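/- **Setting.** Let $d\in\{1,2,3\}$, $T>0$, $I=(0,T)$, let $\Omega\subset\mathbb R^d$ be a bounded polyhedral open set with $\Omega=\operatorname{int}\overline\Omega$, $\Sigma=I\times\Omega$, and let $\partial\Omega$ be partitioned, up to sets of surface measure zero, into disjoint measurable parts $\Gamma_D,\Gamma_N,\Gamma_R$ (some may be empty). Let $\gamma,\eta,\xi>0$ on $\Omega$ and $\kappa>0$ on $\Gamma_R$ be functions of $x$, with $\gamma,\kappa$ measurable and bounded and $\eta,\xi$ Lipschitz on $\overline\Omega$. Let $u\in C^1([0,T];H^2(\Omega))$, with weak derivative $\partial_t^2u\in L^1(0,T;L^2(\Omega))$, solve $$\partial_t^2u+\gamma\,\partial_tu-\partial_t\operatorname{div}(\eta\nabla u)-\operatorname{div}(\xi^2\nabla u)=f\ \text{ a.e. in }\Sigma,$$ $$u=g_D\ \text{on } I\times\Gamma_D,\quad \partial_{\boldsymbol n}u=g_N\ \text{on } I\times\Gamma_N,\quad \partial_{\boldsymbol n}u+\kappa u=g_R\ \text{on } I\times\Gamma_R,\quad u(0)=u_0,\ \ \partial_tu(0)=w_0\ \text{in }\Omega,$$ the boundary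 conditions in the sense of traces. Let $0=t_0<\dots<t_{N_t}=T$, $I_i=(t_{i-1},t_i)$, let $\mathcal T_h=\{K\}$ be a finite decomposition of $\overline\Omega$ into convex polytopes with nonempty, pairwise disjoint interiors, with interior faces $\mathcal E_h^i$ and boundary faces $\mathcal E_h^\partial=\mathcal E_h^D\cup\mathcal E_h^N\cup\mathcal E_h^R$ (lying in $\Gamma_D,\Gamma_N,\Gamma_R$), and $\mathcal E_h=\mathcal E_h^i\cup\mathcal E_h^\partial$; write $\mathcal D_\tau=\{I_i\}$, and let $\int_{\mathcal T_h}$ denote $\sum_{K}\int_K$. On every element $\sigma=I_i\times K$ let a fully connected network with input $(t,x)$, at least one hidden layer, fixed weights and biases of the hidden layers and a $C^2$ activation function be given, and let $\phi^\sigma_1,\dots,\phi^\sigma_{M_\sigma}$ be the outputs of the neurons of its last hidden layer. Let $V_h^\tau$ be the space of the functions on $\Sigma$ whose restriction to each $\sigma$ is a linear combination of the $\phi^\sigma_m$. On interior faces, with the traces $v^\pm$, $\boldsymbol q^\pm$ from the two adjacent elements and their unit outward normals $\boldsymbol n^\pm$, put $[\![v]\!]=v^+\boldsymbol n^++v^-\boldsymbol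 n^-$ and $\{\boldsymbol q\}=\tfrac12(\boldsymbol q^++\boldsymbol q^-)$; on boundary faces $[\![v]\!]=v\boldsymbol n$ and $\{\boldsymbol q\}=\boldsymbol q$. At interior time nodes put $[w(t_i)]=w(t_i^-)-w(t_i^+)$ and $\{w(t_i)\}=\tfrac12(w(t_i^+)+w(t_i^-))$; at the end nodes $[w(t_0)]=-w(t_0)$, $[w(t_{N_t})]=w(t_{N_t})$, $\{w\}=w$. Let $\nabla_h$ and $\partial_\tau$ be the broken gradient and the broken time derivative, and let $\beta_1,\beta_2$ be real penalty parameters that may vary from face to face. Define $$\begin{aligned}B_{h\tau}(u,v)=&-\int_\Sigma\partial_\tau u\,\partial_\tau v+\int_\Sigma\gamma\,\partial_\tau u\,v+\int_\Sigma\eta\,\nabla_h(\partial_\tau u)\cdot\nabla_hv+\int_\Sigma\xi^2\nabla_hu\cdot\nabla_hv\\&+\sum_{i=0}^{N_t-1}\int_{\mathcal T_h}[u(t_i)]\{\partial_\tau v(t_i)\}\,dx+\sum_{i=1}^{N_t}\int_{\mathcal T_h}[v(t_i)]\{\partial_\tau u(t_i)\}\,dx-\sum_{i=0}^{N_t-1}\int_{\mathcal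 T_h}\beta_1[u(t_i)][v(t_i)]\,dx\\&-\int_{\mathcal D_\tau\times\mathcal E_h}\eta\,[\![v]\!]\cdot\{\nabla_h(\partial_\tau u)\}-\int_{\mathcal D_\tau\times(\mathcal E_h^i\cup\mathcal E_h^D)}\xi^2[\![u]\!]\cdot\{\nabla_hv\}-\int_{\mathcal D_\tau\times(\mathcal E_h^i\cup\mathcal E_h^D)}\xi^2[\![v]\!]\cdot\{\nabla_hu\}\\&+\int_{\mathcal D_\tau\times\mathcal E_h^R}\xi^2\kappa\,uv+\int_{\mathcal D_\tau\times(\mathcal E_h^i\cup\mathcal E_h^D)}\beta_2\xi^2[\![u]\!]\cdot[\![v]\!],\end{aligned}$$ $$\begin{aligned}l(v)=&\int_\Sigma fv-\int_{\mathcal T_h}u_0\,\partial_\tau v(0,x)\,dx+\int_{\mathcal T_h}w_0\,v(0,x)\,dx-\int_{\mathcal T_h}\beta_1u_0\,v(0,x)\,dx\\&-\int_{\mathcal D_\tau\times\mathcal E_h^D}\xi^2g_D\,\boldsymbol n\cdot\nabla_hv+\int_{\mathcal D_\tau\times\mathcal E_h^N}\xi^2g_Nv+\int_{\mathcal D_\tau\times\mathcal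 E_h^R}\xi^2g_Rv+\int_{\mathcal D_\tau\times\mathcal E_h^D}\beta_2\xi^2g_Dv.\end{aligned}$$ **Lemma (Consistency).** The scheme is consistent: $B_{h\tau}(u,v)=l(v)$ for every $v\in V_h^\tau$. -/

import Mathlib

open MeasureTheory Set Filter Topology
open scoped ENNReal ContDiff Matrix

noncomputable section

namespace LRNNDG

/-- The space `ℝ^d` with its Euclidean norm. -/
abbrev E (d : ℕ) : Type := EuclideanSpace ℝ (Fin d)

/-- The `(d-1)`-dimensional surface measure of `ℝ^d` (normalised Hausdorff measure). -/
abbrev surf (d : ℕ) : Measure (E d) := Measure.euclideanHausdorffMeasure (d - 1)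

/-! ### The Sobolev space `H²(Ω)` -/

/-- `L²(Ω; F)`. -/
abbrev L2 {d : ℕ} (Ω : Set (E d)) (F : Type) [NormedAddCommGroup F] : Type :=
  Lp F 2 (volume.restrict Ω)

/-- `G` is the weak gradient of `w` in `Ω`. -/
def IsWeakGrad {d : ℕ} (Ω : Set (E d)) (w : E d → ℝ) (G : E d → E d) : Prop :=
  ∀ φ : E d → ℝ, ContDiff ℝ ∞ φ → HasCompactSupport φ → tsupport φ ⊆ Ω →
    ∫ x in Ω, w x • gradient φ x = -∫ x in Ω, φ x • G x

lemma gradient_continuous {d : ℕ} {φ : E d → ℝ} (h : ContDiff ℝ ∞ φ) :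
    Continuous (gradient φ) :=
  (InnerProductSpace.toDual ℝ (E d)).symm.continuous.comp
    (h.continuous_fderiv (by simp))

lemma gradient_compactSupport {d : ℕ} {φ : E d → ℝ} (h : HasCompactSupport φ) :
    HasCompactSupport (gradient φ) :=
  (h.fderiv (𝕜 := ℝ)).comp_left (g := (InnerProductSpace.toDual ℝ (E d)).symm) (by simp)

lemma integrable_smul_gradient {d : ℕ} {Ω : Set (E d)} {φ : E d → ℝ} (h : ContDiff ℝ ∞ φ)
    (hc : HasCompactSupport φ) (w : L2 Ω ℝ) :
    Integrable (fun x => w x • gradient φ x) (volume.restrict Ω) :=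
  memLp_one_iff_integrable.1 (MemLp.smul (p := 2) (q := 2)
    ((gradient_continuous h).memLp_of_hasCompactSupport (gradient_compactSupport hc))
    (Lp.memLp w))

lemma integrable_smul_field {d : ℕ} {Ω : Set (E d)} {φ : E d → ℝ} (h : ContDiff ℝ ∞ φ)
    (hc : HasCompactSupport φ) (G : L2 Ω (E d)) :
    Integrable (fun x => φ x • G x) (volume.restrict Ω) :=
  memLp_one_iff_integrable.1 (MemLp.smul (p := 2) (q := 2)
    (Lp.memLp G) (h.continuous.memLp_of_hasCompactSupport hc))

lemma IsWeakGrad.add {d : ℕ} {Ω : Set (E d)} {w w' : L2 Ω ℝ} {G G' : L2 Ω (E d)}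
    (h : IsWeakGrad Ω w G) (h' : IsWeakGrad Ω w' G') :
    IsWeakGrad Ω (w + w' : L2 Ω ℝ) (G + G' : L2 Ω (E d)) := by
  intro φ h1 h2 h3
  have e1 : ∫ x in Ω, (w + w' : L2 Ω ℝ) x • gradient φ x
      = ∫ x in Ω, (w x • gradient φ x + w' x • gradient φ x) := by
    refine integral_congr_ae ?_
    filter_upwards [Lp.coeFn_add w w'] with x hx
    rw [hx, Pi.add_apply, add_smul]
  have e2 : ∫ x in Ω, φ x • (G + G' : L2 Ω (E d)) x
      = ∫ x in Ω, (φ x • G x + φ x • G' x) := by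
    refine integral_congr_ae ?_
    filter_upwards [Lp.coeFn_add G G'] with x hx
    rw [hx, Pi.add_apply, smul_add]
  rw [e1, e2, integral_add (integrable_smul_gradient h1 h2 w) (integrable_smul_gradient h1 h2 w'),
    integral_add (integrable_smul_field h1 h2 G) (integrable_smul_field h1 h2 G'),
    h φ h1 h2 h3, h' φ h1 h2 h3, neg_add]

lemma IsWeakGrad.smul {d : ℕ} {Ω : Set (E d)} (c : ℝ) {w : L2 Ω ℝ} {G : L2 Ω (E d)}
    (h : IsWeakGrad Ω w G) :
    IsWeakGrad Ω (c • w : L2 Ω ℝ) (c • G : L2 Ω (E d)) := by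
  intro φ h1 h2 h3
  have e1 : ∫ x in Ω, (c • w : L2 Ω ℝ) x • gradient φ x
      = ∫ x in Ω, c • (w x • gradient φ x) := by
    refine integral_congr_ae ?_
    filter_upwards [Lp.coeFn_smul c w] with x hx
    rw [hx, Pi.smul_apply, smul_assoc]
  have e2 : ∫ x in Ω, φ x • (c • G : L2 Ω (E d)) x = ∫ x in Ω, c • (φ x • G x) := by
    refine integral_congr_ae ?_
    filter_upwards [Lp.coeFn_smul c G] with x hx
    rw [hx, Pi.smul_apply, smul_comm]
  rw [e1, e2, integral_smul, integral_smul, h φ h1 h2 h3, smul_neg]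

lemma IsWeakGrad.zero {d : ℕ} {Ω : Set (E d)} :
    IsWeakGrad Ω (0 : L2 Ω ℝ) (0 : L2 Ω (E d)) := by
  simpa using IsWeakGrad.smul (Ω := Ω) (w := 0) (G := 0) 0 (by
    intro φ _ _ _
    have e1 : ∫ x in Ω, (0 : L2 Ω ℝ) x • gradient φ x = ∫ x in Ω, (0 : E d) := by
      refine integral_congr_ae ?_
      filter_upwards [Lp.coeFn_zero ℝ 2 (volume.restrict Ω)] with x hx
      rw [hx, Pi.zero_apply, zero_smul]
    have e2 : ∫ x in Ω, φ x • (0 : L2 Ω (E d)) x = ∫ x in Ω, (0 : E d) := by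
      refine integral_congr_ae ?_
      filter_upwards [Lp.coeFn_zero (E d) 2 (volume.restrict Ω)] with x hx
      rw [hx, Pi.zero_apply, smul_zero]
    rw [e1, e2]; simp)

/-- The Sobolev space `H²(Ω)`: a function of `L²(Ω)` together with its weak gradient and the weak
gradients of the components of the gradient, all in `L²`. The norm inherited from the product is
equivalent to the usual `H²` norm. -/
def H2 {d : ℕ} (Ω : Set (E d)) :
    Submodule ℝ (L2 Ω ℝ × L2 Ω (E d) × (Fin d → L2 Ω (E d))) where
  carrier := {p | IsWeakGrad Ω p.1 p.2.1 ∧ ∀ k, IsWeakGrad Ω (fun x => p.2.1 x k) (p.2.2 k)}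
  add_mem' := by
    rintro ⟨w, G, H⟩ ⟨w', G', H'⟩ ⟨h1, h2⟩ ⟨h1', h2'⟩
    refine ⟨h1.add h1', fun k => ?_⟩
    have key : ∀ (G : L2 Ω (E d)), ∃ g : L2 Ω ℝ, (g : E d → ℝ) =ᵐ[volume.restrict Ω]
        fun x => G x k := fun G =>
      ⟨(EuclideanSpace.proj (𝕜 := ℝ) k).compLp G, ContinuousLinearMap.coeFn_compLp _ G⟩
    have congr : ∀ {a b : E d → ℝ} {K : E d → E d}, a =ᵐ[volume.restrict Ω] b →
        IsWeakGrad Ω a K → IsWeakGrad Ω b K := by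
      intro a b K hab ha φ p1 p2 p3
      rw [← ha φ p1 p2 p3]
      refine integral_congr_ae ?_
      filter_upwards [hab] with x hx
      rw [hx]
    obtain ⟨g, hg⟩ := key G
    obtain ⟨g', hg'⟩ := key G'
    refine congr ?_ ((congr hg.symm (h2 k)).add (congr hg'.symm (h2' k)))
    filter_upwards [Lp.coeFn_add g g', Lp.coeFn_add G G', hg, hg'] with x a1 a2 a3 a4
    change (g + g' : L2 Ω ℝ) x = (G + G' : L2 Ω (E d)) x k
    rw [a1, a2, Pi.add_apply, Pi.add_apply, a3, a4]
    rfl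
  zero_mem' := by
    refine ⟨IsWeakGrad.zero, fun k => ?_⟩
    intro φ h1 h2 h3
    refine Eq.trans ?_ (IsWeakGrad.zero φ h1 h2 h3)
    refine integral_congr_ae ?_
    filter_upwards [Lp.coeFn_zero ℝ 2 (volume.restrict Ω),
      Lp.coeFn_zero (E d) 2 (volume.restrict Ω)] with x hx hy
    change (0 : L2 Ω (E d)) x k • gradient φ x = (0 : L2 Ω ℝ) x • gradient φ x
    rw [hx, hy]
    rfl
  smul_mem' := by
    rintro c ⟨w, G, H⟩ ⟨h1, h2⟩
    refine ⟨h1.smul c, fun k => ?_⟩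
    intro φ p1 p2 p3
    have e1 : ∫ x in Ω, (c • G : L2 Ω (E d)) x k • gradient φ x
        = ∫ x in Ω, c • (G x k • gradient φ x) := by
      refine integral_congr_ae ?_
      filter_upwards [Lp.coeFn_smul c G] with x hx
      simp [hx, mul_smul]
    have e2 : ∫ x in Ω, φ x • (c • H k : L2 Ω (E d)) x = ∫ x in Ω, c • (φ x • H k x) := by
      refine integral_congr_ae ?_
      filter_upwards [Lp.coeFn_smul c (H k)] with x hx
      rw [hx, Pi.smul_apply, smul_comm]
    have := h2 k φ p1 p2 p3
    change ∫ x in Ω, (c • G : L2 Ω (E d)) x k • gradient φ x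
      = -∫ x in Ω, φ x • (c • H k : L2 Ω (E d)) x
    rw [e1, e2, integral_smul, integral_smul, ← smul_neg]
    exact congrArg (c • ·) this

namespace H2

variable {d : ℕ} {Ω : Set (E d)}

/-- The element of `L²(Ω)` underlying an element of `H²(Ω)`. -/
def toL2 (w : H2 Ω) : L2 Ω ℝ := w.1.1

/-- The gradient of an element of `H²(Ω)`. -/
def grad (w : H2 Ω) : L2 Ω (E d) := w.1.2.1

/-- `w.hess k` is the gradient of the `k`-th partial derivative. -/
def hess (w : H2 Ω) (k : Fin d) : L2 Ω (E d) := w.1.2.2 k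

/-- The Laplacian of an element of `H²(Ω)`. -/
def laplacian (w : H2 Ω) (x : E d) : ℝ := ∑ k, hess w k x k

/-- `div (c ∇w) = c Δw + ∇c · ∇w` for a Lipschitz coefficient `c` and `w` in `H²(Ω)`. -/
def divCoeffGrad (c : E d → ℝ) (w : H2 Ω) (x : E d) : ℝ :=
  c x * laplacian w x + inner ℝ (gradient c x) (grad w x)

end H2

/-! ### Traces and normals -/

/-- `g ∈ L²(∂A)` is the trace of the `H¹(A)` function `w`: the boundary values of some functions
that are `C¹` up to the boundary and converge to `w` in `H¹(A)` converge to `g` in `L²(∂A)`. -/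
def IsTrace {d : ℕ} (A : Set (E d)) (w g : E d → ℝ) : Prop :=
  MemLp w 2 (volume.restrict A) ∧ MemLp g 2 ((surf d).restrict (frontier A)) ∧
  ∃ (φ : ℕ → E d → ℝ) (G : E d → E d), MemLp G 2 (volume.restrict A) ∧
    (∀ n, ContDiff ℝ 1 (φ n)) ∧
    Tendsto (fun n => eLpNorm (φ n - w) 2 (volume.restrict A)) atTop (𝓝 0) ∧
    Tendsto (fun n => eLpNorm (gradient (φ n) - G) 2 (volume.restrict A)) atTop (𝓝 0) ∧
    Tendsto (fun n => eLpNorm (φ n - g) 2 ((surf d).restrict (frontier A))) atTop (𝓝 0)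

open Classical in
/-- The trace of `w` on `∂A` (zero if `w` has no trace). -/
def trace {d : ℕ} (A : Set (E d)) (w : E d → ℝ) : E d → ℝ :=
  if h : ∃ g, IsTrace A w g then h.choose else 0

/-- The trace on `∂A` of a vector field, taken componentwise. -/
def traceVec {d : ℕ} (A : Set (E d)) (q : E d → E d) : E d → E d :=
  fun x => WithLp.toLp 2 fun k => trace A (fun y => q y k) x

/-- `ν` is the unit outward normal of `A` at `x`, a point where `∂A` is flat: near `x` the closure
of `A` is the half space on the side opposite to `ν`. For a polyhedral set this covers all points
of the boundary except those on lower-dimensional faces. -/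
def IsOutwardNormal {d : ℕ} (A : Set (E d)) (x ν : E d) : Prop :=
  ‖ν‖ = 1 ∧ ∀ᶠ y in 𝓝 x, (y ∈ closure A ↔ inner ℝ ν (y - x) ≤ 0)

open Classical in
/-- The unit outward normal of `A` (zero where there is none). -/
def outwardNormal {d : ℕ} (A : Set (E d)) (x : E d) : E d :=
  if h : ∃ ν, IsOutwardNormal A x ν then h.choose else 0

/-! ### The initial-boundary value problem -/

/-- The data of the diffusive-viscous wave equation with mixed boundary conditions, with the
standing assumptions on them. -/
structure Problem (d : ℕ) where
  /-- the spatial domain -/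
  Ω : Set (E d)
  /-- the final time -/
  T : ℝ
  /-- diffusive attenuation -/
  γ : E d → ℝ
  /-- viscous attenuation -/
  η : E d → ℝ
  /-- wave speed -/
  ξ : E d → ℝ
  /-- Robin coefficient -/
  κ : E d → ℝ
  /-- source term -/
  f : ℝ → E d → ℝ
  /-- Dirichlet boundary -/
  ΓD : Set (E d)
  /-- Neumann boundary -/
  ΓN : Set (E d)
  /-- Robin boundary -/
  ΓR : Set (E d)
  /-- Dirichlet boundary values -/
  gD : ℝ → E d → ℝ
  /-- Neumann boundary values -/
  gN : ℝ → E d → ℝ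
  /-- Robin boundary values -/
  gR : ℝ → E d → ℝ
  /-- initial value -/
  u0 : E d → ℝ
  /-- initial velocity -/
  w0 : E d → ℝ
  T_pos : 0 < T
  /-- `Ω` is open and lies on one side of its boundary (no slits). -/
  Ω_regular : interior (closure Ω) = Ω
  γ_pos : ∀ x ∈ Ω, 0 < γ x
  η_pos : ∀ x ∈ Ω, 0 < η x
  ξ_pos : ∀ x ∈ Ω, 0 < ξ x
  κ_pos : ∀ x ∈ ΓR, 0 < κ x
  γ_bdd : MemLp γ ∞ (volume.restrict Ω)
  η_lip : ∃ C, LipschitzOnWith C η (closure Ω)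
  ξ_lip : ∃ C, LipschitzOnWith C ξ (closure Ω)
  κ_bdd : MemLp κ ∞ ((surf d).restrict ΓR)
  measurableSet_ΓD : MeasurableSet ΓD
  measurableSet_ΓN : MeasurableSet ΓN
  measurableSet_ΓR : MeasurableSet ΓR
  ΓD_subset : ΓD ⊆ frontier Ω
  ΓN_subset : ΓN ⊆ frontier Ω
  ΓR_subset : ΓR ⊆ frontier Ω
  disjoint_DN : Disjoint ΓD ΓN
  disjoint_DR : Disjoint ΓD ΓR
  disjoint_NR : Disjoint ΓN ΓR
  /-- The three parts cover the boundary up to the (null) interfaces between them. -/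
  cover : surf d (frontier Ω \ (ΓD ∪ ΓN ∪ ΓR)) = 0

/-- The time derivative in `H²(Ω)` of a curve `[0, T] → H²(Ω)`, one-sided at `0` and `T`. -/
def timeDeriv {d : ℕ} (P : Problem d) (u : ℝ → H2 P.Ω) (t : ℝ) : H2 P.Ω :=
  derivWithin u (Icc 0 P.T) t

/-- `a` is the weak time derivative on `(0, T)` of the `L²(Ω)`-valued function `w`. -/
def IsWeakTimeDeriv {d : ℕ} {Ω : Set (E d)} (T : ℝ) (w a : ℝ → L2 Ω ℝ) : Prop :=
  ∀ θ : ℝ → ℝ, ContDiff ℝ ∞ θ → HasCompactSupport θ → tsupport θ ⊆ Ioo 0 T →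
    ∫ t in Ioo 0 T, deriv θ t • w t = -∫ t in Ioo 0 T, θ t • a t

/-- `u` solves the initial-boundary value problem: the equation holds almost everywhere, with
`∂²u/∂t² ∈ L¹(0, T; L²(Ω))` in the weak sense, the boundary conditions hold in the sense of traces
on `∂Ω`, and the initial conditions hold in `L²(Ω)`. -/
structure IsSolution {d : ℕ} (P : Problem d) (u : ℝ → H2 P.Ω) : Prop where
  equation : ∃ utt : ℝ → L2 P.Ω ℝ, IntegrableOn utt (Ioo 0 P.T) ∧
    IsWeakTimeDeriv P.T (fun t => H2.toL2 (timeDeriv P u t)) utt ∧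
    ∀ᵐ t ∂(volume.restrict (Ioo 0 P.T)), ∀ᵐ x ∂(volume.restrict P.Ω),
      utt t x + P.γ x * H2.toL2 (timeDeriv P u t) x
        - H2.divCoeffGrad P.η (timeDeriv P u t) x
        - H2.divCoeffGrad (fun y => P.ξ y ^ 2) (u t) x = P.f t x
  dirichlet : ∀ᵐ t ∂(volume.restrict (Ioo 0 P.T)), ∃ g : E d → ℝ,
    IsTrace P.Ω (H2.toL2 (u t)) g ∧ ∀ᵐ x ∂((surf d).restrict P.ΓD), g x = P.gD t x
  neumann : ∀ᵐ t ∂(volume.restrict (Ioo 0 P.T)), ∃ p : E d → E d,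
    (∀ k, IsTrace P.Ω (fun x => H2.grad (u t) x k) (fun x => p x k)) ∧
    ∀ᵐ x ∂((surf d).restrict P.ΓN), inner ℝ (p x) (outwardNormal P.Ω x) = P.gN t x
  robin : ∀ᵐ t ∂(volume.restrict (Ioo 0 P.T)), ∃ (p : E d → E d) (g : E d → ℝ),
    (∀ k, IsTrace P.Ω (fun x => H2.grad (u t) x k) (fun x => p x k)) ∧
    IsTrace P.Ω (H2.toL2 (u t)) g ∧
    ∀ᵐ x ∂((surf d).restrict P.ΓR),
      inner ℝ (p x) (outwardNormal P.Ω x) + P.κ x * g x = P.gR t x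
  init_value : ∀ᵐ x ∂(volume.restrict P.Ω), H2.toL2 (u 0) x = P.u0 x
  init_velocity : ∀ᵐ x ∂(volume.restrict P.Ω), H2.toL2 (timeDeriv P u 0) x = P.w0 x

/-! ### The space-time mesh -/

/-- A partition of `(0, T)` into `Nt` intervals and of `closure Ω` into `Ns` convex polytopes. -/
structure Mesh {d : ℕ} (P : Problem d) (Nt Ns : ℕ) where
  /-- the time nodes -/
  node : Fin (Nt + 1) → ℝ
  node_strictMono : StrictMono node
  node_zero : node 0 = 0
  node_last : node (Fin.last Nt) = P.T
  /-- the spatial elements -/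
  elem : Fin Ns → Set (E d)
  polytope : ∀ j, ∃ s : Finset (E d), elem j = convexHull ℝ (s : Set (E d))
  interior_nonempty : ∀ j, (interior (elem j)).Nonempty
  disjoint_interior : ∀ j k, j ≠ k → Disjoint (interior (elem j)) (interior (elem k))
  cover : closure P.Ω = ⋃ j, elem j

/-! ### Local randomized neural networks -/

/-- Hidden layers of a fully connected network with `m` inputs and `n` neurons in the last hidden
layer: weights and biases of one or more layers. -/
inductive HiddenNet : ℕ → ℕ → Type
  | first {m n : ℕ} (W : Matrix (Fin n) (Fin m) ℝ) (b : Fin n → ℝ) : HiddenNet m n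
  | next {m k n : ℕ} (N : HiddenNet m k) (W : Matrix (Fin n) (Fin k) ℝ) (b : Fin n → ℝ) :
      HiddenNet m n

/-- The output of the last hidden layer, with activation function `act`. -/
def HiddenNet.eval (act : ℝ → ℝ) : {m n : ℕ} → HiddenNet m n → (Fin m → ℝ) → Fin n → ℝ
  | _, _, .first W b, x => fun i => act ((W *ᵥ x + b) i)
  | _, _, .next N W b, x => fun i => act ((W *ᵥ HiddenNet.eval act N x + b) i)

/-- A randomized network on a space-time element: `M` neurons in the last hidden layer and fixed
hidden parameters. The input is `(t, x)`. -/
structure RandNet (d : ℕ) where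
  /-- number of neurons in the last hidden layer -/
  M : ℕ
  /-- fixed hidden layers -/
  hidden : HiddenNet (d + 1) M

/-- The basis function `φ_m (t, x)` of a randomized network. -/
def RandNet.basis {d : ℕ} (act : ℝ → ℝ) (N : RandNet d) (m : Fin N.M) (t : ℝ) (x : E d) : ℝ :=
  N.hidden.eval act (Fin.cons t fun k => x k) m

/-- The functions `∑ α_m φ_m` of a randomized network with free output weights `α`. -/
def RandNet.space {d : ℕ} (act : ℝ → ℝ) (N : RandNet d) : Set (ℝ → E d → ℝ) :=
  {v | ∃ α : Fin N.M → ℝ, ∀ t x, v t x = ∑ m, α m * N.basis act m t x}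

/-- The local randomized neural network DG space. A piecewise function on the space-time mesh is
the family of its restrictions `v i j` to the elements `(t_i, t_{i+1}) × K_j`. -/
def dgSpace {d Nt Ns : ℕ} (act : ℝ → ℝ) (net : Fin Nt → Fin Ns → RandNet d) :
    Set (Fin Nt → Fin Ns → ℝ → E d → ℝ) :=
  {v | ∀ i j, v i j ∈ (net i j).space act}

/-! ### Broken functions, jumps and averages -/

/-- A function on the space-time mesh with its broken time derivative, broken gradient and broken
gradient of the time derivative: on the slab `i` and the element `j`, at time `t` in the closed
slab, a function of the space variable on the element. -/
structure Broken (d Nt Ns : ℕ) where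
  /-- the value -/
  val : Fin Nt → Fin Ns → ℝ → E d → ℝ
  /-- the broken time derivative -/
  dt : Fin Nt → Fin Ns → ℝ → E d → ℝ
  /-- the broken gradient -/
  grad : Fin Nt → Fin Ns → ℝ → E d → E d
  /-- the broken gradient of the broken time derivative -/
  gradDt : Fin Nt → Fin Ns → ℝ → E d → E d

/-- The restriction of a curve in `H²(Ω)` to the space-time elements. -/
def Broken.ofCurve {d : ℕ} (Nt Ns : ℕ) (P : Problem d) (u : ℝ → H2 P.Ω) : Broken d Nt Ns where
  val _ _ t := H2.toL2 (u t)
  dt _ _ t := H2.toL2 (timeDeriv P u t)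
  grad _ _ t := H2.grad (u t)
  gradDt _ _ t := H2.grad (timeDeriv P u t)

/-- The piecewise (smooth) function with restrictions `v i j`. -/
def Broken.ofPieces {d Nt Ns : ℕ} (v : Fin Nt → Fin Ns → ℝ → E d → ℝ) : Broken d Nt Ns where
  val := v
  dt i j t x := deriv (fun s => v i j s x) t
  grad i j t x := gradient (v i j t) x
  gradDt i j t x := gradient (fun y => deriv (fun s => v i j s y) t) x

namespace Mesh

variable {d Nt Ns : ℕ} {P : Problem d} (𝓜 : Mesh P Nt Ns)

/-- `w(t_i⁻)`, zero at `t_0`. -/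
def left (w : Fin Nt → ℝ → ℝ) (i : Fin (Nt + 1)) : ℝ :=
  if h : i = 0 then 0 else w (i.pred h) (𝓜.node i)

/-- `w(t_i⁺)`, zero at the final time. -/
def right (w : Fin Nt → ℝ → ℝ) (i : Fin (Nt + 1)) : ℝ :=
  if h : i = Fin.last Nt then 0 else w (i.castPred h) (𝓜.node i)

/-- The temporal jump: `w(t_i⁻) - w(t_i⁺)` at interior nodes, `-w` at the first and `w` at the last
node. -/
def tJump (w : Fin Nt → ℝ → ℝ) (i : Fin (Nt + 1)) : ℝ := 𝓜.left w i - 𝓜.right w i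

/-- The temporal average: the mean of `w(t_i⁻)` and `w(t_i⁺)` at interior nodes, the one-sided value
at the first and at the last node. -/
def tAvg (w : Fin Nt → ℝ → ℝ) (i : Fin (Nt + 1)) : ℝ :=
  if i = 0 ∨ i = Fin.last Nt then 𝓜.left w i + 𝓜.right w i
  else (𝓜.left w i + 𝓜.right w i) / 2

/-- The spatial jump `w_j n_j + w_k n_k` at the face between the elements `j` and `k`. -/
def jump (w : Fin Ns → E d → ℝ) (j k : Fin Ns) (x : E d) : E d :=
  trace (𝓜.elem j) (w j) x • outwardNormal (𝓜.elem j) x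
    + trace (𝓜.elem k) (w k) x • outwardNormal (𝓜.elem k) x

/-- The average of a vector field at the face between the elements `j` and `k`. -/
def avg (q : Fin Ns → E d → E d) (j k : Fin Ns) (x : E d) : E d :=
  (1 / 2 : ℝ) • (traceVec (𝓜.elem j) (q j) x + traceVec (𝓜.elem k) (q k) x)

/-- The jump `w n` at a boundary face of the element `j`. -/
def bJump (w : Fin Ns → E d → ℝ) (j : Fin Ns) (x : E d) : E d :=
  trace (𝓜.elem j) (w j) x • outwardNormal (𝓜.elem j) x

/-- The average `q` of a vector field at a boundary face of the element `j`. -/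
def bAvg (q : Fin Ns → E d → E d) (j : Fin Ns) (x : E d) : E d :=
  traceVec (𝓜.elem j) (q j) x

/-- `∫_Σ g dx dt` for a piecewise function. -/
def intVolume (g : Fin Nt → Fin Ns → ℝ → E d → ℝ) : ℝ :=
  ∑ i, ∑ j, ∫ t in 𝓜.node i.castSucc..𝓜.node i.succ, ∫ x in 𝓜.elem j, g i j t x

/-- `∫_{𝒯_h} g dx` for a piecewise function. -/
def intSpace (g : Fin Ns → E d → ℝ) : ℝ := ∑ j, ∫ x in 𝓜.elem j, g j x

/-- `∫ g ds dt` over the interior faces `K_j ∩ K_k` (unordered pairs of elements) in all slabs. -/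
def intInterior (g : Fin Nt → Fin Ns → Fin Ns → ℝ → E d → ℝ) : ℝ :=
  ∑ i, ∑ j, ∑ k ∈ Finset.Ioi j, ∫ t in 𝓜.node i.castSucc..𝓜.node i.succ,
    ∫ x in 𝓜.elem j ∩ 𝓜.elem k, g i j k t x ∂(surf d)

/-- `∫ g ds dt` over the boundary faces that belong to the part `Γ` of `∂Ω`, in all slabs. -/
def intBoundary (Γ : Set (E d)) (g : Fin Nt → Fin Ns → ℝ → E d → ℝ) : ℝ :=
  ∑ i, ∑ j, ∫ t in 𝓜.node i.castSucc..𝓜.node i.succ,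
    ∫ x in frontier (𝓜.elem j) ∩ Γ, g i j t x ∂(surf d)

/-- `∫ c ⟦w⟧ · {q} ds dt` over the interior faces and the boundary faces in `Γ`, in all slabs. -/
def intJumpAvg (Γ : Set (E d)) (c : E d → ℝ) (w : Fin Nt → Fin Ns → ℝ → E d → ℝ)
    (q : Fin Nt → Fin Ns → ℝ → E d → E d) : ℝ :=
  𝓜.intInterior (fun i j k t x => c x *
      inner ℝ (𝓜.jump (fun l => w i l t) j k x) (𝓜.avg (fun l => q i l t) j k x))
    + 𝓜.intBoundary Γ (fun i j t x => c x *
      inner ℝ (𝓜.bJump (fun l => w i l t) j x) (𝓜.bAvg (fun l => q i l t) j x))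

/-- `∫ β ⟦w⟧ · ⟦v⟧ ds dt` over the interior faces and the boundary faces in `Γ`, in all slabs. -/
def intJumpJump (Γ : Set (E d)) (β : Fin Nt → E d → ℝ) (w v : Fin Nt → Fin Ns → ℝ → E d → ℝ) : ℝ :=
  𝓜.intInterior (fun i j k t x => β i x *
      inner ℝ (𝓜.jump (fun l => w i l t) j k x) (𝓜.jump (fun l => v i l t) j k x))
    + 𝓜.intBoundary Γ (fun i j t x => β i x *
      inner ℝ (𝓜.bJump (fun l => w i l t) j x) (𝓜.bJump (fun l => v i l t) j x))

/-- The bilinear form `B_{hτ}`. The penalty `β₁ n j` belongs to the temporal face `{t_n} × K_j`, the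
penalty `β₂ i` is a function on the spatial faces of the slab `i` (for instance constant on every
face). -/
def B (β₁ : Fin (Nt + 1) → Fin Ns → ℝ) (β₂ : Fin Nt → E d → ℝ) (u v : Broken d Nt Ns) : ℝ :=
  - 𝓜.intVolume (fun i j t x => u.dt i j t x * v.dt i j t x)
  + 𝓜.intVolume (fun i j t x => P.γ x * u.dt i j t x * v.val i j t x)
  + 𝓜.intVolume (fun i j t x => P.η x * inner ℝ (u.gradDt i j t x) (v.grad i j t x))
  + 𝓜.intVolume (fun i j t x => P.ξ x ^ 2 * inner ℝ (u.grad i j t x) (v.grad i j t x))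
  + ∑ n : Fin Nt, 𝓜.intSpace (fun j x =>
      𝓜.tJump (fun i t => u.val i j t x) n.castSucc * 𝓜.tAvg (fun i t => v.dt i j t x) n.castSucc)
  + ∑ n : Fin Nt, 𝓜.intSpace (fun j x =>
      𝓜.tJump (fun i t => v.val i j t x) n.succ * 𝓜.tAvg (fun i t => u.dt i j t x) n.succ)
  - ∑ n : Fin Nt, 𝓜.intSpace (fun j x => β₁ n.castSucc j *
      𝓜.tJump (fun i t => u.val i j t x) n.castSucc * 𝓜.tJump (fun i t => v.val i j t x) n.castSucc)
  - 𝓜.intJumpAvg (frontier P.Ω) P.η v.val u.gradDt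
  - 𝓜.intJumpAvg P.ΓD (fun x => P.ξ x ^ 2) u.val v.grad
  - 𝓜.intJumpAvg P.ΓD (fun x => P.ξ x ^ 2) v.val u.grad
  + 𝓜.intBoundary P.ΓR (fun i j t x => P.ξ x ^ 2 * P.κ x *
      trace (𝓜.elem j) (u.val i j t) x * trace (𝓜.elem j) (v.val i j t) x)
  + 𝓜.intJumpJump P.ΓD (fun i x => β₂ i x * P.ξ x ^ 2) u.val v.val

/-- The linear form `l`. -/
def l [NeZero Nt] (β₁ : Fin (Nt + 1) → Fin Ns → ℝ) (β₂ : Fin Nt → E d → ℝ)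
    (v : Broken d Nt Ns) : ℝ :=
  𝓜.intVolume (fun i j t x => P.f t x * v.val i j t x)
  - 𝓜.intSpace (fun j x => P.u0 x * v.dt 0 j 0 x)
  + 𝓜.intSpace (fun j x => P.w0 x * v.val 0 j 0 x)
  - 𝓜.intSpace (fun j x => β₁ 0 j * P.u0 x * v.val 0 j 0 x)
  - 𝓜.intBoundary P.ΓD (fun i j t x => P.ξ x ^ 2 * P.gD t x *
      inner ℝ (outwardNormal (𝓜.elem j) x) (traceVec (𝓜.elem j) (v.grad i j t) x))
  + 𝓜.intBoundary P.ΓN (fun i j t x => P.ξ x ^ 2 * P.gN t x *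
      trace (𝓜.elem j) (v.val i j t) x)
  + 𝓜.intBoundary P.ΓR (fun i j t x => P.ξ x ^ 2 * P.gR t x *
      trace (𝓜.elem j) (v.val i j t) x)
  + 𝓜.intBoundary P.ΓD (fun i j t x => β₂ i x * P.ξ x ^ 2 * P.gD t x *
      trace (𝓜.elem j) (v.val i j t) x)

end Mesh

end LRNNDG

end

open LRNNDG

open MeasureTheory Set Filter Topology
open scoped ENNReal ContDiff Matrix

noncomputable section

namespace LRNNDG

/-! ### Faces and flat boundary points of convex sets -/

/-! Test the equation with a function that is C² on every space-time element and integrate by parts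
element by element, in time for the second derivative and in space for both divergence terms. The
result, `Mesh.element_equation`, contains volume integrals of the bilinear form, the values of `∂ₜu
v` at the two ends of the slab, and fluxes through the boundary of the element. After summation over
the mesh three facts account for everything else. In space, the two traces of an `H¹(Ω)` function on
an interior face agree (`Mesh.trace_ae_eq`) and the two normals are opposite. So the jump of `u`
vanishes there, and the fluxes from the two sides combine into the jump of `v` times the average of
the gradient (`Mesh.sum_flux_eq`). In time, `u` and `∂ₜu` are single curves on `[0, T]`: they have
no jump at interior nodes, and the end values of the slabs sum by parts to the jumps of `v` plus the
initial data (`Mesh.sum_tJump_curve`, `Mesh.sum_tJump_tAvg`). On `∂Ω` the boundary conditions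
replace traces and fluxes by data. The penalties only multiply jumps of `u`, so what is left of them
is data as well, whatever their values.

The analytic work is to justify this with traces defined as limits of boundary values of C¹
functions. Its core is the divergence theorem on a convex polytope for Lipschitz functions,
`IsPolytope.integral_fderiv`. For a radial field `g(x)(x - p)` with `p` interior it follows from
polar coordinates on the cones from `p` over the facets; subtracting the formulas for two centres
gives constant fields. From it come the trace inequality (field `φ²(x - p)`), Green's formula and
the uniqueness of traces; existence of traces also needs the density of C¹ functions, obtained by
contraction towards `p` and mollification. `Mesh.surf_ae_structure` describes the boundary of an
element up to surface null sets.

In time, a continuous curve with a weak derivative in `L¹` is a primitive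
(`sub_eq_integral_of_weak_deriv`), which yields `integral_inner_by_parts`. Splitting time integrals
requires each summand to be integrable; this is why the trace is made a continuous operator
`traceL`, so that boundary integrals of curves in `H²(Ω)` are continuous in time. -/

/-- The face of `K` with outward normal `ν`: the points of `K` that maximise `⟪ν, ·⟫`. -/
def face {d : ℕ} (K : Set (E d)) (ν : E d) : Set (E d) :=
  {x | x ∈ K ∧ ∀ y ∈ K, inner ℝ ν y ≤ inner ℝ ν x}

/-- The points where `K` has outward normal `ν`. -/
def flat {d : ℕ} (K : Set (E d)) (ν : E d) : Set (E d) := {x | IsOutwardNormal K x ν}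

/-- A convex polytope with nonempty interior. -/
structure IsPolytope {d : ℕ} (K : Set (E d)) : Prop where
  exists_vertices : ∃ s : Finset (E d), K = convexHull ℝ (s : Set (E d))
  interior_nonempty : (interior K).Nonempty

section Convex

variable {d : ℕ} {K : Set (E d)} {ν ν' x : E d}

lemma IsPolytope.convex (hK : IsPolytope K) : Convex ℝ K := by
  obtain ⟨s, rfl⟩ := hK.exists_vertices
  exact convex_convexHull ℝ _

lemma IsPolytope.isCompact (hK : IsPolytope K) : IsCompact K := by
  obtain ⟨s, rfl⟩ := hK.exists_vertices
  exact s.finite_toSet.isCompact_convexHull ℝ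

lemma IsPolytope.isClosed (hK : IsPolytope K) : IsClosed K := hK.isCompact.isClosed

/-- Converts a neighbourhood statement into one point on a given ray; all local descriptions of sets
are used through it. The bound by 1 keeps the point on a segment when convexity is to be applied. -/
lemma exists_small_smul {P : E d → Prop} {x : E d} (h : ∀ᶠ y in 𝓝 x, P y) (w : E d) :
    ∃ t : ℝ, 0 < t ∧ t < 1 ∧ P (x + t • w) := by
  have hc : Tendsto (fun t : ℝ => x + t • w) (𝓝[>] 0) (𝓝 x) := by
    have : Continuous fun t : ℝ => x + t • w := by fun_prop
    simpa using (this.tendsto 0).mono_left nhdsWithin_le_nhds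
  have h2 : ∀ᶠ t : ℝ in 𝓝[>] 0, t < 1 :=
    (eventually_lt_nhds one_pos).filter_mono nhdsWithin_le_nhds
  obtain ⟨t, ⟨h3, h4⟩, h5⟩ := ((hc.eventually h).and h2 |>.and self_mem_nhdsWithin).exists
  exact ⟨t, h5, h4, h3⟩

lemma IsOutwardNormal.mem_closure (h : IsOutwardNormal K x ν) : x ∈ closure K :=
  h.2.self_of_nhds.2 (by simp)

/-- Convexity makes the local normal global: a point of `K` can be pulled along the segment towards
`x` until the half-space description applies, and the sign of the inner product does not change. -/
lemma IsOutwardNormal.mem_face (h : IsOutwardNormal K x ν) (hK : Convex ℝ K) (hc : IsClosed K) :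
    x ∈ face K ν := by
  have hx : x ∈ K := hc.closure_eq ▸ h.mem_closure
  refine ⟨hx, fun y hy => ?_⟩
  obtain ⟨t, t0, t1, ht⟩ := exists_small_smul h.2 (y - x)
  have h1 : x + t • (y - x) ∈ closure K := subset_closure <| by
    simpa using hK.add_smul_sub_mem hx hy ⟨t0.le, t1.le⟩
  have h2 := ht.1 h1
  rw [add_sub_cancel_left, inner_smul_right, inner_sub_right] at h2
  nlinarith [nonpos_of_mul_nonpos_right h2 t0]

lemma inner_le_of_isOutwardNormal (h : IsOutwardNormal K x ν) (h' : IsOutwardNormal K x ν')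
    {w : E d} (hw : inner ℝ ν w ≤ 0) : inner ℝ ν' w ≤ 0 := by
  obtain ⟨t, t0, t1, h1, h2⟩ := exists_small_smul (h.2.and h'.2) w
  rw [add_sub_cancel_left, inner_smul_right] at h1 h2
  exact nonpos_of_mul_nonpos_right (h2.1 (h1.2 (mul_nonpos_of_nonneg_of_nonpos t0.le hw))) t0

/-- Testing with the part of `ν'` orthogonal to `ν` bounds the square of `⟪ν, ν'⟫` below by 1, and
testing with `-ν` makes `⟪ν, ν'⟫` nonnegative. With Cauchy–Schwarz it equals 1. -/
lemma eq_of_inner_nonpos_imp (h1 : ‖ν‖ = 1) (h2 : ‖ν'‖ = 1)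
    (h : ∀ w : E d, inner ℝ ν w ≤ 0 → inner ℝ ν' w ≤ 0) : ν = ν' := by
  have a1 : inner ℝ ν ν = (1 : ℝ) := by rw [real_inner_self_eq_norm_sq, h1]; norm_num
  have a2 : inner ℝ ν' ν' = (1 : ℝ) := by rw [real_inner_self_eq_norm_sq, h2]; norm_num
  have b1 := h (ν' - (inner ℝ ν ν' : ℝ) • ν) (by
    rw [inner_sub_right, inner_smul_right, a1]; simp)
  have b2 := h (-ν) (by rw [inner_neg_right, a1]; norm_num)
  rw [inner_sub_right, inner_smul_right, a2, real_inner_comm ν ν'] at b1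
  rw [inner_neg_right, real_inner_comm] at b2
  have b3 : inner ℝ ν ν' = (1 : ℝ) := by
    have := real_inner_le_norm ν ν'
    rw [h1, h2] at this
    nlinarith
  exact (inner_eq_one_iff_of_norm_eq_one h1 h2).1 b3

lemma IsOutwardNormal.unique (h : IsOutwardNormal K x ν) (h' : IsOutwardNormal K x ν') :
    ν = ν' :=
  eq_of_inner_nonpos_imp h.1 h'.1 fun _ hw => inner_le_of_isOutwardNormal h h' hw

lemma IsOutwardNormal.outwardNormal_eq (h : IsOutwardNormal K x ν) : outwardNormal K x = ν := by
  have hex : ∃ ν, IsOutwardNormal K x ν := ⟨ν, h⟩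
  rw [outwardNormal, dif_pos hex]
  exact hex.choose_spec.unique h

lemma IsOutwardNormal.congr {A B : Set (E d)} (h : IsOutwardNormal A x ν)
    (hAB : ∀ᶠ y in 𝓝 x, y ∈ closure A ↔ y ∈ closure B) : IsOutwardNormal B x ν :=
  ⟨h.1, by filter_upwards [h.2, hAB] with y h1 h2; rw [← h2, h1]⟩

lemma face_subset : face K ν ⊆ K := fun _ h => h.1

lemma face_subset_frontier (hν : ν ≠ 0) : face K ν ⊆ frontier K := by
  rintro x ⟨hx, hmax⟩
  refine ⟨subset_closure hx, fun hi => ?_⟩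
  obtain ⟨t, t0, -, ht⟩ := exists_small_smul (mem_interior_iff_mem_nhds.1 hi) ν
  have := hmax _ ht
  rw [inner_add_right, inner_smul_right, real_inner_self_eq_norm_sq] at this
  have h2 : 0 < ‖ν‖ ^ 2 := by positivity
  nlinarith

lemma convex_face (hK : Convex ℝ K) : Convex ℝ (face K ν) := by
  intro x hx y hy a b ha hb hab
  refine ⟨hK hx.1 hy.1 ha hb hab, fun z hz => ?_⟩
  rw [inner_add_right, inner_smul_right, inner_smul_right]
  have h1 := hx.2 z hz
  have h2 := hy.2 z hz
  have h3 : inner ℝ ν z = a * inner ℝ ν z + b * (inner ℝ ν z : ℝ) := by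
    rw [← add_mul, hab, one_mul]
  rw [h3]
  gcongr

lemma isClosed_face (hc : IsClosed K) : IsClosed (face K ν) := by
  have : face K ν = K ∩ ⋂ y ∈ K, {x | inner ℝ ν y ≤ (inner ℝ ν x : ℝ)} := by
    ext x; simp [face]
  rw [this]
  refine hc.inter (isClosed_biInter fun y _ => ?_)
  exact isClosed_le continuous_const (by fun_prop)

/-- The supporting hyperplane theorem: Hahn–Banach separates `x` from the interior, and the weak
inequality extends to `K`, which lies in the closure of its interior. -/
lemma exists_mem_face_of_frontier (hK : Convex ℝ K) (hc : IsClosed K)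
    (hi : (interior K).Nonempty) (hx : x ∈ frontier K) :
    ∃ ν : E d, ‖ν‖ = 1 ∧ x ∈ face K ν := by
  obtain ⟨f, hf⟩ := geometric_hahn_banach_open_point hK.interior isOpen_interior hx.2
  set w := (InnerProductSpace.toDual ℝ (E d)).symm f
  have hw : ∀ y, inner ℝ w y = f y := fun y => by simp [w]
  have hw0 : w ≠ 0 := by
    intro h0
    obtain ⟨y, hy⟩ := hi
    have := hf y hy
    rw [← hw, ← hw, h0] at this
    simp at this
  have hle : ∀ y ∈ K, f y ≤ f x := by
    intro y hy
    have : y ∈ closure (interior K) := by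
      rw [hK.closure_interior_eq_closure_of_nonempty_interior hi]; exact subset_closure hy
    exact closure_minimal (fun z hz => (hf z hz).le)
      (isClosed_le f.continuous continuous_const) this
  refine ⟨(‖w‖⁻¹ : ℝ) • w, by simp [norm_smul, hw0], hc.frontier_subset hx, fun y hy => ?_⟩
  rw [real_inner_smul_left, real_inner_smul_left, hw, hw]
  exact mul_le_mul_of_nonneg_left (hle y hy) (by positivity)

/-- If a convex combination of vertices maximises `⟪ν, ·⟫` on `K`, so does every vertex with nonzero
weight. Hence the face of `ν` contains the hull of these vertices, and one normal for each of the
finitely many sets of vertices is enough. -/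
lemma IsPolytope.exists_normals (hK : IsPolytope K) :
    ∃ N : Finset (E d), (∀ ν ∈ N, ‖ν‖ = 1) ∧ frontier K ⊆ ⋃ ν ∈ N, face K ν := by
  classical
  obtain ⟨s, hs⟩ := hK.exists_vertices
  have key : ∀ x ∈ frontier K, ∃ a ∈ s.powerset, x ∈ convexHull ℝ (a : Set (E d)) ∧
      ∃ ν : E d, ‖ν‖ = 1 ∧ (a : Set (E d)) ⊆ face K ν := by
    intro x hx
    obtain ⟨ν, hν, hxν⟩ :=
      exists_mem_face_of_frontier hK.convex hK.isClosed hK.interior_nonempty hx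
    have hxK : x ∈ convexHull ℝ (s : Set (E d)) := hs ▸ hxν.1
    obtain ⟨w, hw0, hw1, hwx⟩ := Finset.mem_convexHull'.1 hxK
    have hsub : ∀ y ∈ s, y ∈ K := fun y hy => hs ▸ subset_convexHull ℝ _ (by exact_mod_cast hy)
    refine ⟨s.filter (fun y => w y ≠ 0), Finset.mem_powerset.2 (Finset.filter_subset _ _), ?_,
      ν, hν, ?_⟩
    · refine Finset.mem_convexHull'.2 ⟨w, fun y hy => hw0 y (Finset.mem_filter.1 hy).1, ?_, ?_⟩
      · rw [← hw1]; exact Finset.sum_filter_ne_zero s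
      · rw [← hwx]
        refine Finset.sum_filter_of_ne fun y _ hy h0 => hy (by simp [h0])
    · intro y hy
      obtain ⟨hys, hyw⟩ := Finset.mem_filter.1 (Finset.mem_coe.1 hy)
      refine ⟨hsub y hys, ?_⟩
      suffices h : inner ℝ ν x ≤ (inner ℝ ν y : ℝ) from fun z hz => (hxν.2 z hz).trans h
      by_contra! hlt
      have h1 : inner ℝ ν x = ∑ z ∈ s, w z * (inner ℝ ν z : ℝ) := by
        rw [← hwx, inner_sum]; simp [inner_smul_right]
      have h2 : ∑ z ∈ s, w z * (inner ℝ ν z : ℝ) < ∑ z ∈ s, w z * (inner ℝ ν x : ℝ) := by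
        refine Finset.sum_lt_sum (fun z hz => ?_) ⟨y, hys, ?_⟩
        · exact mul_le_mul_of_nonneg_left (hxν.2 z (hsub z hz)) (hw0 z hz)
        · exact mul_lt_mul_of_pos_left hlt (lt_of_le_of_ne (hw0 y hys) (Ne.symm hyw))
      rw [← Finset.sum_mul, hw1, one_mul, ← h1] at h2
      exact lt_irrefl _ h2
  -- One normal per set of vertices. Sets that lie in no common face receive 0, which the filter on
  -- the norm discards.
  let pick : Finset (E d) → E d := fun a =>
    if h : ∃ ν : E d, ‖ν‖ = 1 ∧ (a : Set (E d)) ⊆ face K ν then h.choose else 0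
  refine ⟨(s.powerset.image pick).filter (fun ν => ‖ν‖ = 1),
    fun ν h => (Finset.mem_filter.1 h).2, fun x hx => ?_⟩
  obtain ⟨a, ha, hxa, hex⟩ := key x hx
  have hp : pick a = hex.choose := dif_pos hex
  refine mem_iUnion₂.2 ⟨pick a, Finset.mem_filter.2 ⟨Finset.mem_image_of_mem _ ha, ?_⟩, ?_⟩
  · rw [hp]; exact hex.choose_spec.1
  · rw [hp]
    exact convexHull_min hex.choose_spec.2 (convex_face hK.convex) hxa

/-- The inner product with `ν` is constant on the face, so the half-space can be anchored at a fixed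
`p` instead of the moving point. This displays the flat part as a closed set intersected with an
open one, hence measurable. -/
lemma flat_eq_inter (hK : Convex ℝ K) (hc : IsClosed K) (hν : ‖ν‖ = 1) {p : E d}
    (hp : p ∈ face K ν) :
    flat K ν = face K ν ∩ {x | ∀ᶠ y in 𝓝 x, (y ∈ K ↔ inner ℝ ν y ≤ (inner ℝ ν p : ℝ))} := by
  have heq : ∀ x ∈ face K ν, (inner ℝ ν x : ℝ) = inner ℝ ν p := fun x hx =>
    le_antisymm (hp.2 x hx.1) (hx.2 p hp.1)
  ext x
  constructor
  · intro h
    have hx := IsOutwardNormal.mem_face h hK hc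
    refine ⟨hx, ?_⟩
    filter_upwards [h.2] with y hy
    rw [hc.closure_eq] at hy
    rw [hy, inner_sub_right, heq x hx, sub_nonpos]
  · rintro ⟨hx, h⟩
    refine ⟨hν, ?_⟩
    filter_upwards [h] with y hy
    rw [hc.closure_eq, hy, inner_sub_right, heq x hx, sub_nonpos]

lemma measurableSet_flat (hK : Convex ℝ K) (hc : IsClosed K) (hν : ‖ν‖ = 1) :
    MeasurableSet (flat K ν) := by
  by_cases hne : (face K ν).Nonempty
  · obtain ⟨p, hp⟩ := hne
    rw [flat_eq_inter hK hc hν hp]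
    exact (isClosed_face hc).measurableSet.inter isOpen_setOfPred_eventually_nhds.measurableSet
  · rw [not_nonempty_iff_eq_empty] at hne
    have : flat K ν = ∅ := by
      rw [← subset_empty_iff, ← hne]
      exact fun x hx => IsOutwardNormal.mem_face hx hK hc
    rw [this]; exact MeasurableSet.empty

/-- The isometric parametrisation of the hyperplane through `a` with normal `ν`. -/
lemma isometry_add_hyperplane (a ν : E d) :
    Isometry (fun y : (ℝ ∙ ν)ᗮ => a + (y : E d)) :=
  Isometry.of_dist_eq fun y z => by simp [Subtype.dist_eq]

lemma range_add_hyperplane (a ν : E d) :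
    range (fun y : (ℝ ∙ ν)ᗮ => a + (y : E d)) = {x | inner ℝ ν (x - a) = (0 : ℝ)} := by
  ext x
  constructor
  · rintro ⟨y, rfl⟩
    simpa using Submodule.mem_orthogonal_singleton_iff_inner_right.1 y.2
  · intro h
    exact ⟨⟨x - a, Submodule.mem_orthogonal_singleton_iff_inner_right.2 h⟩, by simp⟩

lemma finrank_hyperplane (hν : ‖ν‖ = 1) : Module.finrank ℝ (ℝ ∙ ν)ᗮ = d - 1 := by
  have h0 : ν ≠ 0 := by rintro rfl; simp at hν
  have := (ℝ ∙ ν).finrank_add_finrank_orthogonal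
  rw [finrank_span_singleton h0, finrank_euclideanSpace_fin] at this
  omega

/-- Isometries transport Hausdorff measure, and on a Euclidean space of dimension `d - 1` the
normalised `(d - 1)`-dimensional Hausdorff measure is Lebesgue measure. All computations with the
surface measure pass through this identity. -/
lemma map_volume_hyperplane (hν : ‖ν‖ = 1) (a : E d) :
    Measure.map (fun y : (ℝ ∙ ν)ᗮ => a + (y : E d)) volume
      = (surf d).restrict {x | inner ℝ ν (x - a) = (0 : ℝ)} := by
  rw [← range_add_hyperplane, ← (isometry_add_hyperplane a ν).map_euclideanHausdorffMeasure,
    ← InnerProductSpace.euclideanHausdorffMeasure_eq_volume, finrank_hyperplane hν]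

lemma measurableEmbedding_add_hyperplane (a ν : E d) :
    MeasurableEmbedding (fun y : (ℝ ∙ ν)ᗮ => a + (y : E d)) :=
  (isometry_add_hyperplane a ν).isClosedEmbedding.measurableEmbedding

/-- The surface measure on a part `Z` of a hyperplane. -/
lemma map_volume_restrict_hyperplane (hν : ‖ν‖ = 1) (a : E d) {Z : Set (E d)}
    (hZ : MeasurableSet Z) (hZa : Z ⊆ {x | inner ℝ ν (x - a) = (0 : ℝ)}) :
    Measure.map (fun y : (ℝ ∙ ν)ᗮ => a + (y : E d))
      (volume.restrict ((fun y : (ℝ ∙ ν)ᗮ => a + (y : E d)) ⁻¹' Z)) = (surf d).restrict Z := by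
  rw [← (measurableEmbedding_add_hyperplane a ν).restrict_map, map_volume_hyperplane hν,
    Measure.restrict_restrict hZ, inter_eq_self_of_subset_left hZa]

lemma face_subset_hyperplane {a : E d} (ha : a ∈ face K ν) :
    face K ν ⊆ {x | inner ℝ ν (x - a) = (0 : ℝ)} := fun x hx => by
  simp only [mem_ofPred_eq, inner_sub_right]
  linarith [ha.2 x hx.1, hx.2 a ha.1]

/-- A relatively interior point of a face is flat: with `p` interior to `K`, a point near it and
below the supporting hyperplane lies on a segment from `p` to a nearby point of the hyperplane,
which still belongs to `K`. -/
lemma isOutwardNormal_of_mem_interior (hK : Convex ℝ K) (hc : IsClosed K)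
    (hi : (interior K).Nonempty) (hν : ‖ν‖ = 1) {a : E d} (ha : a ∈ face K ν) {y : (ℝ ∙ ν)ᗮ}
    (hy : y ∈ interior ((fun y : (ℝ ∙ ν)ᗮ => a + (y : E d)) ⁻¹' K)) :
    IsOutwardNormal K (a + (y : E d)) ν := by
  refine ⟨hν, ?_⟩
  rw [hc.closure_eq]
  have hyν : inner ℝ ν (y : E d) = (0 : ℝ) :=
    Submodule.mem_orthogonal_singleton_iff_inner_right.1 y.2
  obtain ⟨p, hp⟩ := hi
  have hν0 : ν ≠ 0 := by rintro rfl; simp at hν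
  have hpa : (inner ℝ ν p : ℝ) < inner ℝ ν a := by
    refine lt_of_le_of_ne (ha.2 p (interior_subset hp)) fun he => ?_
    exact (face_subset_frontier hν0 (show p ∈ face K ν from
      ⟨interior_subset hp, fun z hz => he ▸ ha.2 z hz⟩)).2 hp
  set h : ℝ := inner ℝ ν a - inner ℝ ν p with hh
  have h0 : 0 < h := sub_pos.2 hpa
  set x := a + (y : E d) with hx
  have hxa : (inner ℝ ν x : ℝ) = inner ℝ ν a := by rw [hx, inner_add_right, hyν, add_zero]
  -- `τ z` is the weight of `p`: it is 1 at `p` and 0 on the hyperplane. The point `a + q z` is the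
  -- projection of `z` from `p` onto the hyperplane.
  let τ : E d → ℝ := fun z => (inner ℝ ν a - inner ℝ ν z) / h
  have hτx : τ x = 0 := by simp [τ, hxa]
  have hτc : Continuous τ := by fun_prop
  let q : E d → E d := fun z => (1 - τ z)⁻¹ • (z - τ z • p) - a
  have hqx : q x = y := by simp only [q, hτx]; simp [hx]
  have hqc : ContinuousAt q x := by
    refine ContinuousAt.sub (ContinuousAt.fun_smul (ContinuousAt.fun_inv₀ ?_ ?_) ?_) continuousAt_const
    · fun_prop
    · simp [hτx]
    · fun_prop
  have hτ1 : ∀ᶠ z in 𝓝 x, τ z < 1 :=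
    hτc.continuousAt.eventually_lt_const (by simp [hτx])
  obtain ⟨ε, hε, hball⟩ := Metric.mem_nhds_iff.1 (mem_interior_iff_mem_nhds.1 hy)
  have hqε : ∀ᶠ z in 𝓝 x, dist (q z) y < ε := by
    have := hqc.tendsto
    rw [hqx] at this
    exact (tendsto_iff_dist_tendsto_zero.1 this).eventually_lt_const hε
  filter_upwards [hτ1, hqε] with z hz1 hz2
  rw [inner_sub_right, hxa]
  constructor
  · intro hz; linarith [ha.2 z hz]
  · intro hz
    have hτ0 : 0 ≤ τ z := div_nonneg (by linarith) h0.le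
    have h1 : 0 < 1 - τ z := by linarith
    have hin : inner ℝ ν (q z) = (0 : ℝ) := by
      have e : τ z * h = inner ℝ ν a - inner ℝ ν z := div_mul_cancel₀ _ h0.ne'
      simp only [q, inner_sub_right, inner_smul_right]
      rw [sub_eq_zero, inv_mul_eq_iff_eq_mul₀ h1.ne']
      linear_combination e - τ z * hh
    have hmem : (⟨q z, Submodule.mem_orthogonal_singleton_iff_inner_right.2 hin⟩ : (ℝ ∙ ν)ᗮ)
        ∈ Metric.ball y ε := by simpa [Subtype.dist_eq] using hz2
    have hqK : a + q z ∈ K := hball hmem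
    have : z = (1 - τ z) • (a + q z) + τ z • p := by
      simp only [q]
      rw [add_sub_cancel, smul_smul, mul_inv_cancel₀ h1.ne', one_smul, sub_add_cancel]
    rw [this]
    exact hK hqK (interior_subset hp) h1.le hτ0 (by ring)

/-- Non-flat points of the face lie on the relative boundary of a convex subset of the hyperplane,
and the boundary of a convex set is Lebesgue null. -/
lemma surf_face_diff_flat (hK : Convex ℝ K) (hc : IsClosed K)
    (hi : (interior K).Nonempty) (hν : ‖ν‖ = 1) : surf d (face K ν \ flat K ν) = 0 := by
  rcases (face K ν).eq_empty_or_nonempty with h0 | ⟨a, ha⟩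
  · simp [h0]
  set ι := fun y : (ℝ ∙ ν)ᗮ => a + (y : E d)
  have hm : MeasurableSet (face K ν \ flat K ν) :=
    (isClosed_face hc).measurableSet.diff (measurableSet_flat hK hc hν)
  have h1 : (surf d).restrict {x | inner ℝ ν (x - a) = (0 : ℝ)} (face K ν \ flat K ν)
      = surf d (face K ν \ flat K ν) := by
    rw [Measure.restrict_apply hm, inter_eq_self_of_subset_left
      (sdiff_subset.trans (face_subset_hyperplane ha))]
  rw [← h1, ← map_volume_hyperplane hν, Measure.map_apply (by fun_prop) hm]
  have hconv : Convex ℝ (ι ⁻¹' K) := by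
    intro y hy z hz s t hs ht hst
    have := hK hy hz hs ht hst
    simp only [mem_preimage, ι] at this ⊢
    convert! this using 1
    push_cast
    rw [smul_add, smul_add, add_add_add_comm, ← add_smul, hst, one_smul]
  refine measure_mono_null ?_ (hconv.addHaar_frontier volume)
  rintro y ⟨hy1, hy2⟩
  refine ⟨subset_closure hy1.1, fun hy => hy2 ?_⟩
  exact isOutwardNormal_of_mem_interior hK hc hi hν ha hy

lemma surf_face_lt_top (hK : IsCompact K) (hν : ‖ν‖ = 1) : surf d (face K ν) < ⊤ := by
  rcases (face K ν).eq_empty_or_nonempty with h0 | ⟨a, ha⟩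
  · simp [h0]
  have hm : MeasurableSet (face K ν) := (isClosed_face hK.isClosed).measurableSet
  have h1 : (surf d).restrict {x | inner ℝ ν (x - a) = (0 : ℝ)} (face K ν)
      = surf d (face K ν) := by
    rw [Measure.restrict_apply hm, inter_eq_self_of_subset_left (face_subset_hyperplane ha)]
  rw [← h1, ← map_volume_hyperplane hν, Measure.map_apply (by fun_prop) hm]
  refine ((isometry_add_hyperplane a ν).isClosedEmbedding.isCompact_preimage ?_).measure_lt_top
  exact hK.of_isClosed_subset (isClosed_face hK.isClosed) face_subset

end Convex

/-! ### Cones over flat pieces -/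

section Cone

variable {d : ℕ} {ν p : E d}

/-- The orthogonal decomposition `x = p + s ν + y`. -/
lemma measurePreserving_slice (hν : ‖ν‖ = 1) (p : E d) :
    MeasurePreserving (fun z : ℝ × (ℝ ∙ ν)ᗮ => p + z.1 • ν + (z.2 : E d))
      (volume.prod volume) volume := by
  have h1 := ((ℝ ∙ ν).measurePreserving_measurableEquivProd p).symm
  rw [InnerProductSpace.euclideanHausdorffMeasure_eq_volume] at h1
  have h2 : MeasurePreserving (Prod.map (LinearIsometryEquiv.toSpanUnitSingleton (𝕜 := ℝ) ν hν) id :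
      ℝ × (ℝ ∙ ν)ᗮ → (ℝ ∙ ν) × (ℝ ∙ ν)ᗮ) (volume.prod volume) (volume.prod volume) :=
    (LinearIsometryEquiv.measurePreserving _).prod (MeasurePreserving.id _)
  have := h1.comp h2
  convert! this using 1
  ext z : 1
  simp [add_comm, add_left_comm]

/-- The point at height fraction `r` on the ray from `p` through `p + h ν + y`. -/
def coneMap (p ν : E d) (h : ℝ) (z : ℝ × (ℝ ∙ ν)ᗮ) : E d := p + z.1 • (h • ν + (z.2 : E d))

lemma continuous_coneMap {h : ℝ} : Continuous (coneMap p ν h) := by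
  unfold coneMap; fun_prop

lemma lintegral_smul_comp {W : Type*} [NormedAddCommGroup W] [NormedSpace ℝ W]
    [MeasurableSpace W] [BorelSpace W] [FiniteDimensional ℝ W] (μ : Measure W) [μ.IsAddHaarMeasure]
    {c : ℝ} (hc : 0 < c) (f : W → ℝ≥0∞) :
    ∫⁻ y, f y ∂μ = ENNReal.ofReal (c ^ Module.finrank ℝ W) * ∫⁻ y, f (c • y) ∂μ := by
  have h1 : ∫⁻ y, f (c • y) ∂μ = ∫⁻ y, f y ∂(Measure.map (c • ·) μ) :=
    ((MeasurableEquiv.smul₀ c hc.ne').measurableEmbedding.lintegral_map f).symm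
  rw [h1, Measure.map_addHaar_smul μ hc.ne', lintegral_smul_measure, smul_eq_mul, ← mul_assoc,
    ← ENNReal.ofReal_mul (by positivity), abs_of_pos (by positivity),
    mul_inv_cancel₀ (by positivity), ENNReal.ofReal_one, one_mul]

/-- The `ν`-component of the image determines `r` because `h > 0`, and then `y` follows because `r ≠
0`. The value `r = 0` is left out since it is mapped to `p` for every `y`. Injectivity also makes
the cone a Borel set. -/
lemma injOn_coneMap (hν : ‖ν‖ = 1) {h : ℝ} (hh : 0 < h) :
    InjOn (coneMap p ν h) (Ioc 0 1 ×ˢ univ) := by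
  rintro ⟨r, y⟩ ⟨hr, -⟩ ⟨r', y'⟩ ⟨-, -⟩ he
  have hy : ∀ y : (ℝ ∙ ν)ᗮ, inner ℝ ν (y : E d) = (0 : ℝ) := fun y =>
    Submodule.mem_orthogonal_singleton_iff_inner_right.1 y.2
  have he' : r • (h • ν + (y : E d)) = r' • (h • ν + (y' : E d)) := add_left_cancel he
  have h1 := congrArg (fun x => (inner ℝ ν x : ℝ)) he'
  simp only [inner_smul_right, inner_add_right, hy, real_inner_self_eq_norm_sq, hν] at h1
  have h2 : r = r' := by
    have : r * h = r' * h := by linarith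
    exact mul_right_cancel₀ hh.ne' this
  subst h2
  have h3 := smul_right_injective (E d) hr.1.ne' he'
  exact Prod.ext rfl (Subtype.ext (add_left_cancel h3))

lemma measurableSet_cone (hν : ‖ν‖ = 1) {h : ℝ} (hh : 0 < h) {A : Set (ℝ ∙ ν)ᗮ}
    (hA : MeasurableSet A) : MeasurableSet (coneMap p ν h '' (Ioc 0 1 ×ˢ A)) :=
  (measurableSet_Ioc.prod hA).image_of_measurable_injOn continuous_coneMap.measurable
    ((injOn_coneMap hν hh).mono (prod_mono_right (subset_univ _)))

/-- Slice orthogonally to `ν` by Tonelli, then rescale: the height `s = h r` contributes the factor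
`h`, and the dilation of the slice by `r` contributes `r ^ (d - 1)`. -/
lemma lintegral_cone (hν : ‖ν‖ = 1) {h : ℝ} (hh : 0 < h) {A : Set (ℝ ∙ ν)ᗮ}
    (hA : MeasurableSet A) {g : E d → ℝ≥0∞} (hg : Measurable g) :
    ∫⁻ x in coneMap p ν h '' (Ioc 0 1 ×ˢ A), g x
      = ∫⁻ z in Ioc 0 1 ×ˢ A, ENNReal.ofReal (h * z.1 ^ (d - 1)) * g (coneMap p ν h z)
          ∂(volume.prod volume) := by
  set C := coneMap p ν h '' (Ioc 0 1 ×ˢ A) with hC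
  have hCm : MeasurableSet C := measurableSet_cone hν hh hA
  have hyν : ∀ y : (ℝ ∙ ν)ᗮ, inner ℝ ν (y : E d) = (0 : ℝ) := fun y =>
    Submodule.mem_orthogonal_singleton_iff_inner_right.1 y.2
  have hmeas : Measurable (C.indicator g) := hg.indicator hCm
  have hcoord : ∀ (r : ℝ) (y : (ℝ ∙ ν)ᗮ), r ≠ 0 →
      p + (h * r) • ν + ((r • y : (ℝ ∙ ν)ᗮ) : E d) = coneMap p ν h (r, y) := by
    intro r y _
    simp only [coneMap, Submodule.coe_smul, smul_add, smul_smul, add_assoc, mul_comm h r]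
  have hind : ∀ (r : ℝ) (y : (ℝ ∙ ν)ᗮ), r ≠ 0 → (coneMap p ν h (r, y) ∈ C ↔ r ∈ Ioc 0 1 ∧ y ∈ A) := by
    intro r y hr
    constructor
    · rintro ⟨⟨r', y'⟩, ⟨hr', hy'⟩, he⟩
      have h1 := congrArg (fun x => (inner ℝ ν (x - p) : ℝ)) he
      simp only [coneMap, add_sub_cancel_left, inner_smul_right, inner_add_right, hyν,
        real_inner_self_eq_norm_sq, hν] at h1
      have h2 : r' = r := by
        have : r' * h = r * h := by linarith
        exact mul_right_cancel₀ hh.ne' this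
      subst h2
      have := injOn_coneMap (p := p) hν hh (mk_mem_prod hr' (mem_univ y'))
        (mk_mem_prod hr' (mem_univ y)) he
      rw [Prod.mk.injEq] at this
      exact ⟨hr', this.2 ▸ hy'⟩
    · rintro ⟨h1, h2⟩
      exact ⟨(r, y), ⟨h1, h2⟩, rfl⟩
  calc ∫⁻ x in C, g x = ∫⁻ x, C.indicator g x := (lintegral_indicator hCm g).symm
    _ = ∫⁻ z : ℝ × (ℝ ∙ ν)ᗮ, C.indicator g (p + z.1 • ν + (z.2 : E d)) ∂(volume.prod volume) :=
        ((measurePreserving_slice hν p).lintegral_comp hmeas).symm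
    _ = ∫⁻ s, ∫⁻ y : (ℝ ∙ ν)ᗮ, C.indicator g (p + s • ν + (y : E d)) :=
        lintegral_prod _ (hmeas.comp (measurePreserving_slice hν p).measurable).aemeasurable
    _ = ENNReal.ofReal h * ∫⁻ r, ∫⁻ y : (ℝ ∙ ν)ᗮ, C.indicator g (p + (h * r) • ν + (y : E d)) := by
        have := lintegral_smul_comp (volume : Measure ℝ) hh
          (fun s => ∫⁻ y : (ℝ ∙ ν)ᗮ, C.indicator g (p + s • ν + (y : E d)))
        simpa using this
    _ = ENNReal.ofReal h * ∫⁻ r in Ioc (0:ℝ) 1, ENNReal.ofReal (r ^ (d - 1)) *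
          ∫⁻ y in A, g (coneMap p ν h (r, y)) := by
        congr 1
        rw [← lintegral_indicator measurableSet_Ioc]
        refine lintegral_congr_ae ?_
        have h0 : ∀ᵐ r : ℝ, r ≠ 0 := by simp [ae_iff]
        filter_upwards [h0] with r hr
        by_cases hr1 : r ∈ Ioc (0:ℝ) 1
        · rw [indicator_of_mem hr1, lintegral_smul_comp volume hr1.1, finrank_hyperplane hν,
            ← lintegral_indicator hA]
          congr 1
          refine lintegral_congr fun y => ?_
          rw [hcoord r y hr]
          by_cases hy : y ∈ A
          · rw [indicator_of_mem hy, indicator_of_mem ((hind r y hr).2 ⟨hr1, hy⟩)]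
          · rw [indicator_of_notMem hy, indicator_of_notMem fun h => hy ((hind r y hr).1 h).2]
        · rw [indicator_of_notMem hr1]
          refine (lintegral_congr fun y => ?_).trans lintegral_zero
          -- Every point at a nonzero height has cone coordinates, so `hind` also excludes the
          -- slices with `r` outside `Ioc 0 1`.
          have e : p + (h * r) • ν + (y : E d) = coneMap p ν h (r, r⁻¹ • y) := by
            rw [coneMap, smul_add, Submodule.coe_smul, smul_inv_smul₀ hr, smul_smul, mul_comm r h,
              add_assoc]
          rw [e, indicator_of_notMem fun h => hr1 ((hind r _ hr).1 h).1]
    _ = ∫⁻ z in Ioc 0 1 ×ˢ A, ENNReal.ofReal (h * z.1 ^ (d - 1)) * g (coneMap p ν h z)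
          ∂(volume.prod volume) := by
        have hgm : Measurable fun z : ℝ × (ℝ ∙ ν)ᗮ => g (coneMap p ν h z) :=
          hg.comp continuous_coneMap.measurable
        have hw : Measurable fun z : ℝ × (ℝ ∙ ν)ᗮ => ENNReal.ofReal (h * z.1 ^ (d - 1)) :=
          ((measurable_fst.pow_const _).const_mul h).ennreal_ofReal
        have hsec : ∀ r : ℝ, Measurable fun y : (ℝ ∙ ν)ᗮ => g (coneMap p ν h (r, y)) :=
          fun r => hgm.comp measurable_prodMk_left
        rw [← Measure.prod_restrict, lintegral_prod _ (hw.fun_mul hgm).aemeasurable,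
          ← lintegral_const_mul' _ _ ENNReal.ofReal_ne_top]
        refine lintegral_congr fun r => ?_
        dsimp only
        rw [lintegral_const_mul _ (hsec r), ENNReal.ofReal_mul hh.le, mul_assoc]

/-- Lebesgue measure on a cone. -/
lemma restrict_cone (hν : ‖ν‖ = 1) {h : ℝ} (hh : 0 < h) {A : Set (ℝ ∙ ν)ᗮ}
    (hA : MeasurableSet A) :
    (volume : Measure (E d)).restrict (coneMap p ν h '' (Ioc 0 1 ×ˢ A))
      = Measure.map (coneMap p ν h) (((volume.restrict (Ioc 0 1)).prod (volume.restrict A)).withDensity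
          fun z => ENNReal.ofReal (h * z.1 ^ (d - 1))) := by
  have hmeas : Measurable fun z : ℝ × (ℝ ∙ ν)ᗮ => ENNReal.ofReal (h * z.1 ^ (d - 1)) := by fun_prop
  refine Measure.ext_of_lintegral _ fun g hg => ?_
  rw [lintegral_cone hν hh hA hg, lintegral_map hg continuous_coneMap.measurable,
    Measure.prod_restrict]
  exact (lintegral_withDensity_eq_lintegral_mul _ hmeas
    (hg.comp continuous_coneMap.measurable)).symm

/-- The Jacobian `h * r ^ (d - 1)` is positive for `r > 0`, so null sets of the cone pull back to
null sets of the product. This is how Rademacher's theorem reaches the individual rays. -/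
lemma ae_cone_of_ae (hν : ‖ν‖ = 1) {h : ℝ} (hh : 0 < h) {A : Set (ℝ ∙ ν)ᗮ}
    (hA : MeasurableSet A) {P : E d → Prop} (hP : ∀ᵐ x, P x) :
    ∀ᵐ z ∂((volume.restrict (Ioc (0:ℝ) 1)).prod (volume.restrict A)), P (coneMap p ν h z) := by
  have h1 := ae_restrict_of_ae (s := coneMap p ν h '' (Ioc 0 1 ×ˢ A)) hP
  rw [restrict_cone hν hh hA] at h1
  have h2 := ae_of_ae_map continuous_coneMap.aemeasurable h1
  rw [ae_withDensity_iff (by fun_prop)] at h2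
  have h3 : ∀ᵐ z ∂((volume.restrict (Ioc (0:ℝ) 1)).prod (volume.restrict A)), z ∈ Ioc (0:ℝ) 1 ×ˢ A := by
    rw [Measure.prod_restrict]
    exact ae_restrict_mem (measurableSet_Ioc.prod hA)
  filter_upwards [h2, h3] with z hz hz3
  refine hz ?_
  have : 0 < h * z.1 ^ (d - 1) := mul_pos hh (pow_pos hz3.1.1 _)
  simpa using this

lemma volume_cone_eq_zero (hν : ‖ν‖ = 1) {h : ℝ} (hh : 0 < h) {A : Set (ℝ ∙ ν)ᗮ}
    (hA : MeasurableSet A) (h0 : volume A = 0) :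
    volume (coneMap p ν h '' (Ioc 0 1 ×ˢ A)) = 0 := by
  have h1 := lintegral_cone (p := p) hν hh hA (g := 1) measurable_one
  rw [← Measure.prod_restrict, Measure.restrict_eq_zero.2 h0] at h1
  simpa using h1

end Cone

/-! ### The divergence theorem on polytopes -/

section Divergence

variable {d : ℕ} {ν p : E d}

/-- The divergence of the field `g(x) (x - p)`. -/
def radialDiv (g : E d → ℝ) (p x : E d) : ℝ := d * g x + fderiv ℝ g x (x - p)

lemma measurable_radialDiv {g : E d → ℝ} (hg : Continuous g) (p : E d) :
    Measurable (radialDiv g p) := by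
  unfold radialDiv
  refine (hg.measurable.const_mul _).add ?_
  exact (isBoundedBilinearMap_apply (𝕜 := ℝ) (E := E d) (F := ℝ)).continuous.measurable.comp
    ((measurable_fderiv ℝ g).prodMk (measurable_id.sub_const p))

lemma integrableOn_radialDiv {g : E d → ℝ} {c : NNReal} (hg : LipschitzWith c g) (p : E d)
    {K : Set (E d)} (hK : IsCompact K) : IntegrableOn (radialDiv g p) K := by
  obtain ⟨M, hM⟩ := hK.exists_bound_of_continuousOn hg.continuous.continuousOn
  obtain ⟨R, hR⟩ := hK.exists_bound_of_continuousOn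
    (f := fun x => x - p) (by fun_prop)
  refine Measure.integrableOn_of_bounded (M := d * M + c * R) hK.measure_lt_top.ne
    (measurable_radialDiv hg.continuous p).aestronglyMeasurable ?_
  filter_upwards [ae_restrict_mem hK.measurableSet] with x hx
  refine (norm_add_le _ _).trans (add_le_add ?_ ?_)
  · rw [norm_mul, Real.norm_natCast]
    exact mul_le_mul_of_nonneg_left (hM x hx) (by positivity)
  · exact ((fderiv ℝ g x).le_of_opNorm_le (norm_fderiv_le_of_lipschitz ℝ hg) _).trans
      (mul_le_mul_of_nonneg_left (hR x hx) c.2)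

/-- The integrand is the derivative of `r ^ d * g (p + r • w)`, an absolutely continuous function of
`r` that vanishes at 0 because `d ≥ 1`. -/
lemma integral_ray (hd : 1 ≤ d) {g : E d → ℝ} {c : NNReal} (hg : LipschitzWith c g) (p w : E d)
    (hdiff : ∀ᵐ r ∂(volume.restrict (Ioc (0:ℝ) 1)), DifferentiableAt ℝ g (p + r • w)) :
    ∫ r in Ioc (0:ℝ) 1, r ^ (d - 1) * radialDiv g p (p + r • w) = g (p + w) := by
  have hac1 : AbsolutelyContinuousOnInterval (fun r : ℝ => r ^ d) 0 1 :=
    ContDiffOn.absolutelyContinuousOnInterval (by fun_prop)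
  have hac2 : AbsolutelyContinuousOnInterval (fun r : ℝ => g (p + r • w)) 0 1 := by
    have h1 : LipschitzWith ‖w‖₊ (fun r : ℝ => p + r • w) :=
      LipschitzWith.of_dist_le_mul fun r s => by
        rw [dist_add_left, dist_eq_norm, ← sub_smul, norm_smul, Real.dist_eq, mul_comm]
        rfl
    exact ((hg.comp h1).lipschitzOnWith (s := uIcc 0 1)).absolutelyContinuousOnInterval
  have h := (hac1.fun_mul hac2).integral_deriv_eq_sub
  have h0 : (0:ℝ) ^ d = 0 := zero_pow (by omega)
  simp only [one_pow, one_mul, one_smul, h0, zero_mul, sub_zero] at h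
  rw [← h, intervalIntegral.integral_of_le zero_le_one]
  refine integral_congr_ae ?_
  filter_upwards [hdiff] with r hr
  have hp : HasDerivAt (fun r : ℝ => p + r • w) w r := by
    simpa using ((hasDerivAt_id r).smul_const w).const_add p
  have h2 := hr.hasFDerivAt.comp_hasDerivAt r hp
  have h3 := (hasDerivAt_pow d r).fun_mul h2
  refine Eq.trans ?_ h3.deriv.symm
  have e : r ^ d = r ^ (d - 1) * r := by rw [← pow_succ, Nat.sub_add_cancel hd]
  simp only [radialDiv, add_sub_cancel_left, map_smul, smul_eq_mul, Function.comp, e]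
  ring

/-- In cone coordinates the factor `r ^ (d - 1)` of the Jacobian is exactly the one in
`integral_ray`, so Fubini leaves an integral over the base alone. -/
lemma integral_radialDiv_cone (hd : 1 ≤ d) (hν : ‖ν‖ = 1) {h : ℝ} (hh : 0 < h) {A : Set (ℝ ∙ ν)ᗮ}
    (hA : MeasurableSet A) {g : E d → ℝ} {c : NNReal} (hg : LipschitzWith c g)
    (hint : IntegrableOn (radialDiv g p) (coneMap p ν h '' (Ioc 0 1 ×ˢ A))) :
    ∫ x in coneMap p ν h '' (Ioc 0 1 ×ˢ A), radialDiv g p x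
      = h * ∫ y in A, g (p + (h • ν + (y : E d))) := by
  set μ := (volume.restrict (Ioc (0:ℝ) 1)).prod (volume.restrict A)
  have hG := measurable_radialDiv hg.continuous p
  have hw : Measurable fun z : ℝ × (ℝ ∙ ν)ᗮ => ENNReal.ofReal (h * z.1 ^ (d - 1)) :=
    ((measurable_fst.pow_const _).const_mul h).ennreal_ofReal
  have hmem : ∀ᵐ z ∂μ, z ∈ Ioc (0:ℝ) 1 ×ˢ A := by
    simp only [μ, Measure.prod_restrict]
    exact ae_restrict_mem (measurableSet_Ioc.prod hA)
  have htoReal : ∀ᵐ z ∂μ, (ENNReal.ofReal (h * z.1 ^ (d - 1))).toReal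
      • radialDiv g p (coneMap p ν h z) = h * (z.1 ^ (d - 1) * radialDiv g p (coneMap p ν h z)) := by
    filter_upwards [hmem] with z hz
    rw [ENNReal.toReal_ofReal (mul_nonneg hh.le (pow_nonneg hz.1.1.le _)), smul_eq_mul, mul_assoc]
  rw [IntegrableOn, restrict_cone hν hh hA, integrable_map_measure hG.aestronglyMeasurable
    continuous_coneMap.aemeasurable, integrable_withDensity_iff_integrable_smul' hw
    (Eventually.of_forall fun _ => ENNReal.ofReal_lt_top)] at hint
  have hint' := hint.congr htoReal
  rw [restrict_cone hν hh hA, integral_map continuous_coneMap.aemeasurable hG.aestronglyMeasurable,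
    integral_withDensity_eq_integral_toReal_smul hw
    (Eventually.of_forall fun _ => ENNReal.ofReal_lt_top), integral_congr_ae htoReal,
    integral_prod_symm _ hint', ← integral_const_mul]
  refine integral_congr_ae ?_
  -- Rademacher's theorem in `E d`, carried over to cone coordinates and then, by Fubini, to almost
  -- every ray.
  have hdiff : ∀ᵐ z ∂μ, DifferentiableAt ℝ g (coneMap p ν h z) :=
    ae_cone_of_ae hν hh hA hg.ae_differentiableAt
  have hdiff' : ∀ᵐ y ∂(volume.restrict A), ∀ᵐ r ∂(volume.restrict (Ioc (0:ℝ) 1)),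
      DifferentiableAt ℝ g (coneMap p ν h (r, y)) :=
    Measure.ae_ae_of_ae_prod (p := fun z => DifferentiableAt ℝ g (coneMap p ν h z.swap))
      (Measure.measurePreserving_swap.quasiMeasurePreserving.ae hdiff)
  filter_upwards [hdiff'] with y hy
  rw [integral_const_mul]
  congr 1
  exact integral_ray hd hg p (h • ν + (y : E d)) hy

end Divergence

section Polytope

variable {d : ℕ} {K Z : Set (E d)} {ν p x : E d}

/-- The surface measure on the boundary of `K`. -/
abbrev bdry (K : Set (E d)) : Measure (E d) := (surf d).restrict (frontier K)

lemma outwardNormal_spec (K : Set (E d)) (x : E d) :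
    outwardNormal K x = 0 ∨ IsOutwardNormal K x (outwardNormal K x) := by
  by_cases h : ∃ ν, IsOutwardNormal K x ν
  · right; rw [outwardNormal, dif_pos h]; exact h.choose_spec
  · left; rw [outwardNormal, dif_neg h]

lemma norm_outwardNormal_le (K : Set (E d)) (x : E d) : ‖outwardNormal K x‖ ≤ 1 := by
  rcases outwardNormal_spec K x with h | h
  · simp [h]
  · exact h.1.le

/-- The union of the segments from `p` to the points of `Z`, without `p`. -/
def coneOver (p : E d) (Z : Set (E d)) : Set (E d) :=
  {x | ∃ r ∈ Ioc (0:ℝ) 1, ∃ z ∈ Z, x = p + r • (z - p)}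

lemma coneOver_eq_image (hν : ‖ν‖ = 1) {h : ℝ} (hZ : Z ⊆ {x | inner ℝ ν (x - p) = h}) :
    coneOver p Z = coneMap p ν h ''
      (Ioc 0 1 ×ˢ ((fun y : (ℝ ∙ ν)ᗮ => (p + h • ν) + (y : E d)) ⁻¹' Z)) := by
  ext x
  constructor
  · rintro ⟨r, hr, z, hz, rfl⟩
    have hz' : inner ℝ ν (z - p - h • ν) = (0 : ℝ) := by
      rw [inner_sub_right, hZ hz, inner_smul_right, real_inner_self_eq_norm_sq, hν]; ring
    refine ⟨(r, ⟨z - p - h • ν, Submodule.mem_orthogonal_singleton_iff_inner_right.2 hz'⟩),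
      ⟨hr, ?_⟩, ?_⟩
    · simpa [← sub_sub] using hz
    · simp [coneMap]
  · rintro ⟨⟨r, y⟩, ⟨hr, hy⟩, rfl⟩
    exact ⟨r, hr, _, hy, by simp [coneMap, add_assoc]⟩

lemma subset_hyperplane_iff (hν : ‖ν‖ = 1) {h : ℝ} (hZ : Z ⊆ {x | inner ℝ ν (x - p) = h}) :
    Z ⊆ {x | inner ℝ ν (x - (p + h • ν)) = (0 : ℝ)} := fun x hx => by
  have := hZ hx
  simp only [mem_ofPred_eq] at this ⊢
  rw [← sub_sub, inner_sub_right, this, inner_smul_right, real_inner_self_eq_norm_sq, hν]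
  ring

lemma measurableSet_coneOver (hν : ‖ν‖ = 1) {h : ℝ} (hh : 0 < h) (hZm : MeasurableSet Z)
    (hZ : Z ⊆ {x | inner ℝ ν (x - p) = h}) : MeasurableSet (coneOver p Z) := by
  rw [coneOver_eq_image hν hZ]
  exact measurableSet_cone hν hh (hZm.preimage (measurableEmbedding_add_hyperplane _ _).measurable)

lemma volume_coneOver_eq_zero (hν : ‖ν‖ = 1) {h : ℝ} (hh : 0 < h) (hZm : MeasurableSet Z)
    (hZ : Z ⊆ {x | inner ℝ ν (x - p) = h}) (h0 : surf d Z = 0) : volume (coneOver p Z) = 0 := by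
  rw [coneOver_eq_image hν hZ]
  have hme := (measurableEmbedding_add_hyperplane (p + h • ν) ν)
  refine volume_cone_eq_zero hν hh (hZm.preimage hme.measurable) ?_
  rw [← Measure.map_apply hme.measurable hZm, map_volume_hyperplane hν]
  exact measure_mono_null (subset_refl _) (Measure.absolutelyContinuous_of_le
    Measure.restrict_le_self h0)

/-- The factor `⟪ν, x - p⟫` equals the height `h` throughout `Z`; this identifies the base integral
of the cone formula with the boundary flux of the radial field. -/
lemma integral_radialDiv_coneOver (hd : 1 ≤ d) (hν : ‖ν‖ = 1) {h : ℝ} (hh : 0 < h)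
    (hZm : MeasurableSet Z) (hZ : Z ⊆ {x | inner ℝ ν (x - p) = h})
    {g : E d → ℝ} {c : NNReal} (hg : LipschitzWith c g)
    (hint : IntegrableOn (radialDiv g p) (coneOver p Z)) :
    ∫ x in coneOver p Z, radialDiv g p x = ∫ x in Z, g x * inner ℝ ν (x - p) ∂(surf d) := by
  have hme := (measurableEmbedding_add_hyperplane (p + h • ν) ν)
  have e1 : ∫ x in Z, g x * inner ℝ ν (x - p) ∂(surf d) = ∫ x in Z, h * g x ∂(surf d) := by
    refine setIntegral_congr_fun hZm fun x hx => ?_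
    have := hZ hx
    simp only [mem_ofPred_eq] at this
    simp only [this, mul_comm]
  rw [coneOver_eq_image hν hZ] at hint ⊢
  rw [e1, integral_radialDiv_cone hd hν hh (hZm.preimage hme.measurable) hg hint,
    integral_const_mul, ← map_volume_restrict_hyperplane hν _ hZm (subset_hyperplane_iff hν hZ),
    hme.integral_map]
  simp only [add_assoc]

lemma inner_pos_of_mem_face (hp : p ∈ interior K) (hν : ‖ν‖ = 1) (hx : x ∈ face K ν) :
    0 < (inner ℝ ν (x - p) : ℝ) := by
  obtain ⟨t, t0, -, ht⟩ := exists_small_smul (mem_interior_iff_mem_nhds.1 hp) ν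
  have := hx.2 _ ht
  rw [inner_add_right, inner_smul_right, real_inner_self_eq_norm_sq, hν] at this
  rw [inner_sub_right]
  linarith

lemma face_subset_level (hx : x ∈ face K ν) :
    face K ν ⊆ {y | inner ℝ ν (y - p) = (inner ℝ ν (x - p) : ℝ)} := fun y hy => by
  simp only [mem_ofPred_eq, inner_sub_right]
  linarith [hy.2 x hx.1, hx.2 y hy.1]

/-- A ray from an interior point meets the boundary only once: of two such points the nearer one
would be a proper convex combination of `p` and a point of `K`, hence interior. -/
lemma eq_of_ray_eq (hK : Convex ℝ K) (hc : IsClosed K) (hp : p ∈ interior K) {r r' : ℝ}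
    (hr : 0 < r) (hr' : 0 < r') {z z' : E d} (hz : z ∈ frontier K) (hz' : z' ∈ frontier K)
    (he : p + r • (z - p) = p + r' • (z' - p)) : z = z' := by
  have key : ∀ {r r' : ℝ} {z z' : E d}, 0 < r → 0 < r' → z ∈ frontier K → z' ∈ frontier K →
      p + r • (z - p) = p + r' • (z' - p) → ¬ r < r' := by
    intro r r' z z' hr hr' hz hz' he hlt
    have h1 : r • (z - p) = r' • (z' - p) := add_left_cancel he
    have h2 : z' = (1 - r / r') • p + (r / r') • z := by
      have : z' - p = (r / r') • (z - p) := by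
        rw [div_eq_inv_mul, mul_smul, h1, inv_smul_smul₀ hr'.ne']
      rw [← sub_add_cancel z' p, this, smul_sub, sub_smul, one_smul]; abel
    refine hz'.2 ?_
    rw [h2]
    exact hK.combo_interior_self_mem_interior hp (hc.frontier_subset hz)
      (sub_pos.2 ((div_lt_one hr').2 hlt)) (by positivity) (by ring)
  have hrr : r = r' := le_antisymm (not_lt.1 (key hr' hr hz' hz he.symm))
    (not_lt.1 (key hr hr' hz hz' he))
  subst hrr
  exact sub_left_injective (smul_right_injective (E d) hr.ne' (add_left_cancel he))

/-- The last point of `K` on the ray from `p` through `x` exists by compactness. It is not interior,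
since otherwise the ray could be followed further inside `K`. -/
lemma exists_frontier_ray (hK : IsCompact K) (hx : x ∈ K) (hxp : x ≠ p) :
    ∃ z ∈ frontier K, ∃ r ∈ Ioc (0:ℝ) 1, x = p + r • (z - p) := by
  set S : Set ℝ := {t | 0 ≤ t ∧ p + t • (x - p) ∈ K} with hS
  have hcont : Continuous fun t : ℝ => p + t • (x - p) := by fun_prop
  have hclosed : IsClosed S := (isClosed_Ici (a := (0:ℝ))).inter (hK.isClosed.preimage hcont)
  have h1S : (1:ℝ) ∈ S := ⟨zero_le_one, by simpa using hx⟩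
  have hxp' : 0 < ‖x - p‖ := norm_pos_iff.2 (sub_ne_zero.2 hxp)
  obtain ⟨R, hR⟩ := hK.exists_bound_of_continuousOn (f := fun y => y - p) (by fun_prop)
  have hbdd : BddAbove S := by
    refine ⟨R / ‖x - p‖, fun t ht => ?_⟩
    have := hR _ ht.2
    rw [add_sub_cancel_left, norm_smul, Real.norm_of_nonneg ht.1] at this
    exact (le_div_iff₀ hxp').2 this
  have hsup := hclosed.csSup_mem ⟨1, h1S⟩ hbdd
  set T := sSup S with hT
  have hT1 : 1 ≤ T := le_csSup hbdd h1S
  have hT0 : 0 < T := by linarith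
  refine ⟨p + T • (x - p), ⟨subset_closure hsup.2, fun hi => ?_⟩, T⁻¹,
    ⟨by positivity, inv_le_one_of_one_le₀ hT1⟩, ?_⟩
  · obtain ⟨t, t0, -, ht⟩ := exists_small_smul (P := (· ∈ K))
      (mem_interior_iff_mem_nhds.1 hi) (x - p)
    have : T + t ∈ S := ⟨by linarith, by
      simpa [add_smul, add_assoc] using ht⟩
    linarith [le_csSup hbdd this]
  · rw [add_sub_cancel_left, inv_smul_smul₀ hT0.ne', add_sub_cancel]

lemma flat_subset_face (hK : IsPolytope K) : flat K ν ⊆ face K ν :=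
  fun _ hx => IsOutwardNormal.mem_face hx hK.convex hK.isClosed

lemma ne_zero_of_norm_eq_one (hν : ‖ν‖ = 1) : ν ≠ 0 := by rintro rfl; simp at hν

lemma pairwiseDisjoint_flat (N : Set (E d)) : N.PairwiseDisjoint (flat K) := by
  intro ν _ ν' _ hne
  exact disjoint_left.2 fun x hx hx' => hne (IsOutwardNormal.unique hx hx')

lemma frontier_ae_eq (hK : IsPolytope K) {N : Finset (E d)} (hN : ∀ ν ∈ N, ‖ν‖ = 1)
    (hcov : frontier K ⊆ ⋃ ν ∈ N, face K ν) :
    (frontier K : Set (E d)) =ᵐ[surf d] ⋃ ν ∈ N, flat K ν := by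
  have hsub : (⋃ ν ∈ N, flat K ν) ⊆ frontier K := iUnion₂_subset fun ν hν =>
    (flat_subset_face hK).trans (face_subset_frontier (ne_zero_of_norm_eq_one (hN ν hν)))
  refine Filter.EventuallyLE.antisymm ?_ hsub.eventuallyLE
  rw [ae_le_set]
  refine measure_mono_null (t := ⋃ ν ∈ N, (face K ν \ flat K ν)) ?_ ?_
  · rintro x ⟨hx, hx'⟩
    obtain ⟨ν, hν, hxν⟩ := mem_iUnion₂.1 (hcov hx)
    exact mem_iUnion₂.2 ⟨ν, hν, hxν, fun h => hx' (mem_iUnion₂.2 ⟨ν, hν, h⟩)⟩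
  · refine (measure_biUnion_null_iff (I := (N : Set (E d))) N.countable_toSet).2 ?_
    exact fun ν hν => surf_face_diff_flat hK.convex hK.isClosed hK.interior_nonempty (hN ν hν)

lemma surf_frontier_lt_top (hK : IsPolytope K) : surf d (frontier K) < ⊤ := by
  obtain ⟨N, hN, hcov⟩ := hK.exists_normals
  refine (measure_mono hcov).trans_lt ?_
  refine (measure_biUnion_finset_le N _).trans_lt ?_
  exact ENNReal.sum_lt_top.2 fun ν hν => surf_face_lt_top hK.isCompact (hN ν hν)

lemma IsPolytope.isFiniteMeasure_bdry (hK : IsPolytope K) : IsFiniteMeasure (bdry K) :=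
  ⟨by simpa using surf_frontier_lt_top hK⟩

lemma IsPolytope.ae_isOutwardNormal (hK : IsPolytope K) :
    ∀ᵐ x ∂(bdry K), IsOutwardNormal K x (outwardNormal K x) := by
  obtain ⟨N, hN, hcov⟩ := hK.exists_normals
  rw [bdry, Measure.restrict_congr_set (frontier_ae_eq hK hN hcov)]
  have hm : MeasurableSet (⋃ ν ∈ N, flat K ν) := Finset.measurableSet_biUnion _ fun ν hν =>
    measurableSet_flat hK.convex hK.isClosed (hN ν hν)
  filter_upwards [ae_restrict_mem hm] with x hx
  obtain ⟨ν, hν, hxν⟩ := mem_iUnion₂.1 hx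
  have h : IsOutwardNormal K x ν := hxν
  rwa [h.outwardNormal_eq]

/-- The normal is constant on each of the finitely many flat pieces, and these exhaust the boundary
up to a null set. -/
lemma IsPolytope.aestronglyMeasurable_outwardNormal (hK : IsPolytope K) :
    AEStronglyMeasurable (outwardNormal K) (bdry K) := by
  obtain ⟨N, hN, hcov⟩ := hK.exists_normals
  rw [bdry, Measure.restrict_congr_set (frontier_ae_eq hK hN hcov)]
  have e : (⋃ ν ∈ N, flat K ν) = ⋃ ν : N, flat K ν := by ext; simp
  rw [e, aestronglyMeasurable_iUnion_iff]
  rintro ⟨ν, hν⟩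
  refine (aestronglyMeasurable_const (b := ν)).congr ?_
  filter_upwards [ae_restrict_mem (measurableSet_flat hK.convex hK.isClosed (hN ν hν))] with x hx
  exact (IsOutwardNormal.outwardNormal_eq hx).symm

/-- Every point of `K` other than `p` lies on a segment from `p` to the boundary. What the cones
over the flat pieces miss lies in cones over null parts of faces, which are null. -/
lemma volume_eq_cones (hK : IsPolytope K) (hd : 1 ≤ d) (hp : p ∈ interior K)
    {N : Finset (E d)} (hN : ∀ ν ∈ N, ‖ν‖ = 1) (hcov : frontier K ⊆ ⋃ ν ∈ N, face K ν) :
    K =ᵐ[volume] ⋃ ν ∈ N, coneOver p (flat K ν) := by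
  have hsub : (⋃ ν ∈ N, coneOver p (flat K ν)) ⊆ K := by
    refine iUnion₂_subset fun ν hν => ?_
    rintro x ⟨r, hr, z, hz, rfl⟩
    exact hK.convex.add_smul_sub_mem (interior_subset hp) (flat_subset_face hK hz).1 ⟨hr.1.le, hr.2⟩
  refine Filter.EventuallyLE.antisymm ?_ hsub.eventuallyLE
  rw [ae_le_set]
  refine measure_mono_null (t := {p} ∪ ⋃ ν ∈ N, coneOver p (face K ν \ flat K ν)) ?_
    (measure_union_null ?_ ?_)
  · rintro x ⟨hx, hx'⟩
    by_cases hxp : x = p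
    · exact Or.inl hxp
    obtain ⟨z, hz, r, hr, hxz⟩ := exists_frontier_ray hK.isCompact hx hxp
    obtain ⟨ν, hν, hzν⟩ := mem_iUnion₂.1 (hcov hz)
    exact Or.inr (mem_iUnion₂.2 ⟨ν, hν, r, hr, z,
      ⟨hzν, fun h => hx' (mem_iUnion₂.2 ⟨ν, hν, r, hr, z, h, hxz⟩)⟩, hxz⟩)
  -- A single point is a null set only in positive dimension.
  · have : NeZero d := ⟨by omega⟩
    exact measure_singleton p
  · refine (measure_biUnion_null_iff (I := (N : Set (E d))) N.countable_toSet).2 fun ν hν => ?_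
    have hν1 := hN ν hν
    rcases (face K ν).eq_empty_or_nonempty with h0 | ⟨a, ha⟩
    · simp [h0, coneOver]
    exact volume_coneOver_eq_zero hν1 (inner_pos_of_mem_face hp hν1 ha)
      ((isClosed_face hK.isClosed).measurableSet.diff
        (measurableSet_flat hK.convex hK.isClosed hν1))
      (sdiff_subset.trans (face_subset_level ha))
      (surf_face_diff_flat hK.convex hK.isClosed hK.interior_nonempty hν1)

lemma IsPolytope.integrable_bdry (hK : IsPolytope K) {f : E d → ℝ} (hf : Continuous f) :
    Integrable f (bdry K) := by
  have := hK.isFiniteMeasure_bdry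
  obtain ⟨M, hM⟩ := hK.isCompact.exists_bound_of_continuousOn hf.continuousOn
  refine Integrable.of_bound hf.aestronglyMeasurable M ?_
  filter_upwards [ae_restrict_mem isClosed_frontier.measurableSet] with x hx
  exact hM x (hK.isClosed.frontier_subset hx)

lemma IsPolytope.integrable_mul_inner_normal (hK : IsPolytope K) {f : E d → ℝ}
    {q : E d → E d} (hf : Continuous f) (hq : Continuous q) :
    Integrable (fun x => f x * inner ℝ (outwardNormal K x) (q x)) (bdry K) := by
  refine (hK.integrable_bdry (hf.norm.mul hq.norm)).mono'
    (hf.aestronglyMeasurable.mul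
      (hK.aestronglyMeasurable_outwardNormal.inner hq.aestronglyMeasurable))
    (Eventually.of_forall fun x => ?_)
  rw [norm_mul]
  refine mul_le_mul_of_nonneg_left ((norm_inner_le_norm _ _).trans ?_) (norm_nonneg _)
  exact mul_le_of_le_one_left (norm_nonneg _) (norm_outwardNormal_le K x)

/-- The divergence theorem for the fields `g(x) (x - p)`. -/
lemma IsPolytope.integral_radialDiv (hK : IsPolytope K) (hd : 1 ≤ d) (hp : p ∈ interior K)
    {g : E d → ℝ} {c : NNReal} (hg : LipschitzWith c g) :
    ∫ x in K, radialDiv g p x = ∫ x, g x * inner ℝ (outwardNormal K x) (x - p) ∂(bdry K) := by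
  obtain ⟨N, hN, hcov⟩ := hK.exists_normals
  have hmflat : ∀ ν ∈ N, MeasurableSet (flat K ν) := fun ν hν =>
    measurableSet_flat hK.convex hK.isClosed (hN ν hν)
  have hint := integrableOn_radialDiv hg p hK.isCompact
  have hint2 := hK.integrable_mul_inner_normal hg.continuous (q := fun x => x - p) (by fun_prop)
  have hsub : ∀ ν ∈ N, coneOver p (flat K ν) ⊆ K := by
    rintro ν hν x ⟨r, hr, z, hz, rfl⟩
    exact hK.convex.add_smul_sub_mem (interior_subset hp) (flat_subset_face hK hz).1 ⟨hr.1.le, hr.2⟩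
  have hfr : ∀ ν ∈ N, flat K ν ⊆ frontier K := fun ν hν =>
    (flat_subset_face hK).trans (face_subset_frontier (ne_zero_of_norm_eq_one (hN ν hν)))
  have hcone : ∀ ν ∈ N, MeasurableSet (coneOver p (flat K ν)) ∧
      ∫ x in coneOver p (flat K ν), radialDiv g p x
        = ∫ x in flat K ν, g x * inner ℝ (outwardNormal K x) (x - p) ∂(surf d) := by
    intro ν hν
    rcases (flat K ν).eq_empty_or_nonempty with h0 | ⟨a, ha⟩
    · simp [h0, coneOver]
    have haf := flat_subset_face hK ha
    have hpos := inner_pos_of_mem_face hp (hN ν hν) haf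
    have hlev := (flat_subset_face (ν := ν) hK).trans (face_subset_level (p := p) haf)
    refine ⟨measurableSet_coneOver (hN ν hν) hpos (hmflat ν hν) hlev, ?_⟩
    rw [integral_radialDiv_coneOver hd (hN ν hν) hpos (hmflat ν hν) hlev hg
      (hint.mono_set (hsub ν hν))]
    refine setIntegral_congr_fun (hmflat ν hν) fun x hx => ?_
    simp only [IsOutwardNormal.outwardNormal_eq hx]
  -- A common point of two cones is reached by rays to two boundary points. These coincide, and a
  -- point has only one outward normal.
  have hdisj : (N : Set (E d)).Pairwise (Function.onFun Disjoint fun ν => coneOver p (flat K ν)) := by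
    intro ν hν ν' hν' hne
    refine disjoint_left.2 ?_
    rintro x ⟨r, hr, z, hz, rfl⟩ ⟨r', hr', z', hz', he⟩
    have := eq_of_ray_eq hK.convex hK.isClosed hp hr.1 hr'.1 (hfr ν hν hz) (hfr ν' hν' hz') he
    subst this
    exact hne (IsOutwardNormal.unique hz hz')
  rw [setIntegral_congr_set (volume_eq_cones hK hd hp hN hcov),
    integral_biUnion_finset N (fun ν hν => (hcone ν hν).1) hdisj
      (fun ν hν => hint.mono_set (hsub ν hν)), bdry,
    setIntegral_congr_set (frontier_ae_eq hK hN hcov),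
    integral_biUnion_finset N hmflat (fun ν _ ν' _ hne => pairwiseDisjoint_flat (K := K) univ
      (mem_univ ν) (mem_univ ν') hne)
      (fun ν hν => hint2.mono_measure (Measure.restrict_mono (hfr ν hν) le_rfl))]
  exact Finset.sum_congr rfl fun ν hν => (hcone ν hν).2

/-- The divergence theorem on a convex polytope, for a Lipschitz function times a constant field. -/
theorem IsPolytope.integral_fderiv (hK : IsPolytope K) (hd : 1 ≤ d) {g : E d → ℝ} {c : NNReal}
    (hg : LipschitzWith c g) (v : E d) :
    ∫ x in K, fderiv ℝ g x v = ∫ x, g x * inner ℝ (outwardNormal K x) v ∂(bdry K) := by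
  obtain ⟨p, hp⟩ := hK.interior_nonempty
  -- The radial fields with the interior centres `p` and `p + t • v` differ by `g` times the
  -- constant `t • v`, so subtracting the two formulas gives `t` times the claim.
  obtain ⟨t, t0, -, ht⟩ := exists_small_smul (P := (· ∈ interior K))
    (isOpen_interior.mem_nhds hp) v
  have h1 := hK.integral_radialDiv hd hp hg
  have h2 := hK.integral_radialDiv hd ht hg
  have e1 : ∫ x in K, radialDiv g p x - radialDiv g (p + t • v) x
      = t * ∫ x in K, fderiv ℝ g x v := by
    rw [← integral_const_mul]
    refine integral_congr_ae (Eventually.of_forall fun x => ?_)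
    simp only [radialDiv, ← sub_sub, map_sub, map_smul, smul_eq_mul]
    ring
  have e2 : ∫ x, g x * inner ℝ (outwardNormal K x) (x - p)
        - g x * inner ℝ (outwardNormal K x) (x - (p + t • v)) ∂(bdry K)
      = t * ∫ x, g x * inner ℝ (outwardNormal K x) v ∂(bdry K) := by
    rw [← integral_const_mul]
    refine integral_congr_ae (Eventually.of_forall fun x => ?_)
    simp only [← sub_sub, inner_sub_right, inner_smul_right]
    ring
  rw [integral_sub (integrableOn_radialDiv hg p hK.isCompact)
    (integrableOn_radialDiv hg _ hK.isCompact)] at e1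
  rw [integral_sub (hK.integrable_mul_inner_normal hg.continuous (by fun_prop))
    (hK.integrable_mul_inner_normal hg.continuous (by fun_prop))] at e2
  exact mul_left_cancel₀ t0.ne' (by rw [← e1, ← e2, h1, h2])

end Polytope

/-! ### Integration by parts and the trace inequality for C¹ functions on a polytope. -/

section TraceInequality

variable {d : ℕ} {K : Set (E d)}

lemma volume_diff_interior (hK : IsPolytope K) : volume (K \ interior K) = 0 := by
  have := hK.convex.addHaar_frontier volume
  rwa [hK.isClosed.frontier_eq] at this

lemma IsPolytope.ae_mem_interior (hK : IsPolytope K) :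
    ∀ᵐ x ∂(volume.restrict K), x ∈ interior K := by
  rw [ae_restrict_iff' hK.isClosed.measurableSet]
  have : ∀ᵐ x, x ∉ K \ interior K := measure_eq_zero_iff_ae_notMem.1 (volume_diff_interior hK)
  filter_upwards [this] with x hx hxK
  by_contra h
  exact hx ⟨hxK, h⟩

/-- The coefficients are Lipschitz only on the closed domain, while the divergence theorem is stated
for globally Lipschitz functions. A Lipschitz extension has the same derivative on the interior,
that is, almost everywhere on a polytope. -/
lemma exists_extension_of_lipschitzOn {g : E d → ℝ} {c : NNReal} (hg : LipschitzOnWith c g K) :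
    ∃ g' : E d → ℝ, LipschitzWith c g' ∧ EqOn g g' K ∧
      ∀ x ∈ interior K, fderiv ℝ g x = fderiv ℝ g' x := by
  obtain ⟨g', h1, h2⟩ := hg.extend_real
  refine ⟨g', h1, h2, fun x hx => ?_⟩
  exact Filter.EventuallyEq.fderiv_eq
    (eventually_of_mem (mem_interior_iff_mem_nhds.1 hx) fun y hy => h2 hy)

lemma IsPolytope.ae_differentiableAt (hK : IsPolytope K) {g : E d → ℝ} {c : NNReal}
    (hg : LipschitzOnWith c g K) : ∀ᵐ x ∂(volume.restrict K), DifferentiableAt ℝ g x := by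
  obtain ⟨g', h1, h2⟩ := hg.extend_real
  filter_upwards [ae_restrict_of_ae h1.ae_differentiableAt, hK.ae_mem_interior] with x hx hi
  exact hx.congr_of_eventuallyEq
    (eventually_of_mem (mem_interior_iff_mem_nhds.1 hi) fun y hy => h2 hy)

theorem IsPolytope.integral_fderiv_of_lipschitzOn (hK : IsPolytope K) (hd : 1 ≤ d) {g : E d → ℝ}
    {c : NNReal} (hg : LipschitzOnWith c g K) (v : E d) :
    ∫ x in K, fderiv ℝ g x v = ∫ x, g x * inner ℝ (outwardNormal K x) v ∂(bdry K) := by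
  obtain ⟨g', h1, h2, h3⟩ := exists_extension_of_lipschitzOn hg
  have e1 : ∫ x in K, fderiv ℝ g x v = ∫ x in K, fderiv ℝ g' x v := by
    refine integral_congr_ae ?_
    filter_upwards [hK.ae_mem_interior] with x hx
    rw [h3 x hx]
  rw [e1, hK.integral_fderiv hd h1 v]
  refine setIntegral_congr_fun isClosed_frontier.measurableSet fun x hx => ?_
  simp only [h2 (hK.isClosed.frontier_subset hx)]

lemma lipschitzOn_mul (hK : IsCompact K) {f g : E d → ℝ} {a b : NNReal}
    (hf : LipschitzOnWith a f K) (hg : LipschitzOnWith b g K) :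
    ∃ c, LipschitzOnWith c (fun x => f x * g x) K := by
  obtain ⟨M, hM⟩ := hK.exists_bound_of_continuousOn hf.continuousOn
  obtain ⟨M', hM'⟩ := hK.exists_bound_of_continuousOn hg.continuousOn
  refine ⟨Real.toNNReal |M| * b + Real.toNNReal |M'| * a, LipschitzOnWith.of_dist_le_mul
    fun x hx y hy => ?_⟩
  have h1 := hf.dist_le_mul x hx y hy
  have h2 := hg.dist_le_mul x hx y hy
  have h3 := (hM x hx).trans (le_abs_self M)
  have h4 := (hM' y hy).trans (le_abs_self M')
  push_cast
  rw [Real.coe_toNNReal _ (abs_nonneg _), Real.coe_toNNReal _ (abs_nonneg _)]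
  rw [Real.dist_eq] at h1 h2 ⊢
  rw [Real.norm_eq_abs] at h3 h4
  calc |f x * g x - f y * g y| = |f x * (g x - g y) + g y * (f x - f y)| := by ring_nf
    _ ≤ |f x| * |g x - g y| + |g y| * |f x - f y| := by
        rw [← abs_mul, ← abs_mul]; exact abs_add_le _ _
    _ ≤ |M| * (b * dist x y) + |M'| * (a * dist x y) := by gcongr
    _ = _ := by ring

lemma IsPolytope.exists_lipschitzOn (hK : IsPolytope K) {φ : E d → ℝ} (hφ : ContDiff ℝ 1 φ) :
    ∃ c, LipschitzOnWith c φ K :=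
  hφ.contDiffOn.exists_lipschitzOnWith one_ne_zero hK.convex hK.isCompact

/-- Integration by parts on a convex polytope for a `C¹` and a Lipschitz function. -/
lemma IsPolytope.integral_mul_fderiv (hK : IsPolytope K) (hd : 1 ≤ d) {φ ψ : E d → ℝ}
    (hφ : ContDiff ℝ 1 φ) {c : NNReal} (hψ : LipschitzOnWith c ψ K) (v : E d) :
    ∫ x in K, (fderiv ℝ φ x v * ψ x + φ x * fderiv ℝ ψ x v)
      = ∫ x, φ x * ψ x * inner ℝ (outwardNormal K x) v ∂(bdry K) := by
  obtain ⟨a, ha⟩ := hK.exists_lipschitzOn hφ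
  obtain ⟨b, hb⟩ := lipschitzOn_mul hK.isCompact ha hψ
  rw [← hK.integral_fderiv_of_lipschitzOn hd hb v]
  refine integral_congr_ae ?_
  filter_upwards [hK.ae_differentiableAt hψ] with x hx
  rw [fderiv_fun_mul (hφ.differentiable one_ne_zero x) hx]
  simp only [_root_.add_apply, _root_.smul_apply, smul_eq_mul]
  ring

lemma fderiv_eq_inner_gradient (φ : E d → ℝ) (x v : E d) :
    fderiv ℝ φ x v = inner ℝ (gradient φ x) v := by
  simp [gradient]

lemma continuous_gradient {φ : E d → ℝ} (h : ContDiff ℝ 1 φ) : Continuous (gradient φ) :=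
  (InnerProductSpace.toDual ℝ (E d)).symm.continuous.comp (h.continuous_fderiv one_ne_zero)

/-- A ball of radius `ρ` about `p` inside `K` stays below every supporting hyperplane; apply this to
its extreme point in the direction of the normal. -/
lemma IsPolytope.exists_normal_lower_bound (hK : IsPolytope K) {p : E d} (hp : p ∈ interior K) :
    ∃ ρ : ℝ, 0 < ρ ∧ ∀ᵐ x ∂(bdry K), ρ ≤ inner ℝ (outwardNormal K x) (x - p) := by
  obtain ⟨ρ, hρ, hb⟩ := Metric.nhds_basis_closedBall.mem_iff.1 (mem_interior_iff_mem_nhds.1 hp)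
  refine ⟨ρ, hρ, ?_⟩
  filter_upwards [hK.ae_isOutwardNormal] with x hx
  have hf := hx.mem_face hK.convex hK.isClosed
  have hmem : p + ρ • outwardNormal K x ∈ K := hb (by
    simp [norm_smul, hx.1, abs_of_pos hρ])
  have := hf.2 _ hmem
  rw [inner_add_right, inner_smul_right, real_inner_self_eq_norm_sq, hx.1] at this
  rw [inner_sub_right]
  linarith

lemma memLp_of_isCompact {F : Type*} [NormedAddCommGroup F]
    (hK : IsCompact K) {μ : Measure (E d)} [IsFiniteMeasure (μ.restrict K)]
    {f : E d → F} (hf : Continuous f) [SecondCountableTopologyEither (E d) F] (p : ℝ≥0∞) :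
    MemLp f p (μ.restrict K) := by
  obtain ⟨M, hM⟩ := hK.exists_bound_of_continuousOn hf.continuousOn
  refine MemLp.of_bound hf.aestronglyMeasurable M ?_
  filter_upwards [ae_restrict_mem hK.measurableSet] with x hx using hM x hx

lemma eLpNorm_two_eq {F : Type*} [NormedAddCommGroup F] {μ : Measure (E d)} {f : E d → F}
    (hf : MemLp f 2 μ) : eLpNorm f 2 μ = ENNReal.ofReal (Real.sqrt (∫ x, ‖f x‖ ^ 2 ∂μ)) := by
  rw [hf.eLpNorm_eq_integral_rpow_norm two_ne_zero ENNReal.ofNat_ne_top, Real.sqrt_eq_rpow]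
  simp

lemma isFiniteMeasure_restrict_of_isCompact (hK : IsCompact K) :
    IsFiniteMeasure ((volume : Measure (E d)).restrict K) :=
  ⟨by simpa using hK.measure_lt_top⟩

lemma IsPolytope.memLp_bdry (hK : IsPolytope K) {F : Type*} [NormedAddCommGroup F]
    {f : E d → F} (hf : Continuous f) [SecondCountableTopologyEither (E d) F] (p : ℝ≥0∞) :
    MemLp f p (bdry K) := by
  have := hK.isFiniteMeasure_bdry
  obtain ⟨M, hM⟩ := hK.isCompact.exists_bound_of_continuousOn hf.continuousOn
  refine MemLp.of_bound hf.aestronglyMeasurable M ?_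
  filter_upwards [ae_restrict_mem isClosed_frontier.measurableSet] with x hx
  exact hM x (hK.isClosed.frontier_subset hx)

/-- The trace inequality on a convex polytope. -/
theorem IsPolytope.exists_trace_bound (hK : IsPolytope K) (hd : 1 ≤ d) :
    ∃ C : NNReal, ∀ φ : E d → ℝ, ContDiff ℝ 1 φ →
      eLpNorm φ 2 (bdry K) ≤ C * (eLpNorm φ 2 (volume.restrict K)
        + eLpNorm (gradient φ) 2 (volume.restrict K)) := by
  have := isFiniteMeasure_restrict_of_isCompact hK.isCompact
  obtain ⟨p, hp⟩ := hK.interior_nonempty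
  obtain ⟨ρ, hρ, hn⟩ := hK.exists_normal_lower_bound hp
  obtain ⟨R, hR⟩ := hK.isCompact.exists_bound_of_continuousOn (f := fun y => y - p) (by fun_prop)
  -- The numerator bounds the divergence of `φ² (x - p)` by `|φ|² + |∇φ|²`; the denominator is the
  -- lower bound for the normal component of `x - p`.
  set C0 : ℝ := (d + 1 + R ^ 2) / ρ with hC0
  have hC0' : 0 ≤ C0 := by positivity
  refine ⟨Real.toNNReal (Real.sqrt C0), fun φ hφ => ?_⟩
  have hgc := continuous_gradient hφ
  have m1 := hK.memLp_bdry hφ.continuous 2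
  have m2 : MemLp φ 2 (volume.restrict K) :=
    memLp_of_isCompact (μ := volume) hK.isCompact hφ.continuous 2
  have m3 : MemLp (gradient φ) 2 (volume.restrict K) :=
    memLp_of_isCompact (μ := volume) hK.isCompact hgc 2
  rw [eLpNorm_two_eq m1, eLpNorm_two_eq m2, eLpNorm_two_eq m3,
    ← ENNReal.ofReal_add (Real.sqrt_nonneg _) (Real.sqrt_nonneg _)]
  change _ ≤ ENNReal.ofReal (Real.sqrt C0) * _
  rw [← ENNReal.ofReal_mul (Real.sqrt_nonneg _)]
  refine ENNReal.ofReal_le_ofReal ?_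
  set A := ∫ x in K, ‖φ x‖ ^ 2
  set B := ∫ x in K, ‖gradient φ x‖ ^ 2
  have hA : 0 ≤ A := integral_nonneg fun _ => by positivity
  have hB : 0 ≤ B := integral_nonneg fun _ => by positivity
  obtain ⟨a, ha⟩ := hK.exists_lipschitzOn (φ := fun x => φ x ^ 2) (by fun_prop)
  obtain ⟨g, h1, h2, h3⟩ := exists_extension_of_lipschitzOn ha
  have hdiv := hK.integral_radialDiv hd hp h1
  have hl : ρ * ∫ x, ‖φ x‖ ^ 2 ∂(bdry K)
      ≤ ∫ x, g x * inner ℝ (outwardNormal K x) (x - p) ∂(bdry K) := by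
    rw [← integral_const_mul]
    refine integral_mono_ae (m1.norm.integrable_sq.const_mul ρ)
      (hK.integrable_mul_inner_normal h1.continuous (by fun_prop)) ?_
    filter_upwards [hn, ae_restrict_mem isClosed_frontier.measurableSet] with x hx hxf
    rw [← h2 (hK.isClosed.frontier_subset hxf), Real.norm_eq_abs, sq_abs, mul_comm]
    exact mul_le_mul_of_nonneg_left hx (sq_nonneg _)
  have hr : ∫ x in K, radialDiv g p x ≤ (d + 1 + R ^ 2) * (A + B) := by
    have i1 := (m2.norm.integrable_sq).const_mul (d + 1 + R ^ 2)
    have i2 := (m3.norm.integrable_sq).const_mul (d + 1 + R ^ 2)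
    rw [mul_add, ← integral_const_mul, ← integral_const_mul, ← integral_add i1 i2]
    refine integral_mono_ae (integrableOn_radialDiv h1 p hK.isCompact) (i1.add i2) ?_
    filter_upwards [hK.ae_mem_interior] with x hx
    have hxK := interior_subset hx
    have e : HasFDerivAt (fun x => φ x ^ 2) ((2 * φ x) • fderiv ℝ φ x) x := by
      simpa using (hφ.differentiable one_ne_zero x).hasFDerivAt.pow 2
    rw [radialDiv, ← h2 hxK, ← h3 x hx, e.fderiv]
    simp only [_root_.smul_apply, smul_eq_mul, fderiv_eq_inner_gradient]
    have q1 := abs_real_inner_le_norm (gradient φ x) (x - p)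
    have q2 : ‖x - p‖ ≤ R := hR x hxK
    set t := inner ℝ (gradient φ x) (x - p)
    set s := ‖gradient φ x‖ with hs
    have q3 : |t| ≤ s * R := q1.trans (mul_le_mul_of_nonneg_left q2 (norm_nonneg _))
    have q4 : t ^ 2 ≤ s ^ 2 * R ^ 2 := by
      rw [← sq_abs, ← mul_pow]; exact pow_le_pow_left₀ (abs_nonneg _) q3 2
    rw [Real.norm_eq_abs, sq_abs]
    have q5 : 0 ≤ φ x ^ 2 * R ^ 2 := by positivity
    have q6 : 0 ≤ s ^ 2 * (d + 1) := by positivity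
    -- The mixed term satisfies `2 φ t ≤ φ² + t²`, and `t²` is at most `R²` times the squared
    -- gradient.
    nlinarith [sq_nonneg (φ x - t)]
  have hS : ∫ x, ‖φ x‖ ^ 2 ∂(bdry K) ≤ C0 * (A + B) := by
    rw [hC0, div_mul_eq_mul_div, le_div_iff₀ hρ, mul_comm]
    linarith
  calc Real.sqrt (∫ x, ‖φ x‖ ^ 2 ∂(bdry K)) ≤ Real.sqrt (C0 * (A + B)) := Real.sqrt_le_sqrt hS
    _ = Real.sqrt C0 * Real.sqrt (A + B) := Real.sqrt_mul hC0' _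
    _ ≤ Real.sqrt C0 * (Real.sqrt A + Real.sqrt B) := by
        refine mul_le_mul_of_nonneg_left ?_ (Real.sqrt_nonneg _)
        rw [Real.sqrt_le_left (by positivity), add_sq, Real.sq_sqrt hA, Real.sq_sqrt hB]
        have : 0 ≤ 2 * Real.sqrt A * Real.sqrt B := by positivity
        linarith

end TraceInequality

/-! ### Mollification -/

section Mollify

variable {d : ℕ} {F : Type*} [NormedAddCommGroup F] [NormedSpace ℝ F]

/-- Mollification of `f` with the normalised bump function `b`. -/
def moll (b : ContDiffBump (0 : E d)) (f : E d → F) : E d → F :=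
  convolution (b.normed volume) f (ContinuousLinearMap.lsmul ℝ ℝ) volume

lemma lintegral_normed (b : ContDiffBump (0 : E d)) :
    ∫⁻ t, ENNReal.ofReal (b.normed volume t) = 1 := by
  rw [← ofReal_integral_eq_lintegral_ofReal b.integrable_normed
    (Eventually.of_forall b.nonneg_normed), b.integral_normed, ENNReal.ofReal_one]

/-- The normalised bump is a probability density, so this is Jensen's inequality for the square,
obtained from Hölder's inequality against the constant 1. -/
lemma enorm_moll_sq_le (b : ContDiffBump (0 : E d)) {f : E d → F} (hf : StronglyMeasurable f)
    (x : E d) :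
    ‖moll b f x‖ₑ ^ 2 ≤ ∫⁻ t, ENNReal.ofReal (b.normed volume t) * ‖f (x - t)‖ₑ ^ 2 := by
  have hbm : Measurable fun t => ENNReal.ofReal (b.normed (volume : Measure (E d)) t) :=
    b.continuous_normed.measurable.ennreal_ofReal
  have hfm : Measurable fun t => ‖f (x - t)‖ₑ :=
    (hf.enorm).comp (measurable_const.sub measurable_id)
  have h1 : ‖moll b f x‖ₑ ≤ ∫⁻ t, ENNReal.ofReal (b.normed volume t) * ‖f (x - t)‖ₑ := by
    refine (enorm_integral_le_lintegral_enorm _).trans (lintegral_mono fun t => ?_)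
    simp only [ContinuousLinearMap.lsmul_apply, enorm_smul]
    rw [Real.enorm_eq_ofReal (b.nonneg_normed t)]
  set μ := (volume : Measure (E d)).withDensity fun t => ENNReal.ofReal (b.normed volume t)
  have hμ : μ univ = 1 := by rw [withDensity_apply _ MeasurableSet.univ, Measure.restrict_univ,
    lintegral_normed]
  have h2 : ∫⁻ t, ENNReal.ofReal (b.normed volume t) * ‖f (x - t)‖ₑ
      = ∫⁻ t, ‖f (x - t)‖ₑ ∂μ := (lintegral_withDensity_eq_lintegral_mul _ hbm hfm).symm
  have h3 : ∫⁻ t, ENNReal.ofReal (b.normed volume t) * ‖f (x - t)‖ₑ ^ 2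
      = ∫⁻ t, ‖f (x - t)‖ₑ ^ 2 ∂μ :=
    (lintegral_withDensity_eq_lintegral_mul _ hbm (hfm.pow_const 2)).symm
  rw [h3]
  rw [h2] at h1
  refine (pow_le_pow_left' h1 2).trans ?_
  have h4 := ENNReal.lintegral_mul_le_Lp_mul_Lq μ Real.HolderConjugate.two_two
    hfm.aemeasurable (aemeasurable_const (b := (1 : ℝ≥0∞)))
  simp only [Pi.mul_apply, mul_one, ENNReal.one_rpow, lintegral_const, hμ] at h4
  calc (∫⁻ t, ‖f (x - t)‖ₑ ∂μ) ^ 2 ≤ ((∫⁻ t, ‖f (x - t)‖ₑ ^ (2:ℝ) ∂μ) ^ (1 / (2:ℝ))) ^ 2 :=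
        pow_le_pow_left' h4 2
    _ = ∫⁻ t, ‖f (x - t)‖ₑ ^ 2 ∂μ := by
        rw [← ENNReal.rpow_natCast, ← ENNReal.rpow_mul]
        simp

lemma lintegral_enorm_moll_sq_le (b : ContDiffBump (0 : E d)) {f : E d → F}
    (hf : StronglyMeasurable f) :
    ∫⁻ x, ‖moll b f x‖ₑ ^ 2 ≤ ∫⁻ x, ‖f x‖ₑ ^ 2 := by
  have hbm : Measurable fun t => ENNReal.ofReal (b.normed (volume : Measure (E d)) t) :=
    b.continuous_normed.measurable.ennreal_ofReal
  calc ∫⁻ x, ‖moll b f x‖ₑ ^ 2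
      ≤ ∫⁻ x, ∫⁻ t, ENNReal.ofReal (b.normed volume t) * ‖f (x - t)‖ₑ ^ 2 :=
        lintegral_mono (enorm_moll_sq_le b hf)
    _ = ∫⁻ t, ∫⁻ x, ENNReal.ofReal (b.normed volume t) * ‖f (x - t)‖ₑ ^ 2 := by
        refine lintegral_lintegral_swap (Measurable.aemeasurable ?_)
        exact (hbm.comp measurable_snd).mul
          ((hf.enorm.comp (measurable_fst.sub measurable_snd)).pow_const 2)
    _ = ∫⁻ t, ENNReal.ofReal (b.normed volume t) * ∫⁻ x, ‖f x‖ₑ ^ 2 := by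
        refine lintegral_congr fun t => ?_
        rw [lintegral_const_mul' _ _ ENNReal.ofReal_ne_top,
          lintegral_sub_right_eq_self (fun x => ‖f x‖ₑ ^ 2) t]
    _ = ∫⁻ x, ‖f x‖ₑ ^ 2 := by
        rw [lintegral_mul_const _ hbm, lintegral_normed, one_mul]

lemma eLpNorm_two_eq_lintegral {F' : Type*} [NormedAddCommGroup F'] (μ : Measure (E d))
    (f : E d → F') :
    eLpNorm f 2 μ = (∫⁻ x, ‖f x‖ₑ ^ 2 ∂μ) ^ (1 / (2:ℝ)) := by
  rw [eLpNorm_eq_lintegral_rpow_enorm_toReal two_ne_zero ENNReal.ofNat_ne_top]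
  simp

/-- Mollification does not increase the `L²` norm, and the dilation by `c` changes the squared norm
by `c⁻ᵈ`, at most `2 ^ d`. The bound is uniform in the bump and in `c`, as the density argument for
`tendsto_moll_comp` requires. -/
lemma eLpNorm_moll_comp_le (b : ContDiffBump (0 : E d)) {f : E d → F} (hf : StronglyMeasurable f)
    (p : E d) {c : ℝ} (hc : 1 / 2 ≤ c) :
    eLpNorm (fun x => moll b f (p + c • (x - p))) 2 volume
      ≤ ENNReal.ofReal (2 ^ d) ^ (1 / (2:ℝ)) * eLpNorm f 2 volume := by
  have hc0 : 0 < c := by linarith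
  rw [eLpNorm_two_eq_lintegral, eLpNorm_two_eq_lintegral,
    ← ENNReal.mul_rpow_of_nonneg _ _ (by norm_num)]
  refine ENNReal.rpow_le_rpow ?_ (by norm_num)
  have h1 : ∫⁻ x, ‖moll b f (p + c • (x - p))‖ₑ ^ 2 = ∫⁻ x, ‖moll b f (p + c • x)‖ₑ ^ 2 :=
    lintegral_sub_right_eq_self (fun x => ‖moll b f (p + c • x)‖ₑ ^ 2) p
  have h2 := lintegral_smul_comp (volume : Measure (E d)) hc0 (fun x => ‖moll b f (p + x)‖ₑ ^ 2)
  rw [lintegral_add_left_eq_self (fun x => ‖moll b f x‖ₑ ^ 2) p, finrank_euclideanSpace_fin] at h2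
  rw [h1]
  refine le_trans ?_ (mul_le_mul_right (lintegral_enorm_moll_sq_le b hf) _)
  rw [h2, ← mul_assoc, ← ENNReal.ofReal_mul (by positivity), ← mul_pow]
  refine le_mul_of_one_le_left zero_le ?_
  rw [← ENNReal.ofReal_one]
  exact ENNReal.ofReal_le_ofReal (one_le_pow₀ (by linarith))

lemma moll_add (b : ContDiffBump (0 : E d)) {f g : E d → F} (hf : LocallyIntegrable f)
    (hg : LocallyIntegrable g) : moll b (f + g) = moll b f + moll b g :=
  ConvolutionExists.distrib_add
    (b.hasCompactSupport_normed.convolutionExists_left _ b.continuous_normed hf)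
    (b.hasCompactSupport_normed.convolutionExists_left _ b.continuous_normed hg)

lemma contDiff_moll (b : ContDiffBump (0 : E d)) {f : E d → F} (hf : LocallyIntegrable f) :
    ContDiff ℝ 1 (moll b f) :=
  b.hasCompactSupport_normed.contDiff_convolution_left _ (n := 1) b.contDiff_normed hf

/-- Contraction towards a point and mollification converge to the identity in `L²`. -/
lemma tendsto_moll_comp [CompleteSpace F] {K : Set (E d)} (hK : IsCompact K) (p : E d)
    {f : E d → F} (hf : StronglyMeasurable f) (hf2 : MemLp f 2 volume)
    {b : ℕ → ContDiffBump (0 : E d)} (hb : Tendsto (fun n => (b n).rOut) atTop (𝓝 0))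
    {c : ℕ → ℝ} (hc : Tendsto c atTop (𝓝 1)) (hc2 : ∀ n, 1 / 2 ≤ c n) :
    Tendsto (fun n => eLpNorm (fun x => moll (b n) f (p + c n • (x - p)) - f x) 2
      (volume.restrict K)) atTop (𝓝 0) := by
  have := isFiniteMeasure_restrict_of_isCompact hK
  set D : ℝ≥0∞ := ENNReal.ofReal (2 ^ d) ^ (1 / (2:ℝ)) with hD
  have hDtop : D ≠ ⊤ := ENNReal.rpow_ne_top_of_nonneg (by norm_num) ENNReal.ofReal_ne_top
  obtain ⟨R, hR⟩ := hK.exists_bound_of_continuousOn (f := fun x => x - p) (by fun_prop)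
  set V : ℝ≥0∞ := (volume.restrict K) univ ^ (1 / (2:ℝ)) with hV
  have hVtop : V ≠ ⊤ := ENNReal.rpow_ne_top_of_nonneg (by norm_num) (measure_ne_top _ _)
  have key : ∀ ε : NNReal, 0 < ε → ∀ᶠ n in atTop,
      eLpNorm (fun x => moll (b n) f (p + c n • (x - p)) - f x) 2 (volume.restrict K)
        ≤ (D + 1 + V) * ε := by
    intro ε hε
    -- Split through a continuous compactly supported `g` close to `f` in `L²`. The uniform bound
    -- handles `f - g`; for `g`, uniform continuity gives a pointwise bound on `K`.
    obtain ⟨g, hgs, hfg, hgc, hg2⟩ := hf2.exists_hasCompactSupport_eLpNorm_sub_le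
      ENNReal.ofNat_ne_top (ε := ε) (by exact_mod_cast hε.ne')
    have hguc := hgs.uniformContinuous_of_continuous hgc
    obtain ⟨δ, hδ, hgδ⟩ := Metric.uniformContinuous_iff.1 hguc (ε / 2) (by positivity)
    have h1 : ∀ᶠ n in atTop, (b n).rOut < δ := hb.eventually_lt_const hδ
    have h2 : ∀ᶠ n in atTop, |c n - 1| * R < δ := by
      have : Tendsto (fun n => |c n - 1| * R) atTop (𝓝 (|1 - 1| * R)) :=
        ((hc.sub_const 1).abs).mul_const R
      refine this.eventually_lt_const ?_
      simpa using hδ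
    filter_upwards [h1, h2] with n hn1 hn2
    have hgsm : StronglyMeasurable g := hgc.stronglyMeasurable
    have hgli : LocallyIntegrable g := hgc.locallyIntegrable
    have hfli : LocallyIntegrable f := hf2.locallyIntegrable one_le_two
    have hcont : Continuous fun x : E d => p + c n • (x - p) := by fun_prop
    have hsplit : (fun x => moll (b n) f (p + c n • (x - p)) - f x)
        = (fun x => moll (b n) (f - g) (p + c n • (x - p)))
          + ((fun x => moll (b n) g (p + c n • (x - p)) - g x) + (g - f)) := by
      have e := moll_add (b n) (hfli.sub hgli) hgli
      rw [sub_add_cancel] at e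
      ext x
      simp only [e, Pi.add_apply, Pi.sub_apply]
      abel
    have m1 : AEStronglyMeasurable (fun x => moll (b n) (f - g) (p + c n • (x - p)))
        (volume.restrict K) :=
      ((contDiff_moll (b n) (hfli.sub hgli)).continuous.comp hcont).aestronglyMeasurable
    have m2 : AEStronglyMeasurable (fun x => moll (b n) g (p + c n • (x - p)) - g x)
        (volume.restrict K) :=
      (((contDiff_moll (b n) hgli).continuous.comp hcont).sub hgc).aestronglyMeasurable
    have m3 : AEStronglyMeasurable (g - f) (volume.restrict K) :=
      (hgsm.sub hf).aestronglyMeasurable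
    rw [hsplit]
    refine (eLpNorm_add_le m1 (m2.add m3) one_le_two).trans ?_
    refine (add_le_add_right (eLpNorm_add_le m2 m3 one_le_two) _).trans ?_
    have b1 : eLpNorm (fun x => moll (b n) (f - g) (p + c n • (x - p))) 2 (volume.restrict K)
        ≤ D * ε :=
      ((eLpNorm_mono_measure _ Measure.restrict_le_self).trans
        (eLpNorm_moll_comp_le (b n) (hf.sub hgsm) p (hc2 n))).trans (mul_le_mul_right hfg _)
    have b3 : eLpNorm (g - f) 2 (volume.restrict K) ≤ ε := by
      rw [eLpNorm_sub_comm]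
      exact (eLpNorm_mono_measure _ Measure.restrict_le_self).trans hfg
    have b2 : eLpNorm (fun x => moll (b n) g (p + c n • (x - p)) - g x) 2 (volume.restrict K)
        ≤ V * ε := by
      have hpt : ∀ᵐ x ∂(volume.restrict K),
          ‖moll (b n) g (p + c n • (x - p)) - g x‖ ≤ (ε : ℝ) := by
        filter_upwards [ae_restrict_mem hK.measurableSet] with x hx
        have d1 : dist (moll (b n) g (p + c n • (x - p))) (g (p + c n • (x - p))) ≤ ε / 2 :=
          ContDiffBump.dist_normed_convolution_le hgc.aestronglyMeasurable fun y hy =>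
            (hgδ (lt_trans (Metric.mem_ball.1 hy) hn1)).le
        have d2 : dist (g (p + c n • (x - p))) (g x) ≤ ε / 2 := by
          refine (hgδ ?_).le
          have : p + c n • (x - p) - x = (c n - 1) • (x - p) := by
            rw [sub_smul, one_smul]; abel
          rw [dist_eq_norm, this, norm_smul, Real.norm_eq_abs]
          exact lt_of_le_of_lt (mul_le_mul_of_nonneg_left (hR x hx) (abs_nonneg _)) hn2
        rw [← dist_eq_norm]
        linarith [dist_triangle (moll (b n) g (p + c n • (x - p))) (g (p + c n • (x - p))) (g x)]
      refine (eLpNorm_le_of_ae_bound hpt).trans (le_of_eq ?_)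
      simp [hV]
    calc _ ≤ D * ε + (V * ε + ε) := add_le_add b1 (add_le_add b2 b3)
      _ = (D + 1 + V) * ε := by ring
  set M : ℝ≥0∞ := D + 1 + V
  have hM0 : M ≠ 0 := by
    simp [M]
  have hMtop : M ≠ ⊤ := by simp [M, hDtop, hVtop]
  rw [ENNReal.tendsto_nhds_zero]
  intro ε hε
  obtain ⟨e, he0, he⟩ : ∃ e : NNReal, 0 < e ∧ M * e ≤ ε := by
    rcases eq_or_ne ε ⊤ with rfl | hεt
    · exact ⟨1, one_pos, le_top⟩
    · have hq : ε / M ≠ ⊤ := ENNReal.div_ne_top hεt hM0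
      refine ⟨(ε / M).toNNReal, ENNReal.toNNReal_pos (ENNReal.div_pos hε.ne' hMtop).ne' hq, ?_⟩
      rw [ENNReal.coe_toNNReal hq, ENNReal.mul_div_cancel hM0 hMtop]
  filter_upwards [key e he0] with n hn using hn.trans he

end Mollify

/-! ### Density of C¹ functions in `H¹` of a polytope. -/

section Density

variable {d : ℕ} {K U : Set (E d)}

lemma IsWeakGrad.congr_ae {w w' : E d → ℝ} {G G' : E d → E d} (h : IsWeakGrad U w G)
    (hw : w =ᵐ[volume.restrict U] w') (hG : G =ᵐ[volume.restrict U] G') : IsWeakGrad U w' G' := by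
  intro φ h1 h2 h3
  have e1 : ∫ x in U, w' x • gradient φ x = ∫ x in U, w x • gradient φ x := by
    refine integral_congr_ae ?_
    filter_upwards [hw] with x hx; rw [hx]
  have e2 : ∫ x in U, φ x • G' x = ∫ x in U, φ x • G x := by
    refine integral_congr_ae ?_
    filter_upwards [hG] with x hx; rw [hx]
  rw [e1, e2, h φ h1 h2 h3]

/-- The derivative of the convolution falls on the bump. The reflected bump centred at `x` is an
admissible test function since its support lies in `U`, and the sign from the reflection cancels the
sign in the weak gradient identity. -/
lemma gradient_moll (hU : IsOpen U) {w : E d → ℝ} {G : E d → E d}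
    (hw : MemLp w 2 (volume.restrict U)) (h : IsWeakGrad U w G) (b : ContDiffBump (0 : E d))
    {x : E d} (hx : Metric.closedBall x b.rOut ⊆ U) :
    gradient (moll b (U.indicator w)) x = moll b (U.indicator G) x := by
  set η : E d → ℝ := fun z => b.normed volume (x - z) with hη
  have hηs : ContDiff ℝ ∞ η := b.contDiff_normed.comp (contDiff_const.sub contDiff_id)
  have hsupp : tsupport η ⊆ Metric.closedBall x b.rOut := by
    refine closure_minimal (fun z hz => ?_) Metric.isClosed_closedBall
    have : x - z ∈ Function.support (b.normed (volume : Measure (E d))) := hz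
    rw [b.support_normed_eq] at this
    rw [Metric.mem_closedBall, dist_comm, dist_eq_norm]
    simpa using (mem_ball_zero_iff.1 this).le
  have hηc : HasCompactSupport η :=
    HasCompactSupport.of_support_subset_isCompact (isCompact_closedBall x b.rOut)
      ((subset_tsupport η).trans hsupp)
  have hgrad : ∀ z e, inner ℝ (gradient η z) e = -fderiv ℝ (b.normed volume) (x - z) e := by
    intro z e
    have hb : HasFDerivAt (b.normed volume) (fderiv ℝ (b.normed volume) (x - z)) (x - z) :=
      ((b.contDiff_normed (n := 1)).differentiable (by simp) _).hasFDerivAt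
    have h2 : HasFDerivAt η ((fderiv ℝ (b.normed volume) (x - z)).comp
        (-ContinuousLinearMap.id ℝ (E d))) z :=
      hb.comp z ((hasFDerivAt_id z).const_sub x)
    rw [← fderiv_eq_inner_gradient, h2.fderiv]
    simp
  have hfi : MemLp (U.indicator w) 2 volume := (memLp_indicator_iff_restrict hU.measurableSet).2 hw
  have hfl : LocallyIntegrable (U.indicator w) := hfi.locallyIntegrable one_le_two
  have hf := b.hasCompactSupport_normed.hasFDerivAt_convolution_left
    (ContinuousLinearMap.lsmul ℝ ℝ) (b.contDiff_normed (μ := volume) (n := 1)) hfl x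
  have hint : Integrable (fun z => w z • gradient η z) (volume.restrict U) :=
    memLp_one_iff_integrable.1 (MemLp.smul (p := 2) (q := 2)
      ((gradient_continuous hηs).memLp_of_hasCompactSupport (gradient_compactSupport hηc)) hw)
  refine ext_inner_right ℝ fun e => ?_
  have hwk := h η hηs hηc (hsupp.trans hx)
  have hr : moll b (U.indicator G) x = ∫ z in U, η z • G z := by
    rw [moll, convolution_lsmul_swap, ← integral_indicator hU.measurableSet]
    refine integral_congr_ae (Eventually.of_forall fun z => ?_)
    by_cases hz : z ∈ U <;> simp [hz, hη]
  have hex : ConvolutionExistsAt (fderiv ℝ (b.normed volume)) (U.indicator w) x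
      ((ContinuousLinearMap.lsmul ℝ ℝ).precompL (E d)) volume :=
    (b.hasCompactSupport_normed.fderiv (𝕜 := ℝ)).convolutionExists_left _
      ((b.contDiff_normed (n := 1)).continuous_fderiv (by simp)) hfl x
  rw [hr, ← fderiv_eq_inner_gradient, ← neg_eq_iff_eq_neg.2 hwk, inner_neg_left, ← real_inner_comm,
    ← integral_inner hint]
  change fderiv ℝ (convolution (b.normed volume) (U.indicator w)
    (ContinuousLinearMap.lsmul ℝ ℝ) volume) x e = _
  rw [hf.fderiv, convolution_def, ContinuousLinearMap.integral_apply hex, ← integral_neg,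
    ← integral_indicator hU.measurableSet]
  rw [← integral_sub_left_eq_self _ volume x]
  refine integral_congr_ae (Eventually.of_forall fun z => ?_)
  by_cases hz : z ∈ U
  · rw [indicator_of_mem hz, inner_smul_right, real_inner_comm (gradient η z) e, hgrad, mul_neg,
      neg_neg]
    simp [hz, ContinuousLinearMap.precompL_apply, mul_comm]
  · simp [hz]

/-- Contraction towards `p` by the factor `c` leaves room proportional to `1 - c`: a point of the
small ball is a convex combination, with weights `1 - c` and `c`, of a point in the ball about `p`
and of `x`. -/
lemma closedBall_subset_interior (hK : Convex ℝ K) {p x : E d} {ρ c : ℝ}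
    (hp : Metric.ball p ρ ⊆ K) (hρ : 0 < ρ) (hc0 : 0 ≤ c) (hc : c < 1) (hx : x ∈ K) :
    Metric.closedBall (p + c • (x - p)) ((1 - c) * ρ / 2) ⊆ interior K := by
  intro y hy
  have h1 : 0 < 1 - c := by linarith
  set q := p + (1 - c)⁻¹ • (y - (p + c • (x - p))) with hq
  have hqi : q ∈ interior K := by
    refine (interior_maximal hp Metric.isOpen_ball) ?_
    rw [Metric.mem_ball, dist_eq_norm, hq, add_sub_cancel_left, norm_smul, norm_inv,
      Real.norm_of_nonneg h1.le, inv_mul_lt_iff₀ h1]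
    rw [Metric.mem_closedBall, dist_eq_norm] at hy
    have : 0 < (1 - c) * ρ := mul_pos h1 hρ
    linarith
  have : y = (1 - c) • q + c • x := by
    rw [hq, smul_add, smul_inv_smul₀ h1.ne', sub_smul, one_smul, smul_sub]; abel
  rw [this]
  exact hK.combo_interior_self_mem_interior hqi hx h1 hc0 (by ring)

/-- Functions that are `C¹` up to the boundary are dense in `H¹` of a convex polytope. -/
theorem IsPolytope.exists_smooth_approx (hK : IsPolytope K) {w : E d → ℝ} {G : E d → E d}
    (hw : MemLp w 2 (volume.restrict K)) (hG : MemLp G 2 (volume.restrict K))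
    (h : IsWeakGrad (interior K) w G) :
    ∃ φ : ℕ → E d → ℝ, (∀ n, ContDiff ℝ 1 (φ n)) ∧
      Tendsto (fun n => eLpNorm (φ n - w) 2 (volume.restrict K)) atTop (𝓝 0) ∧
      Tendsto (fun n => eLpNorm (gradient (φ n) - G) 2 (volume.restrict K)) atTop (𝓝 0) := by
  obtain ⟨p, hp⟩ := hK.interior_nonempty
  obtain ⟨ρ, hρ, hball⟩ := Metric.mem_nhds_iff.1 (mem_interior_iff_mem_nhds.1 hp)
  set U := interior K with hU
  have hrestr : volume.restrict U = (volume : Measure (E d)).restrict K :=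
    Measure.restrict_congr_set (Filter.EventuallyLE.antisymm interior_subset.eventuallyLE
      (ae_le_set.2 (volume_diff_interior hK)))
  rw [← hrestr] at hw hG ⊢
  set w' := hw.1.mk w
  set G' := hG.1.mk G
  have hww : w =ᵐ[volume.restrict U] w' := hw.1.ae_eq_mk
  have hGG : G =ᵐ[volume.restrict U] G' := hG.1.ae_eq_mk
  have h' := h.congr_ae hww hGG
  have hw' : MemLp w' 2 (volume.restrict U) := hw.ae_eq hww
  have hG' : MemLp G' 2 (volume.restrict U) := hG.ae_eq hGG
  set f := U.indicator w'
  set F := U.indicator G'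
  have hUm : MeasurableSet U := isOpen_interior.measurableSet
  have hfs : StronglyMeasurable f := hw.1.stronglyMeasurable_mk.indicator hUm
  have hFs : StronglyMeasurable F := hG.1.stronglyMeasurable_mk.indicator hUm
  have hf2 : MemLp f 2 volume := (memLp_indicator_iff_restrict hUm).2 hw'
  have hF2 : MemLp F 2 volume := (memLp_indicator_iff_restrict hUm).2 hG'
  have hfl : LocallyIntegrable f := hf2.locallyIntegrable one_le_two
  -- Below 1, so that there is room for the mollifier; the shift by 2 keeps the factor at least `1 /
  -- 2` from `n = 0` on, as the uniform `L²` bound demands.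
  set c : ℕ → ℝ := fun n => 1 - 1 / ((n : ℝ) + 2) with hcdef
  have hc1 : ∀ n, c n < 1 := fun n => by
    have : (0:ℝ) < 1 / ((n : ℝ) + 2) := by positivity
    simp only [c]; linarith
  have hc2 : ∀ n, 1 / 2 ≤ c n := fun n => by
    have : 1 / ((n : ℝ) + 2) ≤ 1 / 2 := by
      apply one_div_le_one_div_of_le <;> linarith [(Nat.cast_nonneg n : (0:ℝ) ≤ n)]
    simp only [c]; linarith
  have hc : Tendsto c atTop (𝓝 1) := by
    have h1 : Tendsto (fun n : ℕ => 1 / ((n : ℝ) + 2)) atTop (𝓝 0) := by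
      have := (tendsto_const_nhds (x := (1:ℝ))).div_atTop
        (tendsto_natCast_atTop_atTop (R := ℝ) |>.atTop_add (tendsto_const_nhds (x := (2:ℝ))))
      exact this
    simpa [c] using h1.const_sub 1
  have hr0 : ∀ n, 0 < (1 - c n) * ρ / 2 := fun n => by
    have := sub_pos.2 (hc1 n)
    positivity
  -- The outer radius is the one allowed by `closedBall_subset_interior`, so at contracted points
  -- the mollifier never sees the jump of the zero extension across the boundary.
  let b : ℕ → ContDiffBump (0 : E d) := fun n =>
    ⟨(1 - c n) * ρ / 2 / 2, (1 - c n) * ρ / 2, half_pos (hr0 n), half_lt_self (hr0 n)⟩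
  have hb : Tendsto (fun n => (b n).rOut) atTop (𝓝 0) := by
    have : Tendsto (fun n => (1 - c n) * ρ / 2) atTop (𝓝 ((1 - 1) * ρ / 2)) :=
      ((hc.const_sub 1).mul_const ρ).div_const 2
    simpa using this
  set φ : ℕ → E d → ℝ := fun n x => moll (b n) f (p + c n • (x - p)) with hφ
  have hφ1 : ∀ n, ContDiff ℝ 1 (φ n) := fun n =>
    (contDiff_moll (b n) hfl).comp (by fun_prop)
  have hgrad : ∀ n, ∀ x ∈ K, gradient (φ n) x = c n • moll (b n) F (p + c n • (x - p)) := by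
    intro n x hx
    have hsub : Metric.closedBall (p + c n • (x - p)) (b n).rOut ⊆ U :=
      closedBall_subset_interior hK.convex hball hρ (by linarith [hc2 n]) (hc1 n) hx
    rw [← gradient_moll isOpen_interior hw' h' (b n) hsub]
    have hin : HasFDerivAt (fun x => p + c n • (x - p)) (c n • ContinuousLinearMap.id ℝ (E d)) x :=
      (((hasFDerivAt_id x).sub_const p).const_smul (c n)).const_add p
    have hout := ((contDiff_moll (b n) hfl).differentiable one_ne_zero
      (p + c n • (x - p))).hasFDerivAt
    have := (hout.comp x hin).fderiv
    refine ext_inner_right ℝ fun e => ?_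
    rw [← fderiv_eq_inner_gradient, real_inner_smul_left, ← fderiv_eq_inner_gradient]
    change fderiv ℝ (moll (b n) f ∘ fun x => p + c n • (x - p)) x e = _
    rw [this]
    simp [f, hU]
  have hfw : f =ᵐ[volume.restrict U] w := by
    filter_upwards [hww, ae_restrict_mem hUm] with x hx hxU
    simp [f, hxU, hx]
  have hFG : F =ᵐ[volume.restrict U] G := by
    filter_upwards [hGG, ae_restrict_mem hUm] with x hx hxU
    simp [F, hxU, hx]
  refine ⟨φ, hφ1, ?_, ?_⟩
  · have := tendsto_moll_comp hK.isCompact p hfs hf2 hb hc hc2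
    rw [← hrestr] at this
    refine this.congr fun n => eLpNorm_congr_ae ?_
    filter_upwards [hfw] with x hx
    simp [hφ, hx]
  · have h1 := tendsto_moll_comp hK.isCompact p hFs hF2 hb hc hc2
    rw [← hrestr] at h1
    -- The chain rule multiplies the mollified gradient by `c n`, which costs the additional error
    -- `(c n - 1) • F`.
    have hle : ∀ n, eLpNorm (gradient (φ n) - G) 2 (volume.restrict U)
        ≤ eLpNorm (fun x => moll (b n) F (p + c n • (x - p)) - F x) 2 (volume.restrict U)
          + ‖c n - 1‖ₑ * eLpNorm F 2 (volume.restrict U) := by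
      intro n
      have hFl : LocallyIntegrable F := hF2.locallyIntegrable one_le_two
      have hcn : ‖c n‖ₑ ≤ 1 := by
        rw [Real.enorm_eq_ofReal (by linarith [hc2 n]), ← ENNReal.ofReal_one]
        exact ENNReal.ofReal_le_ofReal (hc1 n).le
      have e : gradient (φ n) - G =ᵐ[volume.restrict U]
          (c n • (fun x => moll (b n) F (p + c n • (x - p)) - F x)) + (c n - 1) • F := by
        filter_upwards [hFG, ae_restrict_mem hUm] with x hx hxU
        simp only [Pi.sub_apply, Pi.add_apply, Pi.smul_apply, hgrad n x (interior_subset hxU),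
          ← hx, smul_sub, sub_smul, one_smul]
        abel
      have m1 : AEStronglyMeasurable (fun x => moll (b n) F (p + c n • (x - p)) - F x)
          (volume.restrict U) :=
        (((contDiff_moll (b n) hFl).continuous.comp (by fun_prop)).aestronglyMeasurable).sub
          hFs.aestronglyMeasurable
      rw [eLpNorm_congr_ae e]
      refine (eLpNorm_add_le (m1.const_smul _) (hFs.aestronglyMeasurable.const_smul _)
        one_le_two).trans ?_
      rw [eLpNorm_const_smul, eLpNorm_const_smul]
      gcongr
      exact mul_le_of_le_one_left zero_le hcn
    have h2 : Tendsto (fun n => ‖c n - 1‖ₑ * eLpNorm F 2 (volume.restrict U)) atTop (𝓝 0) := by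
      have h3 : Tendsto (fun n => ‖c n - 1‖ₑ) atTop (𝓝 0) := by
        have := (hc.sub_const 1).enorm
        simpa using this
      have hFne : eLpNorm F 2 (volume.restrict U) ≠ ⊤ := hF2.restrict U |>.2.ne
      simpa using ENNReal.Tendsto.mul_const h3 (Or.inr hFne)
    have h4 := h1.add h2
    rw [add_zero] at h4
    exact tendsto_of_tendsto_of_tendsto_of_le_of_le tendsto_const_nhds h4
      (fun _ => zero_le) hle

end Density

/-! ### Traces on polytopes -/

section Trace

variable {d : ℕ} {K Ω : Set (E d)}

/-- `K` is a convex polytope whose interior lies in the open set `Ω`. -/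
structure IsCell (Ω K : Set (E d)) : Prop where
  polytope : IsPolytope K
  isOpen : IsOpen Ω
  interior_subset : interior K ⊆ Ω
  one_le : 1 ≤ d

lemma IsPolytope.restrict_interior (hK : IsPolytope K) :
    (volume : Measure (E d)).restrict (interior K) = volume.restrict K :=
  Measure.restrict_congr_set (Filter.EventuallyLE.antisymm interior_subset.eventuallyLE
    (ae_le_set.2 (volume_diff_interior hK)))

lemma IsCell.restrict_le (hK : IsCell Ω K) :
    (volume : Measure (E d)).restrict K ≤ volume.restrict Ω := by
  rw [← hK.polytope.restrict_interior]
  exact Measure.restrict_mono hK.interior_subset le_rfl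

lemma IsCell.isWeakGrad (hK : IsCell Ω K) {w : E d → ℝ} {G : E d → E d} (h : IsWeakGrad Ω w G) :
    IsWeakGrad (interior K) w G := by
  intro φ h1 h2 h3
  have hz : ∀ x, x ∉ interior K → φ x = 0 ∧ gradient φ x = 0 := by
    intro x hx
    have hx' : x ∉ tsupport φ := fun h => hx (h3 h)
    refine ⟨image_eq_zero_of_notMem_tsupport hx', ?_⟩
    have : fderiv ℝ φ x = 0 := by
      by_contra hne
      exact hx' (support_fderiv_subset ℝ hne)
    simp [gradient, this]
  have e1 := setIntegral_eq_of_subset_of_forall_sdiff_eq_zero (μ := volume)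
    (f := fun x => w x • gradient φ x) hK.isOpen.measurableSet hK.interior_subset
    (fun x hx => by simp [(hz x hx.2).2])
  have e2 := setIntegral_eq_of_subset_of_forall_sdiff_eq_zero (μ := volume)
    (f := fun x => φ x • G x) hK.isOpen.measurableSet hK.interior_subset
    (fun x hx => by simp [(hz x hx.2).1])
  rw [← e1, ← e2]
  exact h φ h1 h2 (h3.trans hK.interior_subset)

lemma tendsto_integral_smul {μ : Measure (E d)} {F : Type*} [NormedAddCommGroup F]
    [NormedSpace ℝ F] {f : ℕ → E d → F} {f0 : E d → F} {h : E d → ℝ} (hf : ∀ n, MemLp (f n) 2 μ)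
    (hf0 : MemLp f0 2 μ) (hh : MemLp h 2 μ)
    (ht : Tendsto (fun n => eLpNorm (f n - f0) 2 μ) atTop (𝓝 0)) :
    Tendsto (fun n => ∫ x, h x • f n x ∂μ) atTop (𝓝 (∫ x, h x • f0 x ∂μ)) := by
  have hi : ∀ {g : E d → F}, MemLp g 2 μ → Integrable (fun x => h x • g x) μ := fun hg =>
    memLp_one_iff_integrable.1 (MemLp.smul (p := 2) (q := 2) hg hh)
  refine tendsto_integral_of_L1' _ (hi hf0).1 (Eventually.of_forall fun n => hi (hf n)) ?_
  have hle : ∀ n, eLpNorm ((fun x => h x • f n x) - fun x => h x • f0 x) 1 μ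
      ≤ eLpNorm h 2 μ * eLpNorm (f n - f0) 2 μ := by
    intro n
    have : ((fun x => h x • f n x) - fun x => h x • f0 x) = h • (f n - f0) := by
      ext x; simp [smul_sub]
    rw [this]
    exact eLpNorm_smul_le_mul_eLpNorm (p := 2) (q := 2) (r := 1)
      ((hf n).1.sub hf0.1) hh.1
  have h2 : Tendsto (fun n => eLpNorm h 2 μ * eLpNorm (f n - f0) 2 μ) atTop (𝓝 0) := by
    simpa using ENNReal.Tendsto.const_mul ht (Or.inr hh.2.ne)
  exact tendsto_of_tendsto_of_tendsto_of_le_of_le tendsto_const_nhds h2 (fun _ => zero_le) hle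

lemma eLpNorm_inner_le {μ : Measure (E d)} (q : E d → E d) (e : E d) :
    eLpNorm (fun x => (inner ℝ (q x) e : ℝ)) 2 μ ≤ ‖e‖ₑ * eLpNorm q 2 μ := by
  rw [← enorm_norm e, ← eLpNorm_const_smul]
  refine eLpNorm_mono fun x => ?_
  simp only [Pi.smul_apply, norm_smul, norm_norm]
  rw [mul_comm]
  exact norm_inner_le_norm _ _

lemma memLp_inner_const {μ : Measure (E d)} {q : E d → E d} (hq : MemLp q 2 μ) (e : E d) :
    MemLp (fun x => (inner ℝ (q x) e : ℝ)) 2 μ :=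
  ⟨hq.1.inner aestronglyMeasurable_const,
    (eLpNorm_inner_le q e).trans_lt (ENNReal.mul_lt_top (by simp) hq.2)⟩

lemma IsPolytope.memLp_volume (hK : IsPolytope K) {F : Type*} [NormedAddCommGroup F]
    {f : E d → F} (hf : Continuous f) [SecondCountableTopologyEither (E d) F] (p : ℝ≥0∞) :
    MemLp f p (volume.restrict K) := by
  have := isFiniteMeasure_restrict_of_isCompact hK.isCompact
  exact memLp_of_isCompact (μ := volume) hK.isCompact hf p

lemma IsPolytope.memLp_of_lipschitzOn (hK : IsPolytope K) {ψ : E d → ℝ} {c : NNReal}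
    (hψ : LipschitzOnWith c ψ K) : MemLp ψ 2 (volume.restrict K) ∧ MemLp ψ 2 (bdry K) ∧
      ∀ e, MemLp (fun x => fderiv ℝ ψ x e) 2 (volume.restrict K) := by
  have := isFiniteMeasure_restrict_of_isCompact hK.isCompact
  obtain ⟨g, h1, h2, h3⟩ := exists_extension_of_lipschitzOn hψ
  refine ⟨(hK.memLp_volume h1.continuous 2).ae_eq ?_, (hK.memLp_bdry h1.continuous 2).ae_eq ?_,
    fun e => ?_⟩
  · filter_upwards [ae_restrict_mem hK.isClosed.measurableSet] with x hx using (h2 hx).symm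
  · filter_upwards [ae_restrict_mem isClosed_frontier.measurableSet] with x hx
    exact (h2 (hK.isClosed.frontier_subset hx)).symm
  · have hb : MemLp (fun x => fderiv ℝ g x e) 2 (volume.restrict K) :=
      MemLp.of_bound (measurable_fderiv_apply_const ℝ g e).aestronglyMeasurable (c * ‖e‖)
        (Eventually.of_forall fun x =>
          (fderiv ℝ g x).le_of_opNorm_le (norm_fderiv_le_of_lipschitz ℝ h1) _)
    refine hb.ae_eq ?_
    filter_upwards [hK.ae_mem_interior] with x hx
    rw [h3 x hx]

lemma IsPolytope.memLp_mul_normal (hK : IsPolytope K) {g : E d → ℝ} (hg : MemLp g 2 (bdry K))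
    (e : E d) : MemLp (fun x => g x * inner ℝ (outwardNormal K x) e) 2 (bdry K) := by
  refine (hg.norm.const_mul ‖e‖).mono'
    (hg.1.mul (hK.aestronglyMeasurable_outwardNormal.inner aestronglyMeasurable_const))
    (Eventually.of_forall fun x => ?_)
  rw [norm_mul, mul_comm]
  refine mul_le_mul_of_nonneg_right ((norm_inner_le_norm _ _).trans ?_) (norm_nonneg _)
  exact mul_le_of_le_one_left (norm_nonneg _) (norm_outwardNormal_le K x)

/-- Green's formula for limits of smooth functions. -/
lemma IsPolytope.green_of_tendsto (hK : IsPolytope K) (hd : 1 ≤ d) {w g : E d → ℝ}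
    {G : E d → E d} {φ : ℕ → E d → ℝ} (hw : MemLp w 2 (volume.restrict K))
    (hg : MemLp g 2 (bdry K)) (hG : MemLp G 2 (volume.restrict K)) (hφ : ∀ n, ContDiff ℝ 1 (φ n))
    (t1 : Tendsto (fun n => eLpNorm (φ n - w) 2 (volume.restrict K)) atTop (𝓝 0))
    (t2 : Tendsto (fun n => eLpNorm (gradient (φ n) - G) 2 (volume.restrict K)) atTop (𝓝 0))
    (t3 : Tendsto (fun n => eLpNorm (φ n - g) 2 (bdry K)) atTop (𝓝 0))
    {ψ : E d → ℝ} {c : NNReal} (hψ : LipschitzOnWith c ψ K) (e : E d) :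
    ∫ x in K, (inner ℝ (G x) e * ψ x + w x * fderiv ℝ ψ x e)
      = ∫ x, g x * ψ x * inner ℝ (outwardNormal K x) e ∂(bdry K) := by
  obtain ⟨p1, p2, p3⟩ := hK.memLp_of_lipschitzOn hψ
  have m1 : ∀ n, MemLp (φ n) 2 (volume.restrict K) := fun n => hK.memLp_volume (hφ n).continuous 2
  have m2 : ∀ n, MemLp (gradient (φ n)) 2 (volume.restrict K) := fun n =>
    hK.memLp_volume (continuous_gradient (hφ n)) 2
  have m3 : ∀ n, MemLp (φ n) 2 (bdry K) := fun n => hK.memLp_bdry (hφ n).continuous 2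
  have t2' : Tendsto (fun n => eLpNorm ((fun x => (inner ℝ (gradient (φ n) x) e : ℝ))
      - fun x => (inner ℝ (G x) e : ℝ)) 2 (volume.restrict K)) atTop (𝓝 0) := by
    have h2 : Tendsto (fun n => ‖e‖ₑ * eLpNorm (gradient (φ n) - G) 2 (volume.restrict K))
        atTop (𝓝 0) := by
      simpa using ENNReal.Tendsto.const_mul t2 (Or.inr (by simp))
    refine tendsto_of_tendsto_of_tendsto_of_le_of_le tendsto_const_nhds h2 (fun _ => zero_le)
      fun n => ?_
    refine le_trans (le_of_eq ?_) (eLpNorm_inner_le _ e)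
    congr 1
    ext x
    simp [inner_sub_left]
  -- Each term of the formula for C¹ functions pairs an `L²`-convergent sequence with a fixed `L²`
  -- function, so the limit can be taken termwise.
  have l1 := tendsto_integral_smul (fun n => memLp_inner_const (m2 n) e)
    (memLp_inner_const hG e) p1 t2'
  have l2 := tendsto_integral_smul m1 hw (p3 e) t1
  have l3 := tendsto_integral_smul m3 hg (hK.memLp_mul_normal p2 e) t3
  have i : ∀ {a b : E d → ℝ}, MemLp a 2 (volume.restrict K) → MemLp b 2 (volume.restrict K) →
      Integrable (fun x => a x • b x) (volume.restrict K) := fun ha hb =>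
    memLp_one_iff_integrable.1 (MemLp.smul (p := 2) (q := 2) hb ha)
  have l12 := l1.add l2
  rw [← integral_add (i p1 (memLp_inner_const hG e)) (i (p3 e) hw)] at l12
  have heq : ∀ n, (∫ x in K, ψ x • (inner ℝ (gradient (φ n) x) e : ℝ))
      + ∫ x in K, fderiv ℝ ψ x e • φ n x
      = ∫ x, (ψ x * inner ℝ (outwardNormal K x) e) • φ n x ∂(bdry K) := by
    intro n
    rw [← integral_add (i p1 (memLp_inner_const (m2 n) e)) (i (p3 e) (m1 n))]
    have := hK.integral_mul_fderiv hd (hφ n) hψ e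
    simp only [fderiv_eq_inner_gradient (φ n)] at this
    convert this using 2
    · ext x; simp only [smul_eq_mul]; ring
    · ext x; simp only [smul_eq_mul]; ring
  have := tendsto_nhds_unique (l12.congr heq) l3
  convert this using 2
  · ext x; simp only [smul_eq_mul]; ring
  · ext x; simp only [smul_eq_mul]; ring

lemma ae_eq_zero_of_forall_integral_smul {U : Set (E d)} (hU : IsOpen U) {F : Type*}
    [NormedAddCommGroup F] [NormedSpace ℝ F] [CompleteSpace F] {D : E d → F}
    (hD : MemLp D 2 (volume.restrict U))
    (h : ∀ φ : E d → ℝ, ContDiff ℝ ∞ φ → HasCompactSupport φ → tsupport φ ⊆ U →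
      ∫ x in U, φ x • D x = 0) : ∀ᵐ x ∂(volume.restrict U), D x = 0 := by
  have hli : LocallyIntegrable (U.indicator D) volume :=
    ((memLp_indicator_iff_restrict hU.measurableSet).2 hD).locallyIntegrable one_le_two
  have := hU.ae_eq_zero_of_integral_contDiff_smul_eq_zero (hli.locallyIntegrableOn U)
    (fun φ h1 h2 h3 => by
      rw [← h φ h1 h2 h3, ← integral_indicator hU.measurableSet]
      refine integral_congr_ae (Eventually.of_forall fun x => ?_)
      by_cases hx : x ∈ U <;> simp [hx])
  rw [ae_restrict_iff' hU.measurableSet]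
  filter_upwards [this] with x hx hxU
  simpa [hxU] using hx hxU

lemma IsPolytope.lipschitzOn_smooth (hK : IsPolytope K) {φ : E d → ℝ} (hφ : ContDiff ℝ ∞ φ) :
    ∃ c, LipschitzOnWith c φ K := hK.exists_lipschitzOn (hφ.of_le (by simp))

/-- `IsTrace` asks only that the gradients of the approximants converge somewhere. Green's formula
for that limit, tested with functions supported in the interior, shows that the limit is the weak
gradient. -/
lemma IsPolytope.gradient_limit_unique (hK : IsPolytope K) {w g : E d → ℝ}
    {G G' : E d → E d} (hw : MemLp w 2 (volume.restrict K)) (hG : MemLp G 2 (volume.restrict K))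
    (hG' : MemLp G' 2 (volume.restrict K)) (h : IsWeakGrad (interior K) w G)
    (hgreen : ∀ (ψ : E d → ℝ) (c : NNReal), LipschitzOnWith c ψ K → ∀ e : E d,
      ∫ x in K, (inner ℝ (G' x) e * ψ x + w x * fderiv ℝ ψ x e)
        = ∫ x, g x * ψ x * inner ℝ (outwardNormal K x) e ∂(bdry K)) :
    G =ᵐ[volume.restrict K] G' := by
  have key : ∀ᵐ x ∂(volume.restrict (interior K)), G' x - G x = 0 := by
    refine ae_eq_zero_of_forall_integral_smul isOpen_interior
      (by rw [hK.restrict_interior]; exact hG'.sub hG) fun φ h1 h2 h3 => ?_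
    obtain ⟨c, hc⟩ := hK.lipschitzOn_smooth h1
    have hφ2 : MemLp φ 2 (volume.restrict K) := hK.memLp_volume h1.continuous 2
    have hgc := gradient_continuous h1
    have hφg : MemLp (gradient φ) 2 (volume.restrict K) := hK.memLp_volume hgc 2
    have i1 : Integrable (fun x => φ x • G x) (volume.restrict K) :=
      memLp_one_iff_integrable.1 (MemLp.smul (p := 2) (q := 2) hG hφ2)
    have i2 : Integrable (fun x => φ x • G' x) (volume.restrict K) :=
      memLp_one_iff_integrable.1 (MemLp.smul (p := 2) (q := 2) hG' hφ2)
    have i3 : Integrable (fun x => w x • gradient φ x) (volume.restrict K) :=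
      memLp_one_iff_integrable.1 (MemLp.smul (p := 2) (q := 2) hφg hw)
    have hwk := h φ h1 h2 h3
    rw [hK.restrict_interior] at hwk ⊢
    simp only [smul_sub]
    rw [integral_sub i2 i1, ← neg_eq_iff_eq_neg.2 hwk, sub_neg_eq_add]
    refine ext_inner_left ℝ fun e => ?_
    rw [inner_zero_right, inner_add_right, ← integral_inner i2, ← integral_inner i3,
      ← integral_add (i2.const_inner e) (i3.const_inner e)]
    have hg0 : ∫ x, g x * φ x * inner ℝ (outwardNormal K x) e ∂(bdry K) = 0 := by
      refine integral_eq_zero_of_ae ?_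
      filter_upwards [ae_restrict_mem isClosed_frontier.measurableSet] with x hx
      have : φ x = 0 := image_eq_zero_of_notMem_tsupport fun h => hx.2 (h3 h)
      simp [this]
    rw [← hg0, ← hgreen φ c hc e]
    refine integral_congr_ae (Eventually.of_forall fun x => ?_)
    simp only [inner_smul_right, fderiv_eq_inner_gradient, real_inner_comm e]
    ring
  rw [hK.restrict_interior] at key
  filter_upwards [key] with x hx
  exact (sub_eq_zero.1 hx).symm

/-- Green's formula for `H¹` functions with a trace. -/
theorem IsPolytope.green (hK : IsPolytope K) (hd : 1 ≤ d) {w g : E d → ℝ}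
    {G : E d → E d} (ht : IsTrace K w g) (hG : MemLp G 2 (volume.restrict K))
    (h : IsWeakGrad (interior K) w G) {ψ : E d → ℝ} {c : NNReal} (hψ : LipschitzOnWith c ψ K)
    (e : E d) :
    ∫ x in K, (inner ℝ (G x) e * ψ x + w x * fderiv ℝ ψ x e)
      = ∫ x, g x * ψ x * inner ℝ (outwardNormal K x) e ∂(bdry K) := by
  obtain ⟨hw, hg, φ, G', hG', hφ, t1, t2, t3⟩ := ht
  have hgreen : ∀ (ψ : E d → ℝ) (c : NNReal), LipschitzOnWith c ψ K → ∀ e : E d, _ :=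
    fun ψ c hψ e => hK.green_of_tendsto hd hw hg hG' hφ t1 t2 t3 hψ e
  rw [← hgreen ψ c hψ e]
  refine integral_congr_ae ?_
  filter_upwards [hK.gradient_limit_unique hw hG hG' h hgreen] with x hx
  rw [hx]

/-- The hypothesis says that the vector field `f n` integrates to zero against all smooth functions,
so it vanishes almost everywhere; the normal `n` has length 1 almost everywhere. -/
lemma IsPolytope.ae_eq_zero_of_bdry_integral (hK : IsPolytope K) {f : E d → ℝ}
    (hf : MemLp f 2 (bdry K))
    (h : ∀ (ψ : E d → ℝ), ContDiff ℝ ∞ ψ → ∀ e,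
      ∫ x, f x * ψ x * inner ℝ (outwardNormal K x) e ∂(bdry K) = 0) :
    ∀ᵐ x ∂(bdry K), f x = 0 := by
  have := hK.isFiniteMeasure_bdry
  have hm : MemLp (fun x => f x • outwardNormal K x) 2 (bdry K) := by
    refine hf.norm.mono' (hf.1.smul hK.aestronglyMeasurable_outwardNormal)
      (Eventually.of_forall fun x => ?_)
    rw [norm_smul]
    exact mul_le_of_le_one_right (norm_nonneg _) (norm_outwardNormal_le K x)
  have hi : Integrable (fun x => f x • outwardNormal K x) (bdry K) := hm.integrable one_le_two
  have key := ae_eq_zero_of_integral_contDiff_smul_eq_zero hi.locallyIntegrable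
    (fun ψ h1 h2 => by
      have i1 : Integrable (fun x => ψ x • f x • outwardNormal K x) (bdry K) :=
        memLp_one_iff_integrable.1 (MemLp.smul (p := 2) (q := 2) hm (hK.memLp_bdry h1.continuous 2))
      refine ext_inner_left ℝ fun e => ?_
      rw [inner_zero_right, ← integral_inner i1, ← h ψ h1 e]
      refine integral_congr_ae (Eventually.of_forall fun x => ?_)
      simp only [inner_smul_right, real_inner_comm e]
      ring)
  filter_upwards [key, hK.ae_isOutwardNormal] with x hx hn
  exact (smul_eq_zero.1 hx).resolve_right (ne_zero_of_norm_eq_one hn.1)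

/-- Green's formula expresses the boundary integrals of a trace through `w` and `G` alone. Hence the
choice made in the definition of `trace` matters only on null sets. -/
theorem IsPolytope.isTrace_unique (hK : IsPolytope K) (hd : 1 ≤ d) {w g g' : E d → ℝ}
    {G : E d → E d} (hG : MemLp G 2 (volume.restrict K))
    (h : IsWeakGrad (interior K) w G) (ht : IsTrace K w g) (ht' : IsTrace K w g') :
    g =ᵐ[bdry K] g' := by
  have hm : MemLp (fun x => g x - g' x) 2 (bdry K) := ht.2.1.sub ht'.2.1
  have := hK.ae_eq_zero_of_bdry_integral hm fun ψ hψ e => by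
    obtain ⟨c, hc⟩ := hK.lipschitzOn_smooth hψ
    have hb : ∀ {g : E d → ℝ}, MemLp g 2 (bdry K) →
        Integrable (fun x => g x * ψ x * inner ℝ (outwardNormal K x) e) (bdry K) := fun hg => by
      have := memLp_one_iff_integrable.1 (MemLp.smul (p := 2) (q := 2)
        (hK.memLp_mul_normal hg e) (hK.memLp_bdry hψ.continuous 2))
      refine this.congr (Eventually.of_forall fun x => ?_)
      simp only [Pi.smul_apply', smul_eq_mul]; ring
    simp only [sub_mul]
    rw [integral_sub (hb ht.2.1) (hb ht'.2.1), ← hK.green hd ht hG h hc e,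
      ← hK.green hd ht' hG h hc e, sub_self]
  filter_upwards [this] with x hx
  exact sub_eq_zero.1 hx

lemma tendsto_eLpNorm_sub_pairs {μ : Measure (E d)} {F : Type*} [NormedAddCommGroup F]
    {f : ℕ → E d → F} {f0 : E d → F} (hf : ∀ n, AEStronglyMeasurable (f n) μ)
    (hf0 : AEStronglyMeasurable f0 μ)
    (ht : Tendsto (fun n => eLpNorm (f n - f0) 2 μ) atTop (𝓝 0)) :
    Tendsto (fun n : ℕ × ℕ => eLpNorm (f n.1 - f n.2) 2 μ) atTop (𝓝 0) := by
  have h1 : Tendsto (fun n : ℕ × ℕ => eLpNorm (f n.1 - f0) 2 μ + eLpNorm (f n.2 - f0) 2 μ)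
      atTop (𝓝 0) := by
    rw [← prod_atTop_atTop_eq]
    simpa using (ht.comp tendsto_fst).add (ht.comp tendsto_snd)
  refine tendsto_of_tendsto_of_tendsto_of_le_of_le tendsto_const_nhds h1 (fun _ => zero_le)
    fun n => ?_
  have : f n.1 - f n.2 = (f n.1 - f0) - (f n.2 - f0) := by abel
  rw [this]
  exact eLpNorm_sub_le ((hf _).sub hf0) ((hf _).sub hf0) one_le_two

/-- If `C¹` functions converge in `H¹(K)`, then their boundary values converge in `L²(∂K)`. -/
lemma IsPolytope.exists_bdry_limit (hK : IsPolytope K) (hd : 1 ≤ d) {w : E d → ℝ} {G : E d → E d}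
    {φ : ℕ → E d → ℝ} (hw : MemLp w 2 (volume.restrict K)) (hG : MemLp G 2 (volume.restrict K))
    (hφ : ∀ n, ContDiff ℝ 1 (φ n))
    (t1 : Tendsto (fun n => eLpNorm (φ n - w) 2 (volume.restrict K)) atTop (𝓝 0))
    (t2 : Tendsto (fun n => eLpNorm (gradient (φ n) - G) 2 (volume.restrict K)) atTop (𝓝 0)) :
    ∃ g, MemLp g 2 (bdry K) ∧ Tendsto (fun n => eLpNorm (φ n - g) 2 (bdry K)) atTop (𝓝 0) := by
  obtain ⟨C, hC⟩ := hK.exists_trace_bound hd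
  have m1 : ∀ n, MemLp (φ n) 2 (volume.restrict K) := fun n => hK.memLp_volume (hφ n).continuous 2
  have m2 : ∀ n, MemLp (gradient (φ n)) 2 (volume.restrict K) := fun n =>
    hK.memLp_volume (continuous_gradient (hφ n)) 2
  have m3 : ∀ n, MemLp (φ n) 2 (bdry K) := fun n => hK.memLp_bdry (hφ n).continuous 2
  have hgsub : ∀ n m, gradient (φ n - φ m) = gradient (φ n) - gradient (φ m) := by
    intro n m
    ext1 x
    simp only [gradient, Pi.sub_apply]
    rw [fderiv_sub ((hφ n).differentiable one_ne_zero x) ((hφ m).differentiable one_ne_zero x),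
      map_sub]
  -- The trace inequality applied to differences turns convergence in `H¹(K)` into the Cauchy
  -- property in `L²` of the boundary.
  have hcauchy : CauchySeq fun n => (m3 n).toLp (φ n) := by
    rw [Lp.cauchySeq_Lp_iff_cauchySeq_eLpNorm]
    have h1 := (tendsto_eLpNorm_sub_pairs (fun n => (m1 n).1) hw.1 t1).add
      (tendsto_eLpNorm_sub_pairs (fun n => (m2 n).1) hG.1 t2)
    have h2 : Tendsto (fun n : ℕ × ℕ => (C : ℝ≥0∞) * (eLpNorm (φ n.1 - φ n.2) 2 (volume.restrict K)
        + eLpNorm (gradient (φ n.1) - gradient (φ n.2)) 2 (volume.restrict K))) atTop (𝓝 0) := by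
      have := ENNReal.Tendsto.const_mul (a := (C : ℝ≥0∞)) h1 (Or.inr ENNReal.coe_ne_top)
      simpa using this
    refine tendsto_of_tendsto_of_tendsto_of_le_of_le tendsto_const_nhds h2 (fun _ => zero_le)
      fun n => ?_
    have e : eLpNorm ((m3 n.1).toLp (φ n.1) - (m3 n.2).toLp (φ n.2) : E d → ℝ) 2 (bdry K)
        = eLpNorm (φ n.1 - φ n.2) 2 (bdry K) := by
      refine eLpNorm_congr_ae ?_
      filter_upwards [(m3 n.1).coeFn_toLp, (m3 n.2).coeFn_toLp] with x h1 h2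
      simp [h1, h2]
    refine (le_of_eq e).trans ?_
    rw [← hgsub]
    exact hC _ ((hφ n.1).sub (hφ n.2))
  obtain ⟨gL, hg⟩ := cauchySeq_tendsto_of_complete hcauchy
  let g : E d → ℝ := gL
  have t3 : Tendsto (fun n => eLpNorm (φ n - g) 2 (bdry K)) atTop (𝓝 0) := by
    rw [Lp.tendsto_Lp_iff_tendsto_eLpNorm'] at hg
    refine hg.congr fun n => eLpNorm_congr_ae ?_
    filter_upwards [(m3 n).coeFn_toLp] with x h1
    simp [g, h1]
  exact ⟨g, Lp.memLp gL, t3⟩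

/-- Existence of traces, with the trace inequality. -/
theorem IsPolytope.exists_isTrace (hK : IsPolytope K) (hd : 1 ≤ d) :
    ∃ C : NNReal, ∀ (w : E d → ℝ) (G : E d → E d), MemLp w 2 (volume.restrict K) →
      MemLp G 2 (volume.restrict K) → IsWeakGrad (interior K) w G →
      ∃ g, IsTrace K w g ∧ eLpNorm g 2 (bdry K) ≤ C * (eLpNorm w 2 (volume.restrict K)
        + eLpNorm G 2 (volume.restrict K)) := by
  obtain ⟨C, hC⟩ := hK.exists_trace_bound hd
  refine ⟨C, fun w G hw hG h => ?_⟩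
  obtain ⟨φ, hφ, t1, t2⟩ := hK.exists_smooth_approx hw hG h
  have m1 : ∀ n, MemLp (φ n) 2 (volume.restrict K) := fun n => hK.memLp_volume (hφ n).continuous 2
  have m2 : ∀ n, MemLp (gradient (φ n)) 2 (volume.restrict K) := fun n =>
    hK.memLp_volume (continuous_gradient (hφ n)) 2
  have m3 : ∀ n, MemLp (φ n) 2 (bdry K) := fun n => hK.memLp_bdry (hφ n).continuous 2
  obtain ⟨g, hg, t3⟩ := hK.exists_bdry_limit hd hw hG hφ t1 t2
  refine ⟨g, ⟨hw, hg, φ, G, hG, hφ, t1, t2, t3⟩, ?_⟩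
  -- The trace inequality is passed to the limit: triangle inequalities around the approximant `φ
  -- n`, whose error terms tend to zero.
  have hle : ∀ n, eLpNorm g 2 (bdry K) ≤ eLpNorm (φ n - g) 2 (bdry K)
      + C * ((eLpNorm (φ n - w) 2 (volume.restrict K) + eLpNorm w 2 (volume.restrict K))
        + (eLpNorm (gradient (φ n) - G) 2 (volume.restrict K)
          + eLpNorm G 2 (volume.restrict K))) := by
    intro n
    have tri : ∀ {F : Type} [NormedAddCommGroup F] {μ : Measure (E d)} {a b : E d → F},
        AEStronglyMeasurable a μ → AEStronglyMeasurable b μ →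
        eLpNorm a 2 μ ≤ eLpNorm (a - b) 2 μ + eLpNorm b 2 μ := by
      intro F _ μ a b ha hb
      have := eLpNorm_add_le (p := 2) (ha.sub hb) hb one_le_two
      rwa [sub_add_cancel] at this
    refine (tri hg.1 (m3 n).1).trans ?_
    rw [eLpNorm_sub_comm]
    refine add_le_add le_rfl ((hC _ (hφ n)).trans ?_)
    exact mul_le_mul_right (add_le_add (tri (m1 n).1 hw.1) (tri (m2 n).1 hG.1)) _
  have hlim : Tendsto (fun n => eLpNorm (φ n - g) 2 (bdry K)
      + C * ((eLpNorm (φ n - w) 2 (volume.restrict K) + eLpNorm w 2 (volume.restrict K))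
        + (eLpNorm (gradient (φ n) - G) 2 (volume.restrict K)
          + eLpNorm G 2 (volume.restrict K)))) atTop
      (𝓝 (0 + C * ((0 + eLpNorm w 2 (volume.restrict K))
        + (0 + eLpNorm G 2 (volume.restrict K))))) := by
    refine t3.add (ENNReal.Tendsto.const_mul ?_ (Or.inr ENNReal.coe_ne_top))
    exact (t1.add_const _).add (t2.add_const _)
  simp only [zero_add] at hlim
  exact ge_of_tendsto' hlim hle

end Trace

/-! ### Trace operators -/

section TraceOperator

variable {d : ℕ} {K Ω : Set (E d)}

lemma IsTrace.add {w w' g g' : E d → ℝ} (h : IsTrace K w g) (h' : IsTrace K w' g') :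
    IsTrace K (w + w') (g + g') := by
  obtain ⟨hw, hg, φ, G, hG, hφ, t1, t2, t3⟩ := h
  obtain ⟨hw', hg', φ', G', hG', hφ', t1', t2', t3'⟩ := h'
  have add : ∀ {F : Type} [NormedAddCommGroup F] {μ : Measure (E d)} {a a' : ℕ → E d → F}
      {b b' : E d → F}, (∀ n, AEStronglyMeasurable (a n) μ) → (∀ n, AEStronglyMeasurable (a' n) μ) →
      AEStronglyMeasurable b μ → AEStronglyMeasurable b' μ →
      Tendsto (fun n => eLpNorm (a n - b) 2 μ) atTop (𝓝 0) →
      Tendsto (fun n => eLpNorm (a' n - b') 2 μ) atTop (𝓝 0) →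
      Tendsto (fun n => eLpNorm ((a n + a' n) - (b + b')) 2 μ) atTop (𝓝 0) := by
    intro F _ μ a a' b b' ha ha' hb hb' s s'
    have h2 := s.add s'
    rw [add_zero] at h2
    refine tendsto_of_tendsto_of_tendsto_of_le_of_le tendsto_const_nhds h2 (fun _ => zero_le)
      fun n => ?_
    have : (a n + a' n) - (b + b') = (a n - b) + (a' n - b') := by abel
    rw [this]
    exact eLpNorm_add_le ((ha n).sub hb) ((ha' n).sub hb') one_le_two
  have hgrad : ∀ n, gradient (φ n + φ' n) = gradient (φ n) + gradient (φ' n) := by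
    intro n
    ext1 x
    simp only [gradient, Pi.add_apply]
    rw [fderiv_add ((hφ n).differentiable one_ne_zero x) ((hφ' n).differentiable one_ne_zero x),
      map_add]
  refine ⟨hw.add hw', hg.add hg', fun n => φ n + φ' n, G + G', hG.add hG',
    fun n => (hφ n).add (hφ' n), ?_, ?_, ?_⟩
  · exact add (fun n => (hφ n).continuous.aestronglyMeasurable)
      (fun n => (hφ' n).continuous.aestronglyMeasurable) hw.1 hw'.1 t1 t1'
  · simp only [hgrad]
    exact add (fun n => (continuous_gradient (hφ n)).aestronglyMeasurable)
      (fun n => (continuous_gradient (hφ' n)).aestronglyMeasurable) hG.1 hG'.1 t2 t2'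
  · exact add (fun n => (hφ n).continuous.aestronglyMeasurable)
      (fun n => (hφ' n).continuous.aestronglyMeasurable) hg.1 hg'.1 t3 t3'

lemma IsTrace.const_smul {w g : E d → ℝ} (c : ℝ) (h : IsTrace K w g) :
    IsTrace K (c • w) (c • g) := by
  obtain ⟨hw, hg, φ, G, hG, hφ, t1, t2, t3⟩ := h
  have sm : ∀ {F : Type} [NormedAddCommGroup F] [NormedSpace ℝ F] {μ : Measure (E d)}
      {a : ℕ → E d → F} {b : E d → F},
      Tendsto (fun n => eLpNorm (a n - b) 2 μ) atTop (𝓝 0) →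
      Tendsto (fun n => eLpNorm (c • a n - c • b) 2 μ) atTop (𝓝 0) := by
    intro F _ _ μ a b s
    have h2 : Tendsto (fun n => ‖c‖ₑ * eLpNorm (a n - b) 2 μ) atTop (𝓝 0) := by
      simpa using ENNReal.Tendsto.const_mul s (Or.inr (enorm_ne_top (x := c)))
    refine h2.congr fun n => ?_
    rw [← smul_sub, eLpNorm_const_smul]
  have hgrad : ∀ n, gradient (c • φ n) = c • gradient (φ n) := by
    intro n
    ext1 x
    simp only [gradient, Pi.smul_apply]
    rw [fderiv_const_smul ((hφ n).differentiable one_ne_zero x), map_smul]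
  refine ⟨hw.const_smul c, hg.const_smul c, fun n => c • φ n, c • G, hG.const_smul c,
    fun n => contDiff_const.smul (hφ n), sm t1, ?_, sm t3⟩
  simp only [hgrad]
  exact sm t2

lemma IsTrace.congr_ae {w w' g : E d → ℝ} (h : IsTrace K w g) (hw : w =ᵐ[volume.restrict K] w') :
    IsTrace K w' g := by
  obtain ⟨h1, hg, φ, G, hG, hφ, t1, t2, t3⟩ := h
  refine ⟨h1.ae_eq hw, hg, φ, G, hG, hφ, t1.congr fun n => eLpNorm_congr_ae ?_, t2, t3⟩
  filter_upwards [hw] with x hx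
  simp [hx]

lemma isTrace_trace {w g : E d → ℝ} (h : IsTrace K w g) : IsTrace K w (trace K w) := by
  have hex : ∃ g, IsTrace K w g := ⟨g, h⟩
  rw [trace, dif_pos hex]
  exact hex.choose_spec

/-- The equality holds everywhere, not only almost everywhere: both functions have the same set of
traces, so the choice returns the same representative. -/
lemma trace_congr {w w' : E d → ℝ} (hw : w =ᵐ[volume.restrict K] w') : trace K w = trace K w' := by
  have h : IsTrace K w = IsTrace K w' :=
    funext fun g => propext ⟨fun h => h.congr_ae hw, fun h => h.congr_ae hw.symm⟩
  unfold trace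
  rw [h]

/-- The functions of `L²(Ω)` with their weak gradients in `L²(Ω)`. -/
def H1 {d : ℕ} (Ω : Set (E d)) : Submodule ℝ (L2 Ω ℝ × L2 Ω (E d)) where
  carrier := {p | IsWeakGrad Ω p.1 p.2}
  add_mem' := fun h h' => IsWeakGrad.add h h'
  zero_mem' := IsWeakGrad.zero
  smul_mem' := fun c _ h => IsWeakGrad.smul c h

lemma IsCell.memLp (hK : IsCell Ω K) {F : Type} [NormedAddCommGroup F] (w : L2 Ω F) :
    MemLp w 2 (volume.restrict K) := (Lp.memLp w).mono_measure hK.restrict_le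

lemma IsCell.isTrace_trace (hK : IsCell Ω K) (p : H1 Ω) :
    IsTrace K p.1.1 (trace K p.1.1) := by
  obtain ⟨C, hC⟩ := hK.polytope.exists_isTrace hK.one_le
  obtain ⟨g, hg, -⟩ := hC p.1.1 p.1.2 (hK.memLp _) (hK.memLp _) (hK.isWeakGrad p.2)
  exact LRNNDG.isTrace_trace hg

lemma IsCell.isTrace_ae_eq (hK : IsCell Ω K) (p : H1 Ω) {g : E d → ℝ} (hg : IsTrace K p.1.1 g) :
    g =ᵐ[bdry K] trace K p.1.1 :=
  hK.polytope.isTrace_unique hK.one_le (hK.memLp _) (hK.isWeakGrad p.2) hg (hK.isTrace_trace p)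

lemma IsCell.exists_bound (hK : IsCell Ω K) : ∃ C : NNReal, ∀ p : H1 Ω,
    eLpNorm (trace K p.1.1) 2 (bdry K) ≤ C * ‖p‖ₑ := by
  obtain ⟨C, hC⟩ := hK.polytope.exists_isTrace hK.one_le
  refine ⟨C * 2, fun p => ?_⟩
  obtain ⟨g, hg, hb⟩ := hC p.1.1 p.1.2 (hK.memLp _) (hK.memLp _) (hK.isWeakGrad p.2)
  rw [← eLpNorm_congr_ae (hK.isTrace_ae_eq p hg)]
  refine hb.trans ?_
  rw [ENNReal.coe_mul, mul_assoc]
  refine mul_le_mul_right ?_ _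
  have hnorm : ∀ {F : Type} [NormedAddCommGroup F] (w : L2 Ω F),
      eLpNorm w 2 (volume.restrict K) ≤ ‖w‖ₑ := fun w => by
    rw [Lp.enorm_def]; exact eLpNorm_mono_measure _ hK.restrict_le
  have h1 : ‖p.1.1‖ₑ ≤ ‖p‖ₑ := by
    rw [enorm_le_iff_norm_le]; exact norm_fst_le p.1
  have h2 : ‖p.1.2‖ₑ ≤ ‖p‖ₑ := by
    rw [enorm_le_iff_norm_le]; exact norm_snd_le p.1
  calc _ ≤ ‖p‖ₑ + ‖p‖ₑ := add_le_add ((hnorm _).trans h1) ((hnorm _).trans h2)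
    _ = _ := by rw [ENNReal.coe_ofNat, two_mul]

/-- The trace operator from `H¹(Ω)` to `L²(∂K)`. -/
def traceL (hK : IsCell Ω K) : H1 Ω →L[ℝ] Lp ℝ 2 (bdry K) :=
  LinearMap.mkContinuousOfExistsBound
    { toFun := fun p => (hK.isTrace_trace p).2.1.toLp (trace K p.1.1)
      -- Linearity follows from uniqueness: the sum of the chosen traces is a trace of the sum,
      -- hence equal almost everywhere to the chosen one.
      map_add' := fun p q => by
        rw [← MemLp.toLp_add]
        refine MemLp.toLp_congr _ _ ?_
        have h := (hK.isTrace_trace p).add (hK.isTrace_trace q)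
        have hae : (p.1.1 + q.1.1 : E d → ℝ) =ᵐ[volume.restrict K] (p + q).1.1 :=
          (Measure.absolutelyContinuous_of_le hK.restrict_le).ae_eq (Lp.coeFn_add p.1.1 q.1.1).symm
        exact (hK.isTrace_ae_eq (p + q) (h.congr_ae hae)).symm
      map_smul' := fun c p => by
        rw [RingHom.id_apply, ← MemLp.toLp_const_smul]
        refine MemLp.toLp_congr _ _ ?_
        have h := (hK.isTrace_trace p).const_smul c
        have hae : (c • p.1.1 : E d → ℝ) =ᵐ[volume.restrict K] (c • p).1.1 :=
          (Measure.absolutelyContinuous_of_le hK.restrict_le).ae_eq (Lp.coeFn_smul c p.1.1).symm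
        exact (hK.isTrace_ae_eq (c • p) (h.congr_ae hae)).symm }
    (by
      obtain ⟨C, hC⟩ := hK.exists_bound
      refine ⟨C, fun p => ?_⟩
      have h := hC p
      simp only [LinearMap.coe_mk, AddHom.coe_mk, Lp.norm_toLp]
      refine ENNReal.toReal_le_of_le_ofReal (by positivity) (h.trans (le_of_eq ?_))
      rw [ENNReal.ofReal_mul (NNReal.coe_nonneg C), ofReal_norm, ENNReal.ofReal_coe_nnreal])

lemma coeFn_traceL (hK : IsCell Ω K) (p : H1 Ω) : traceL hK p =ᵐ[bdry K] trace K p.1.1 :=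
  (hK.isTrace_trace p).2.1.coeFn_toLp

/-- An `H²` function as an `H¹` function. -/
def H2.toH1 : H2 Ω →L[ℝ] H1 Ω :=
  (((ContinuousLinearMap.fst ℝ (L2 Ω ℝ) (L2 Ω (E d) × (Fin d → L2 Ω (E d)))).prod
    ((ContinuousLinearMap.fst ℝ _ _).comp (ContinuousLinearMap.snd ℝ _ _))).comp
      (H2 Ω).subtypeL).codRestrict (H1 Ω) fun w => w.2.1

/-- A partial derivative of an `H²` function as an `H¹` function. -/
def H2.gradH1 (k : Fin d) : H2 Ω →L[ℝ] H1 Ω :=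
  ((((EuclideanSpace.proj (𝕜 := ℝ) k).compLpL 2 (volume.restrict Ω)).comp
      ((ContinuousLinearMap.fst ℝ (L2 Ω (E d)) (Fin d → L2 Ω (E d))).comp
        (ContinuousLinearMap.snd ℝ (L2 Ω ℝ) _))).prod
    (((ContinuousLinearMap.proj k).comp (ContinuousLinearMap.snd ℝ (L2 Ω (E d)) _)).comp
        (ContinuousLinearMap.snd ℝ (L2 Ω ℝ) _))).comp
      (H2 Ω).subtypeL |>.codRestrict (H1 Ω) fun w => by
    refine IsWeakGrad.congr_ae (w.2.2 k) ?_ (by rfl)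
    exact Filter.EventuallyEq.symm
      (ContinuousLinearMap.coeFn_compLp (EuclideanSpace.proj (𝕜 := ℝ) k) w.1.2.1)

lemma H2.toH1_fst (w : H2 Ω) : (H2.toH1 w).1.1 = H2.toL2 w := rfl
lemma H2.gradH1_fst (k : Fin d) (w : H2 Ω) :
    (H2.gradH1 k w).1.1 =ᵐ[volume.restrict Ω] fun x => H2.grad w x k :=
  ContinuousLinearMap.coeFn_compLp (EuclideanSpace.proj (𝕜 := ℝ) k) w.1.2.1
lemma H2.gradH1_snd (k : Fin d) (w : H2 Ω) : (H2.gradH1 k w).1.2 = H2.hess w k := rfl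

/-- The trace of a smooth function. -/
lemma IsPolytope.isTrace_of_contDiff (hK : IsPolytope K) {φ : E d → ℝ} (hφ : ContDiff ℝ 1 φ) :
    IsTrace K φ φ :=
  ⟨hK.memLp_volume hφ.continuous 2, hK.memLp_bdry hφ.continuous 2, fun _ => φ, gradient φ,
    hK.memLp_volume (continuous_gradient hφ) 2, fun _ => hφ, by simp, by simp, by simp⟩

lemma isWeakGrad_of_contDiff (hK : IsPolytope K) (hd : 1 ≤ d) {φ : E d → ℝ}
    (hφ : ContDiff ℝ 1 φ) : IsWeakGrad (interior K) φ (gradient φ) := by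
  intro η h1 h2 h3
  have hη2 : MemLp η 2 (volume.restrict K) := hK.memLp_volume h1.continuous 2
  have hφ2 : MemLp φ 2 (volume.restrict K) := hK.memLp_volume hφ.continuous 2
  have i1 : Integrable (fun x => η x • gradient φ x) (volume.restrict K) :=
    memLp_one_iff_integrable.1 (MemLp.smul (p := 2) (q := 2)
      (hK.memLp_volume (continuous_gradient hφ) 2) hη2)
  have i2 : Integrable (fun x => φ x • gradient η x) (volume.restrict K) :=
    memLp_one_iff_integrable.1 (MemLp.smul (p := 2) (q := 2)
      (hK.memLp_volume (gradient_continuous h1) 2) hφ2)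
  obtain ⟨c, hc⟩ := hK.lipschitzOn_smooth h1
  rw [hK.restrict_interior, eq_neg_iff_add_eq_zero]
  refine ext_inner_left ℝ fun e => ?_
  rw [inner_zero_right, inner_add_right, ← integral_inner i2, ← integral_inner i1,
    ← integral_add (i2.const_inner e) (i1.const_inner e)]
  have hg0 : ∫ x, φ x * η x * inner ℝ (outwardNormal K x) e ∂(bdry K) = 0 := by
    refine integral_eq_zero_of_ae ?_
    filter_upwards [ae_restrict_mem isClosed_frontier.measurableSet] with x hx
    have : η x = 0 := image_eq_zero_of_notMem_tsupport fun h => hx.2 (h3 h)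
    simp [this]
  rw [← hg0, ← hK.integral_mul_fderiv hd hφ hc e]
  refine integral_congr_ae (Eventually.of_forall fun x => ?_)
  simp only [inner_smul_right, fderiv_eq_inner_gradient, real_inner_comm e]
  ring

lemma IsPolytope.trace_of_contDiff (hK : IsPolytope K) (hd : 1 ≤ d) {φ : E d → ℝ}
    (hφ : ContDiff ℝ 1 φ) : trace K φ =ᵐ[bdry K] φ :=
  hK.isTrace_unique hd (hK.memLp_volume (continuous_gradient hφ) 2)
    (isWeakGrad_of_contDiff hK hd hφ) (isTrace_trace (hK.isTrace_of_contDiff hφ))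
    (hK.isTrace_of_contDiff hφ)

end TraceOperator

/-! ### Geometry of the mesh -/

section Geometry

variable {d Nt Ns : ℕ} {K K' Ω : Set (E d)} {x ν ν' : E d}

lemma IsOutwardNormal.eventually_iff (h : IsOutwardNormal K x ν) (hK : IsClosed K) :
    ∀ᶠ y in 𝓝 x, (y ∈ K ↔ inner ℝ ν (y - x) ≤ 0) := by
  simpa only [hK.closure_eq] using h.2

lemma IsOutwardNormal.eventually_mem_interior (h : IsOutwardNormal K x ν) (hK : IsClosed K) :
    ∀ᶠ y in 𝓝 x, inner ℝ ν (y - x) < 0 → y ∈ interior K := by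
  filter_upwards [(h.eventually_iff hK).eventually_nhds] with y hy hlt
  rw [mem_interior_iff_mem_nhds]
  have : ∀ᶠ z in 𝓝 y, inner ℝ ν (z - x) < 0 :=
    (continuous_const.inner (continuous_id.sub continuous_const)).continuousAt.eventually_lt
      continuousAt_const hlt
  filter_upwards [hy, this] with z h1 h2
  exact h1.2 h2.le

/-- At a common flat boundary point of two sets with disjoint interiors the normals are opposite. -/
lemma IsOutwardNormal.eq_neg (h : IsOutwardNormal K x ν) (h' : IsOutwardNormal K' x ν')
    (hK : IsClosed K) (hK' : IsClosed K') (hdis : Disjoint (interior K) (interior K')) :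
    ν' = -ν := by
  have key : ∀ w : E d, inner ℝ ν w < 0 → 0 ≤ inner ℝ ν' w := by
    intro w hw
    by_contra! hlt
    obtain ⟨t, t0, t1, h1, h2⟩ := exists_small_smul
      ((h.eventually_mem_interior hK).and (h'.eventually_mem_interior hK')) w
    rw [add_sub_cancel_left, inner_smul_right] at h1 h2
    exact disjoint_left.1 hdis (h1 (mul_neg_of_pos_of_neg t0 hw))
      (h2 (mul_neg_of_pos_of_neg t0 hlt))
  refine (neg_eq_iff_eq_neg.1 (eq_of_inner_nonpos_imp h.1 (by rw [norm_neg]; exact h'.1)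
    fun w hw => ?_).symm)
  rw [inner_neg_left, neg_nonpos]
  -- `key` concerns only strictly inward directions. Tilting `w` by `-s • ν` makes it strictly
  -- inward, and `s` tends to zero.
  have hlim : Tendsto (fun s : ℝ => inner ℝ ν' (w - s • ν)) (𝓝[>] 0) (𝓝 (inner ℝ ν' w)) := by
    have : Continuous fun s : ℝ => inner ℝ ν' (w - s • ν) := by fun_prop
    simpa using (this.tendsto 0).mono_left nhdsWithin_le_nhds
  refine ge_of_tendsto hlim ?_
  filter_upwards [self_mem_nhdsWithin] with s hs
  refine key _ ?_
  rw [inner_sub_right, inner_smul_right, real_inner_self_eq_norm_sq, h.1]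
  have : (0:ℝ) < s := hs
  linarith

lemma Problem.isOpen_Ω (P : Problem d) : IsOpen P.Ω := by
  rw [← P.Ω_regular]; exact isOpen_interior

namespace Mesh

variable {P : Problem d} (𝓜 : Mesh P Nt Ns)

lemma isPolytope (j : Fin Ns) : IsPolytope (𝓜.elem j) := ⟨𝓜.polytope j, 𝓜.interior_nonempty j⟩

lemma isClosed_elem (j : Fin Ns) : IsClosed (𝓜.elem j) := (𝓜.isPolytope j).isClosed

lemma elem_subset (j : Fin Ns) : 𝓜.elem j ⊆ closure P.Ω := by
  rw [𝓜.cover]; exact subset_iUnion _ j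

lemma interior_subset (j : Fin Ns) : interior (𝓜.elem j) ⊆ P.Ω := by
  rw [← P.Ω_regular]; exact interior_mono (𝓜.elem_subset j)

lemma isCell (hd : 1 ≤ d) (j : Fin Ns) : IsCell P.Ω (𝓜.elem j) :=
  ⟨𝓜.isPolytope j, P.isOpen_Ω, 𝓜.interior_subset j, hd⟩

lemma isCompact_closure (𝓜 : Mesh P Nt Ns) : IsCompact (closure P.Ω) := by
  rw [𝓜.cover]; exact isCompact_iUnion fun j => (𝓜.isPolytope j).isCompact

variable {𝓜} in
lemma mem_frontier_of_mem_inter {j k : Fin Ns} (hjk : j ≠ k) (hj : x ∈ 𝓜.elem j)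
    (hk : x ∈ 𝓜.elem k) : x ∈ frontier (𝓜.elem j) := by
  rw [(𝓜.isClosed_elem j).frontier_eq]
  refine ⟨hj, fun hi => ?_⟩
  have hcl : closure (interior (𝓜.elem k)) = closure (𝓜.elem k) :=
    (𝓜.isPolytope k).convex.closure_interior_eq_closure_of_nonempty_interior
      (𝓜.interior_nonempty k)
  have hx : x ∈ closure (interior (𝓜.elem k)) := hcl ▸ subset_closure hk
  obtain ⟨y, hy1, hy2⟩ := mem_closure_iff.1 hx _ isOpen_interior hi
  exact disjoint_left.1 (𝓜.disjoint_interior j k hjk) hy1 hy2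

lemma ae_restrict_frontier_isOutwardNormal : ∀ᵐ x ∂(surf d), ∀ k, x ∈ frontier (𝓜.elem k) →
    IsOutwardNormal (𝓜.elem k) x (outwardNormal (𝓜.elem k) x) :=
  ae_all_iff.2 fun k => (ae_restrict_iff' isClosed_frontier.measurableSet).1
    (𝓜.isPolytope k).ae_isOutwardNormal

/-- Discarding a null set, every element is flat at each of its boundary points. Two elements
meeting at such a point occupy complementary half-spaces, so the point is interior to `Ω` and no
third element fits. If no other element is present, `Ω` looks like the element itself and shares its
normal. -/
lemma surf_ae_structure : ∀ᵐ x ∂(surf d), ∀ j, x ∈ frontier (𝓜.elem j) →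
    IsOutwardNormal (𝓜.elem j) x (outwardNormal (𝓜.elem j) x) ∧
    (∀ k, k ≠ j → x ∈ 𝓜.elem k →
      outwardNormal (𝓜.elem k) x = -outwardNormal (𝓜.elem j) x ∧ x ∈ P.Ω ∧
        ∀ l, l ≠ j → x ∈ 𝓜.elem l → l = k) ∧
    (x ∈ P.Ω → ∃ k, k ≠ j ∧ x ∈ 𝓜.elem k) ∧
    (x ∉ P.Ω → outwardNormal P.Ω x = outwardNormal (𝓜.elem j) x) := by
  filter_upwards [𝓜.ae_restrict_frontier_isOutwardNormal] with x hx j hj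
  have hj' : x ∈ 𝓜.elem j := (𝓜.isClosed_elem j).frontier_subset hj
  have hopp : ∀ k, k ≠ j → x ∈ 𝓜.elem k →
      outwardNormal (𝓜.elem k) x = -outwardNormal (𝓜.elem j) x := fun k hk hxk =>
    (hx j hj).eq_neg (hx k (mem_frontier_of_mem_inter hk hxk hj')) (𝓜.isClosed_elem j)
      (𝓜.isClosed_elem k) (𝓜.disjoint_interior j k hk.symm)
  -- The two half-balls fill a neighbourhood inside `closure P.Ω`; `Ω_regular` turns an interior
  -- point of the closure into a point of `Ω`.
  have hΩ : ∀ k, k ≠ j → x ∈ 𝓜.elem k → x ∈ P.Ω := by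
    intro k hk hxk
    rw [← P.Ω_regular, mem_interior_iff_mem_nhds]
    filter_upwards [(hx j hj).eventually_iff (𝓜.isClosed_elem j),
      (hx k (mem_frontier_of_mem_inter hk hxk hj')).eventually_iff (𝓜.isClosed_elem k)]
      with y h1 h2
    rw [hopp k hk hxk, inner_neg_left, neg_nonpos] at h2
    rcases le_total (inner ℝ (outwardNormal (𝓜.elem j) x) (y - x)) 0 with h | h
    · exact 𝓜.elem_subset j (h1.2 h)
    · exact 𝓜.elem_subset k (h2.2 h)
  -- The other elements are finitely many closed sets, so they stay away from a whole neighbourhood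
  -- of `x`.
  have hnear : (∀ k, k ≠ j → x ∉ 𝓜.elem k) →
      ∀ᶠ y in 𝓝 x, (y ∈ closure (𝓜.elem j) ↔ y ∈ closure P.Ω) := by
    intro hno
    have : ∀ᶠ y in 𝓝 x, ∀ k, k ≠ j → y ∉ 𝓜.elem k := by
      rw [eventually_all]
      intro k
      by_cases hk : k = j
      · simp [hk]
      · filter_upwards [(𝓜.isClosed_elem k).isOpen_compl.mem_nhds (hno k hk)] with y hy _
        exact hy
    filter_upwards [this] with y hy
    rw [(𝓜.isClosed_elem j).closure_eq]
    refine ⟨fun h => 𝓜.elem_subset j h, fun h => ?_⟩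
    rw [𝓜.cover, mem_iUnion] at h
    obtain ⟨k, hk⟩ := h
    by_contra hjy
    exact hy k (fun e => hjy (e ▸ hk)) hk
  refine ⟨hx j hj, fun k hk hxk => ⟨hopp k hk hxk, hΩ k hk hxk, fun l hl hxl => ?_⟩, ?_, ?_⟩
  -- With a third element the three normals would be pairwise opposite, which forces the normal of
  -- element `j` to vanish.
  · by_contra hlk
    have h1 := (hx k (mem_frontier_of_mem_inter hk hxk hj')).eq_neg
      (hx l (mem_frontier_of_mem_inter hl hxl hj')) (𝓜.isClosed_elem k) (𝓜.isClosed_elem l)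
      (𝓜.disjoint_interior k l (Ne.symm hlk))
    rw [hopp k hk hxk, hopp l hl hxl, neg_neg] at h1
    have h2 : outwardNormal (𝓜.elem j) x = 0 := by
      have h3 : (2 : ℝ) • outwardNormal (𝓜.elem j) x = 0 := by
        rw [two_smul]; nth_rewrite 1 [← h1]; exact neg_add_cancel _
      exact (smul_eq_zero.1 h3).resolve_left two_ne_zero
    exact ne_zero_of_norm_eq_one (hx j hj).1 h2
  · intro hxΩ
    by_contra! hno
    have hn := hnear hno
    refine hj.2 (mem_interior_iff_mem_nhds.2 ?_)
    filter_upwards [hn, P.isOpen_Ω.mem_nhds hxΩ] with y h1 h2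
    exact (𝓜.isClosed_elem j).closure_eq ▸ h1.2 (subset_closure h2)
  · intro hxΩ
    have hn := hnear fun k hk hxk => hxΩ (hΩ k hk hxk)
    exact ((hx j hj).congr hn).outwardNormal_eq

/-- Decomposition of the boundary integral over an element into boundary and interior faces. -/
lemma integral_bdry (j : Fin Ns) {g : E d → ℝ} (hg : Integrable g (bdry (𝓜.elem j))) :
    ∫ x, g x ∂(bdry (𝓜.elem j)) = ∫ x in frontier (𝓜.elem j) ∩ frontier P.Ω, g x ∂(surf d)
      + ∑ k ∈ Finset.univ.erase j, ∫ x in 𝓜.elem j ∩ 𝓜.elem k, g x ∂(surf d) := by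
  have hm := fun k => (𝓜.isClosed_elem k).measurableSet
  have hmf : MeasurableSet (frontier P.Ω) := isClosed_frontier.measurableSet
  have hmj : MeasurableSet (frontier (𝓜.elem j)) := isClosed_frontier.measurableSet
  -- Almost everywhere exactly one indicator is active: either the point lies on the boundary of
  -- `Ω`, or exactly one other element contains it.
  have hae : g =ᵐ[bdry (𝓜.elem j)] fun x => (frontier P.Ω).indicator g x
      + ∑ k ∈ Finset.univ.erase j, (𝓜.elem k).indicator g x := by
    filter_upwards [ae_restrict_of_ae 𝓜.surf_ae_structure, ae_restrict_mem hmj] with x hx hxj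
    obtain ⟨-, h1, h2, -⟩ := hx j hxj
    have hcl : x ∈ closure P.Ω := 𝓜.elem_subset j ((𝓜.isClosed_elem j).frontier_subset hxj)
    by_cases hxΩ : x ∈ P.Ω
    · obtain ⟨k, hk, hxk⟩ := h2 hxΩ
      have hf : x ∉ frontier P.Ω := fun h => h.2 (by rwa [P.isOpen_Ω.interior_eq])
      rw [indicator_of_notMem hf, zero_add, Finset.sum_eq_single_of_mem k (by simp [hk]),
        indicator_of_mem hxk]
      intro l hl hlk
      exact indicator_of_notMem (fun hxl => hlk ((h1 k hk hxk).2.2 l (by simpa using hl) hxl)) _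
    · have hf : x ∈ frontier P.Ω := ⟨hcl, by rwa [P.isOpen_Ω.interior_eq]⟩
      rw [indicator_of_mem hf, Finset.sum_eq_zero, add_zero]
      intro k hk
      exact indicator_of_notMem (fun hxk => hxΩ (h1 k (by simpa using hk) hxk).2.1) _
  rw [integral_congr_ae hae, integral_add (hg.indicator hmf)
    (integrable_finsetSum _ fun k _ => hg.indicator (hm k)),
    integral_finsetSum _ fun k _ => hg.indicator (hm k), integral_indicator hmf]
  rw [Measure.restrict_restrict hmf, inter_comm]
  congr 1
  refine Finset.sum_congr rfl fun k hk => ?_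
  rw [integral_indicator (hm k), Measure.restrict_restrict (hm k)]
  have : 𝓜.elem k ∩ frontier (𝓜.elem j) = 𝓜.elem j ∩ 𝓜.elem k := by
    ext y
    refine ⟨fun h => ⟨(𝓜.isClosed_elem j).frontier_subset h.2, h.1⟩, fun h => ⟨h.2, ?_⟩⟩
    exact mem_frontier_of_mem_inter (Finset.ne_of_mem_erase hk).symm h.1 h.2
  rw [this]

/-- Decomposition of an integral over boundary faces into the parts of the boundary. -/
lemma integral_boundary_parts (j : Fin Ns) {g : E d → ℝ} (hg : Integrable g (bdry (𝓜.elem j))) :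
    ∫ x in frontier (𝓜.elem j) ∩ frontier P.Ω, g x ∂(surf d)
      = ∫ x in frontier (𝓜.elem j) ∩ P.ΓD, g x ∂(surf d)
        + ∫ x in frontier (𝓜.elem j) ∩ P.ΓN, g x ∂(surf d)
        + ∫ x in frontier (𝓜.elem j) ∩ P.ΓR, g x ∂(surf d) := by
  have hmj : MeasurableSet (frontier (𝓜.elem j)) := isClosed_frontier.measurableSet
  have hset : (frontier (𝓜.elem j) ∩ frontier P.Ω : Set (E d)) =ᵐ[surf d]
      ((frontier (𝓜.elem j) ∩ P.ΓD) ∪ (frontier (𝓜.elem j) ∩ P.ΓN) ∪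
        (frontier (𝓜.elem j) ∩ P.ΓR) : Set (E d)) := by
    rw [← inter_union_distrib_left, ← inter_union_distrib_left]
    refine (ae_eq_refl _).inter (Filter.EventuallyLE.antisymm (ae_le_set.2 P.cover) ?_)
    exact (union_subset (union_subset P.ΓD_subset P.ΓN_subset) P.ΓR_subset).eventuallyLE
  have hi : ∀ Γ : Set (E d), IntegrableOn g (frontier (𝓜.elem j) ∩ Γ) (surf d) :=
    fun Γ => IntegrableOn.mono_set hg inter_subset_left
  rw [setIntegral_congr_set hset, setIntegral_union _ (hmj.inter P.measurableSet_ΓR)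
    ((hi _).union (hi _)) (hi _), setIntegral_union _ (hmj.inter P.measurableSet_ΓN) (hi _) (hi _)]
  · exact P.disjoint_DN.mono inter_subset_right inter_subset_right
  · exact (P.disjoint_DR.mono inter_subset_right inter_subset_right).union_left
      (P.disjoint_NR.mono inter_subset_right inter_subset_right)

lemma restrict_Ω : (volume : Measure (E d)).restrict P.Ω
    = Measure.sum fun j => volume.restrict (𝓜.elem j) := by
  have hfr : volume (⋃ j, frontier (𝓜.elem j)) = 0 :=
    measure_iUnion_null fun j => (𝓜.isPolytope j).convex.addHaar_frontier volume
  have hset : (P.Ω : Set (E d)) =ᵐ[volume] (⋃ j, 𝓜.elem j : Set (E d)) := by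
    refine Filter.EventuallyLE.antisymm ?_ (ae_le_set.2 (measure_mono_null ?_ hfr))
    · rw [← 𝓜.cover]; exact subset_closure.eventuallyLE
    · rintro x ⟨hx, hxΩ⟩
      obtain ⟨j, hj⟩ := mem_iUnion.1 hx
      exact mem_iUnion.2 ⟨j, subset_closure hj, fun hi => hxΩ (𝓜.interior_subset j hi)⟩
  rw [Measure.restrict_congr_set hset, Measure.restrict_iUnion_ae ?_
    fun j => (𝓜.isClosed_elem j).measurableSet.nullMeasurableSet]
  intro j k hjk
  exact measure_mono_null (fun x hx => mem_iUnion.2 ⟨j, mem_frontier_of_mem_inter hjk hx.1 hx.2⟩) hfr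

lemma integral_Ω {F : Type*} [NormedAddCommGroup F] [NormedSpace ℝ F] {g : E d → F}
    (hg : Integrable g (volume.restrict P.Ω)) :
    ∫ x in P.Ω, g x = ∑ j, ∫ x in 𝓜.elem j, g x := by
  rw [𝓜.restrict_Ω] at hg ⊢
  rw [integral_sum_measure hg, tsum_fintype]

end Mesh

end Geometry

/-! ### Matching of traces across faces -/

section Matching

variable {d Nt Ns : ℕ} {P : Problem d} (𝓜 : Mesh P Nt Ns)

/-- The trace on `∂Ω` agrees with the trace on `∂K` where the two boundaries overlap. -/
lemma IsCell.trace_ae_eq_of_isTrace {Ω K : Set (E d)} (hK : IsCell Ω K) (p : H1 Ω) {g : E d → ℝ}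
    (hg : IsTrace Ω p.1.1 g) :
    ∀ᵐ x ∂((surf d).restrict (frontier K ∩ frontier Ω)), trace K p.1.1 x = g x := by
  obtain ⟨hw, hg2, φ, G, hG, hφ, t1, t2, t3⟩ := hg
  have mono : ∀ {F : Type} [NormedAddCommGroup F] {a : ℕ → E d → F} {μ ν : Measure (E d)}, μ ≤ ν →
      Tendsto (fun n => eLpNorm (a n) 2 ν) atTop (𝓝 0) →
      Tendsto (fun n => eLpNorm (a n) 2 μ) atTop (𝓝 0) := fun h ht =>
    tendsto_of_tendsto_of_tendsto_of_le_of_le tendsto_const_nhds ht (fun _ => zero_le)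
      fun n => eLpNorm_mono_measure _ h
  have s1 := mono hK.restrict_le t1
  have s2 := mono hK.restrict_le t2
  -- One approximating sequence serves both `Ω` and `K`. Its boundary values converge to `g` on one
  -- boundary and to `g'` on the other, so the two limits agree on the overlap.
  obtain ⟨g', hg', s3⟩ := hK.polytope.exists_bdry_limit hK.one_le (hw.mono_measure hK.restrict_le)
    (hG.mono_measure hK.restrict_le) hφ s1 s2
  have htr : IsTrace K p.1.1 g' := ⟨hw.mono_measure hK.restrict_le, hg', φ, G,
    hG.mono_measure hK.restrict_le, hφ, s1, s2, s3⟩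
  have h1 := ae_mono (Measure.restrict_mono (μ := surf d) (ν := surf d)
    (inter_subset_left (s := frontier K) (t := frontier Ω)) le_rfl) (hK.isTrace_ae_eq p htr)
  have le1 : (surf d).restrict (frontier K ∩ frontier Ω) ≤ bdry K :=
    Measure.restrict_mono inter_subset_left le_rfl
  have le2 : (surf d).restrict (frontier K ∩ frontier Ω) ≤ bdry Ω :=
    Measure.restrict_mono inter_subset_right le_rfl
  set μ := (surf d).restrict (frontier K ∩ frontier Ω)
  have r1 := mono le1 s3
  have r2 := mono le2 t3
  have hgm := (hg2.mono_measure le2).1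
  have hgm' := (hg'.mono_measure le1).1
  have hzero : eLpNorm (g' - g) 2 μ = 0 := by
    have h3 := r2.add r1
    rw [add_zero] at h3
    refine le_antisymm (ge_of_tendsto' h3 fun n => ?_) zero_le
    have : g' - g = (φ n - g) - (φ n - g') := by abel
    rw [this]
    exact eLpNorm_sub_le ((hφ n).continuous.aestronglyMeasurable.sub hgm)
      ((hφ n).continuous.aestronglyMeasurable.sub hgm') one_le_two
  rw [eLpNorm_eq_zero_iff (hgm'.sub hgm) two_ne_zero] at hzero
  filter_upwards [h1, hzero] with x a b
  rw [← a]
  exact sub_eq_zero.1 b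

lemma isWeakGrad_inner {Ω : Set (E d)} (p : H1 Ω) {φ : E d → ℝ} (h1 : ContDiff ℝ ∞ φ)
    (h2 : HasCompactSupport φ) (h3 : tsupport φ ⊆ Ω) (e : E d) :
    Integrable (fun x => inner ℝ (p.1.2 x) e * φ x + p.1.1 x * fderiv ℝ φ x e)
      (volume.restrict Ω) ∧
    ∫ x in Ω, (inner ℝ (p.1.2 x) e * φ x + p.1.1 x * fderiv ℝ φ x e) = 0 := by
  have i1 := integrable_smul_field h1 h2 p.1.2
  have i2 := integrable_smul_gradient h1 h2 p.1.1
  have e1 : (fun x => inner ℝ (p.1.2 x) e * φ x + p.1.1 x * fderiv ℝ φ x e)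
      = fun x => inner ℝ e (φ x • p.1.2 x) + inner ℝ e (p.1.1 x • gradient φ x) := by
    funext x
    simp only [inner_smul_right, fderiv_eq_inner_gradient, real_inner_comm e]
    ring
  rw [e1]
  refine ⟨(i1.const_inner e).add (i2.const_inner e), ?_⟩
  rw [integral_add (i1.const_inner e) (i2.const_inner e), integral_inner i1, integral_inner i2,
    ← inner_add_right, p.2 φ h1 h2 h3, add_neg_cancel, inner_zero_right]

lemma IsPolytope.integrable_trace_mul {K : Set (E d)} (hK : IsPolytope K) {g ψ : E d → ℝ}
    (hg : MemLp g 2 (bdry K)) (hψ : Continuous ψ) (e : E d) :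
    Integrable (fun x => g x * ψ x * inner ℝ (outwardNormal K x) e) (bdry K) := by
  have := memLp_one_iff_integrable.1 (MemLp.smul (p := 2) (q := 2)
    (hK.memLp_mul_normal hg e) (hK.memLp_bdry hψ 2))
  refine this.congr (Eventually.of_forall fun x => ?_)
  simp only [Pi.smul_apply', smul_eq_mul]; ring

/-- The traces of an `H¹(Ω)` function from the two sides of an interior face agree. -/
lemma Mesh.trace_ae_eq (hd : 1 ≤ d) (p : H1 P.Ω) {j k : Fin Ns} (hjk : j ≠ k) :
    ∀ᵐ x ∂((surf d).restrict (𝓜.elem j ∩ 𝓜.elem k)),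
      trace (𝓜.elem j) p.1.1 x = trace (𝓜.elem k) p.1.1 x := by
  have hsub : ∀ {a b : Fin Ns}, a ≠ b → 𝓜.elem a ∩ 𝓜.elem b ⊆ frontier (𝓜.elem a) := fun h x hx =>
    mem_frontier_of_mem_inter h hx.1 hx.2
  have hmF : MeasurableSet (𝓜.elem j ∩ 𝓜.elem k) :=
    (𝓜.isClosed_elem j).measurableSet.inter (𝓜.isClosed_elem k).measurableSet
  have htr := fun l => ((𝓜.isCell hd l).isTrace_trace p)
  let tr : Fin Ns → E d → ℝ := fun l => trace (𝓜.elem l) p.1.1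
  let n : Fin Ns → E d → E d := fun l => outwardNormal (𝓜.elem l)
  -- All other elements are removed, so a test function supported in `U` sees only elements `j` and
  -- `k`. Almost every point of their common face still lies in `U`.
  let U : Set (E d) := P.Ω \ ⋃ l ∈ {l | l ≠ j ∧ l ≠ k}, 𝓜.elem l
  have hU : IsOpen U := P.isOpen_Ω.sdiff
    ((Set.toFinite _).isClosed_biUnion fun l _ => 𝓜.isClosed_elem l)
  have hleJ : (surf d).restrict (𝓜.elem j ∩ 𝓜.elem k) ≤ bdry (𝓜.elem j) :=
    Measure.restrict_mono (hsub hjk) le_rfl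
  have hleK : (surf d).restrict (𝓜.elem j ∩ 𝓜.elem k) ≤ bdry (𝓜.elem k) :=
    Measure.restrict_mono (fun x hx => hsub hjk.symm ⟨hx.2, hx.1⟩) le_rfl
  have haeU : ∀ᵐ x ∂((surf d).restrict (𝓜.elem j ∩ 𝓜.elem k)), x ∈ U ∧ ‖n j x‖ = 1 ∧
      n k x = -n j x := by
    filter_upwards [ae_restrict_of_ae 𝓜.surf_ae_structure, ae_restrict_mem hmF] with x hx hxF
    obtain ⟨h0, h1, -, -⟩ := hx j (hsub hjk hxF)
    obtain ⟨h2, h3, h4⟩ := h1 k hjk.symm hxF.2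
    refine ⟨⟨h3, fun hmem => ?_⟩, h0.1, h2⟩
    simp only [mem_iUnion] at hmem
    obtain ⟨l, hl, hxl⟩ := hmem
    exact hl.2 (h4 l hl.1 hxl)
  -- A boundary point of element `a` in `U` lies in a further element, which can only be `b`. So the
  -- test function vanishes on the rest of the boundary.
  have hgen : ∀ (a b : Fin Ns) (_ : a ≠ b) (_ : ∀ l, l ≠ a → l ≠ b → l ≠ j ∧ l ≠ k)
      (φ : E d → ℝ) (_ : tsupport φ ⊆ U) (e : E d),
      ∫ x, tr a x * φ x * inner ℝ (n a x) e ∂(bdry (𝓜.elem a))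
        = ∫ x in 𝓜.elem a ∩ 𝓜.elem b, tr a x * φ x * inner ℝ (n a x) e ∂(surf d) := by
    intro a b hab hl φ h3 e
    refine setIntegral_eq_of_subset_of_ae_sdiff_eq_zero
      isClosed_frontier.measurableSet.nullMeasurableSet (hsub hab) ?_
    filter_upwards [𝓜.surf_ae_structure] with x hx hxa
    by_cases hxU : x ∈ U
    · exfalso
      obtain ⟨-, -, h2, -⟩ := hx a hxa.1
      obtain ⟨l, hla, hxl⟩ := h2 hxU.1
      refine hxU.2 (mem_biUnion (hl l hla fun e => ?_) hxl)
      exact hxa.2 ⟨(𝓜.isClosed_elem a).frontier_subset hxa.1, e ▸ hxl⟩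
    · have : φ x = 0 := image_eq_zero_of_notMem_tsupport fun h => hxU (h3 h)
      simp [this]
  have key : ∀ᵐ x ∂((surf d).restrict (𝓜.elem j ∩ 𝓜.elem k)), x ∈ U →
      (tr j x - tr k x) • n j x = 0 := by
    have hm : MemLp (fun x => tr j x - tr k x) 2 ((surf d).restrict (𝓜.elem j ∩ 𝓜.elem k)) :=
      ((htr j).2.1.mono_measure hleJ).sub ((htr k).2.1.mono_measure hleK)
    have := (𝓜.isPolytope j).isFiniteMeasure_bdry
    have : IsFiniteMeasure ((surf d).restrict (𝓜.elem j ∩ 𝓜.elem k)) :=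
      isFiniteMeasure_of_le _ hleJ
    have hm2 : MemLp (fun x => (tr j x - tr k x) • n j x) 2
        ((surf d).restrict (𝓜.elem j ∩ 𝓜.elem k)) := by
      refine hm.norm.mono' (hm.1.smul
        ((𝓜.isPolytope j).aestronglyMeasurable_outwardNormal.mono_measure hleJ))
        (Eventually.of_forall fun x => ?_)
      rw [norm_smul]
      exact mul_le_of_le_one_right (norm_nonneg _) (norm_outwardNormal_le _ x)
    refine hU.ae_eq_zero_of_integral_contDiff_smul_eq_zero
      (hm2.integrable one_le_two).integrableOn.locallyIntegrableOn fun φ h1 h2 h3 => ?_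
    obtain ⟨M, hM⟩ := h2.exists_bound_of_continuous h1.continuous
    have hi : Integrable (fun x => φ x • (tr j x - tr k x) • n j x)
        ((surf d).restrict (𝓜.elem j ∩ 𝓜.elem k)) :=
      (hm2.integrable one_le_two).bdd_smul M h1.continuous.aestronglyMeasurable
        (Eventually.of_forall hM)
    refine ext_inner_left ℝ fun e => ?_
    rw [inner_zero_right, ← integral_inner hi]
    have hΩsub : tsupport φ ⊆ P.Ω := h3.trans sdiff_subset
    -- The weak gradient identity on `Ω` is split over the elements and integrated by parts on each.
    -- Only the terms on the common face survive, and the opposite normals make their sum the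
    -- difference of the two traces.
    obtain ⟨gi, gz⟩ := isWeakGrad_inner p h1 h2 hΩsub e
    rw [𝓜.integral_Ω gi] at gz
    have green : ∀ l, ∫ x in 𝓜.elem l, (inner ℝ (p.1.2 x) e * φ x + p.1.1 x * fderiv ℝ φ x e)
        = ∫ x, tr l x * φ x * inner ℝ (n l x) e ∂(bdry (𝓜.elem l)) := fun l => by
      obtain ⟨c, hc⟩ := (𝓜.isPolytope l).lipschitzOn_smooth h1
      exact (𝓜.isPolytope l).green hd (htr l) ((𝓜.isCell hd l).memLp _)
        ((𝓜.isCell hd l).isWeakGrad p.2) hc e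
    simp only [green] at gz
    rw [← Finset.sum_subset (Finset.subset_univ {j, k}) (fun l _ hl => by
      simp only [Finset.mem_insert, Finset.mem_singleton, not_or] at hl
      refine integral_eq_zero_of_ae ?_
      filter_upwards [ae_restrict_mem isClosed_frontier.measurableSet] with x hx
      have : φ x = 0 := image_eq_zero_of_notMem_tsupport fun h => (h3 h).2
        (mem_biUnion hl ((𝓜.isClosed_elem l).frontier_subset hx))
      simp [this]), Finset.sum_pair hjk,
      hgen j k hjk (fun l h h' => ⟨h, h'⟩) φ h3 e,
      hgen k j hjk.symm (fun l h h' => ⟨h', h⟩) φ h3 e, inter_comm (𝓜.elem k),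
      ← integral_add (((𝓜.isPolytope j).integrable_trace_mul (htr j).2.1 h1.continuous
        e).mono_measure hleJ) (((𝓜.isPolytope k).integrable_trace_mul (htr k).2.1 h1.continuous
        e).mono_measure hleK)] at gz
    rw [← gz]
    refine integral_congr_ae ?_
    filter_upwards [haeU] with x hx
    have hn : outwardNormal (𝓜.elem k) x = -outwardNormal (𝓜.elem j) x := hx.2.2
    simp only [tr, n, hn, inner_smul_right, inner_neg_right, real_inner_comm e]
    ring
  filter_upwards [key, haeU] with x h1 h2
  have h3 := (smul_eq_zero.1 (h1 h2.1)).resolve_right (ne_zero_of_norm_eq_one h2.2.1)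
  exact sub_eq_zero.1 h3

end Matching

/-! ### Integration by parts in time -/

section Pairing

variable {d : ℕ} {K : Set (E d)} {μ : Measure (E d)} {c : E d → ℝ} {V : ℝ → E d → ℝ}

lemma tendstoUniformlyOn_of_continuous (hV : Continuous (Function.uncurry V)) (hK : IsCompact K)
    (t : ℝ) : TendstoUniformlyOn V (V t) (𝓝 t) K := by
  let f : C(ℝ × E d, ℝ) := ⟨Function.uncurry V, hV⟩
  exact (ContinuousMap.tendsto_iff_forall_isCompact_tendstoUniformlyOn.1
    (f.curry.continuous.tendsto t)) K hK

lemma exists_bound_on_compact (hV : Continuous (Function.uncurry V)) (hK : IsCompact K) (a b : ℝ) :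
    ∃ M, 0 ≤ M ∧ ∀ t ∈ Icc a b, ∀ x ∈ K, |V t x| ≤ M := by
  obtain ⟨M, hM⟩ := (isCompact_Icc.prod hK).exists_bound_of_continuousOn
    (f := Function.uncurry V) hV.continuousOn
  exact ⟨max M 0, le_max_right _ _, fun t ht x hx => (hM (t, x) ⟨ht, hx⟩).trans (le_max_left _ _)⟩

lemma memLp_coeff_mul [IsFiniteMeasure μ] (hK : IsCompact K) (hμ : ∀ᵐ x ∂μ, x ∈ K)
    (hc : MemLp c ⊤ μ) (hV : Continuous (Function.uncurry V)) (t : ℝ) :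
    MemLp (fun x => c x * V t x) 2 μ := by
  obtain ⟨M, -, hM⟩ := exists_bound_on_compact hV hK t t
  have hVt : Continuous (V t) := hV.comp (by fun_prop : Continuous fun x : E d => (t, x))
  have h2 : MemLp (V t) 2 μ := MemLp.of_bound hVt.aestronglyMeasurable M (by
    filter_upwards [hμ] with x hx
    exact hM t ⟨le_rfl, le_rfl⟩ x hx)
  exact MemLp.smul (p := ⊤) (q := 2) h2 hc

/-- The curve `t ↦ c V(t)` in `L²(μ)`. -/
def coeffMul [IsFiniteMeasure μ] (hK : IsCompact K) (hμ : ∀ᵐ x ∂μ, x ∈ K)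
    (hc : MemLp c ⊤ μ) (hV : Continuous (Function.uncurry V)) (t : ℝ) : Lp ℝ 2 μ :=
  (memLp_coeff_mul hK hμ hc hV t).toLp _

variable [IsFiniteMeasure μ] (hK : IsCompact K) (hμ : ∀ᵐ x ∂μ, x ∈ K)
    (hc : MemLp c ⊤ μ) (hV : Continuous (Function.uncurry V))

lemma inner_coeffMul (f : Lp ℝ 2 μ) (t : ℝ) :
    inner ℝ f (coeffMul hK hμ hc hV t) = ∫ x, f x * (c x * V t x) ∂μ := by
  rw [L2.inner_def]
  refine integral_congr_ae ?_
  filter_upwards [(memLp_coeff_mul hK hμ hc hV t).coeFn_toLp] with x hx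
  rw [coeffMul, hx]
  simp [mul_comm]

/-- `V s` tends to `V t` uniformly on `K`, and `c` is in `L²`. Pairings with continuous or
integrable `L²`-valued curves thereby become continuous or integrable functions of time. -/
lemma continuous_coeffMul : Continuous (coeffMul hK hμ hc hV) := by
  rw [continuous_iff_continuousAt]
  intro t
  have hc2 : MemLp c 2 μ := hc.mono_exponent le_top
  rw [ContinuousAt, tendsto_iff_norm_sub_tendsto_zero]
  set C := (eLpNorm c 2 μ).toReal with hC
  have hbound : ∀ ε > 0, ∀ᶠ s in 𝓝 t,
      ‖coeffMul hK hμ hc hV s - coeffMul hK hμ hc hV t‖ ≤ ε * C := by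
    intro ε hε
    filter_upwards [Metric.tendstoUniformlyOn_iff.1 (tendstoUniformlyOn_of_continuous hV hK t) ε hε]
      with s hs
    rw [coeffMul, coeffMul, ← MemLp.toLp_sub, Lp.norm_toLp]
    have h1 : eLpNorm ((fun x => c x * V s x) - fun x => c x * V t x) 2 μ
        ≤ ENNReal.ofReal ε * eLpNorm c 2 μ := by
      refine eLpNorm_le_mul_eLpNorm_of_ae_le_mul ?_ 2
      filter_upwards [hμ] with x hx
      have := hs x hx
      rw [Real.dist_eq, abs_sub_comm] at this
      rw [Pi.sub_apply, ← mul_sub, norm_mul, mul_comm]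
      exact mul_le_mul_of_nonneg_right this.le (norm_nonneg _)
    refine (ENNReal.toReal_mono (ENNReal.mul_ne_top ENNReal.ofReal_ne_top hc2.2.ne) h1).trans ?_
    rw [ENNReal.toReal_mul, ENNReal.toReal_ofReal hε.le]
  rw [Metric.tendsto_nhds]
  intro ε hε
  have hC0 : 0 ≤ C := ENNReal.toReal_nonneg
  filter_upwards [hbound (ε / (C + 1)) (by positivity)] with s hs
  rw [dist_zero_right, norm_norm]
  refine hs.trans_lt ?_
  rw [div_mul_eq_mul_div, div_lt_iff₀ (by positivity)]
  nlinarith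

lemma continuousOn_integral_mul (hK : IsCompact K) (hμ : ∀ᵐ x ∂μ, x ∈ K) (hc : MemLp c ⊤ μ)
    (hV : Continuous (Function.uncurry V)) {F : ℝ → Lp ℝ 2 μ} {s : Set ℝ} (hF : ContinuousOn F s) :
    ContinuousOn (fun t => ∫ x, F t x * (c x * V t x) ∂μ) s := by
  simp only [← inner_coeffMul hK hμ hc hV]
  exact hF.inner (continuous_coeffMul hK hμ hc hV).continuousOn

lemma integrableOn_inner_of_continuous {H : Type*} [NormedAddCommGroup H] [InnerProductSpace ℝ H]
    {F G : ℝ → H} {a b : ℝ} (hF : IntegrableOn F (Ioc a b)) (hG : Continuous G) :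
    IntegrableOn (fun t => inner ℝ (F t) (G t)) (Ioc a b) := by
  obtain ⟨M, hM⟩ := (isCompact_Icc (a := a) (b := b)).exists_bound_of_continuousOn hG.continuousOn
  refine Integrable.mono' (hF.norm.mul_const M)
    (hF.aestronglyMeasurable.inner hG.aestronglyMeasurable) ?_
  filter_upwards [ae_restrict_mem measurableSet_Ioc] with t ht
  exact (norm_inner_le_norm _ _).trans
    (mul_le_mul_of_nonneg_left (hM t (Ioc_subset_Icc_self ht)) (norm_nonneg _))

lemma integrableOn_integral_mul (hK : IsCompact K) (hμ : ∀ᵐ x ∂μ, x ∈ K) (hc : MemLp c ⊤ μ)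
    (hV : Continuous (Function.uncurry V)) {F : ℝ → Lp ℝ 2 μ} {a b : ℝ} (hF : IntegrableOn F (Ioc a b)) :
    IntegrableOn (fun t => ∫ x, F t x * (c x * V t x) ∂μ) (Ioc a b) := by
  simp only [← inner_coeffMul hK hμ hc hV]
  exact integrableOn_inner_of_continuous hF (continuous_coeffMul hK hμ hc hV)

/-- Differentiability after pairing with a fixed `f` suffices for the integration by parts. It is
differentiation under the integral, dominated by `‖f c‖` times a bound for `V'` on a compact set. -/
lemma hasDerivAt_inner_coeffMul {V' : ℝ → E d → ℝ} (hV' : Continuous (Function.uncurry V'))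
    (h : ∀ t x, HasDerivAt (fun s => V s x) (V' t x) t) (f : Lp ℝ 2 μ) (t : ℝ) :
    HasDerivAt (fun t => inner ℝ f (coeffMul hK hμ hc hV t))
      (inner ℝ f (coeffMul hK hμ hc hV' t)) t := by
  simp only [inner_coeffMul]
  obtain ⟨M, hM0, hM⟩ := exists_bound_on_compact hV' hK (t - 1) (t + 1)
  have hint : ∀ {W : ℝ → E d → ℝ}, Continuous (Function.uncurry W) → ∀ s,
      Integrable (fun x => f x * (c x * W s x)) μ := fun hW s =>
    memLp_one_iff_integrable.1 (MemLp.smul (p := 2) (q := 2) (memLp_coeff_mul hK hμ hc hW s)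
      (Lp.memLp f))
  have hfc : Integrable (fun x => f x * c x) μ :=
    memLp_one_iff_integrable.1 (MemLp.smul (p := 2) (q := 2) (hc.mono_exponent le_top)
      (Lp.memLp f))
  refine (hasDerivAt_integral_of_dominated_loc_of_deriv_le (Metric.ball_mem_nhds t one_pos)
    (bound := fun x => ‖f x * c x‖ * M)
    (F' := fun s x => f x * (c x * V' s x)) (Eventually.of_forall fun s => (hint hV s).1) (hint hV t)
    (hint hV' t).1 ?_ (hfc.norm.mul_const M) ?_).2
  · filter_upwards [hμ] with x hx s hs
    rw [← mul_assoc, norm_mul]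
    rw [Real.ball_eq_Ioo] at hs
    exact mul_le_mul_of_nonneg_left (hM s (Ioo_subset_Icc_self hs) x hx) (norm_nonneg _)
  · exact Eventually.of_forall fun x s _ => ((h s x).const_mul _).const_mul _

end Pairing

/-! ### Curves in a Hilbert space with an integrable weak derivative. -/

section WeakDerivative

variable {H : Type*} [NormedAddCommGroup H] [InnerProductSpace ℝ H] [CompleteSpace H]

/-- An approximate identity at a point of the open set: the bumps eventually live where `w` is close
to `w x`, so continuity on `s` is enough. -/
lemma tendsto_integral_bump {w : ℝ → H} {s : Set ℝ} {x : ℝ} (hs : IsOpen s) (hx : x ∈ s)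
    (hw : ContinuousOn w s) {r : ℕ → ContDiffBump x} (hr : Tendsto (fun n => (r n).rOut) atTop (𝓝 0)) :
    Tendsto (fun n => ∫ t in s, (r n).normed volume t • w t) atTop (𝓝 (w x)) := by
  rw [Metric.tendsto_atTop']
  intro ε hε
  have hnear : ∀ᶠ t in 𝓝 x, t ∈ s ∧ dist (w t) (w x) < ε / 2 :=
    (show ∀ᶠ t in 𝓝 x, t ∈ s from hs.mem_nhds hx).and ((hw.continuousAt (hs.mem_nhds hx)).eventually
      (Metric.ball_mem_nhds _ (half_pos hε)))
  obtain ⟨δ, δ0, hδ⟩ := Metric.eventually_nhds_iff.1 hnear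
  obtain ⟨N, hN⟩ := (hr.eventually (gt_mem_nhds δ0)).exists_forall_of_atTop
  refine ⟨N, fun n hn => ?_⟩
  have hsupp : ∀ t, (r n).normed volume t ≠ 0 → dist t x < δ := by
    intro t ht
    have : t ∈ Function.support ((r n).normed volume) := ht
    rw [ContDiffBump.support_normed_eq, Metric.mem_ball] at this
    exact this.trans (hN n hn.le)
  have hcont : Continuous ((r n).normed volume) := (r n).continuous_normed
  have hzero : ∀ t ∉ s, (r n).normed volume t • w t = 0 := by
    intro t ht
    by_contra hne
    exact ht (hδ (hsupp t (left_ne_zero_of_smul hne))).1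
  rw [setIntegral_eq_integral_of_forall_compl_eq_zero hzero, dist_eq_norm]
  have hbd : ∀ t, ‖(r n).normed volume t • (w t - w x)‖ ≤ (r n).normed volume t * (ε / 2) := by
    intro t
    rw [norm_smul, Real.norm_of_nonneg ((r n).nonneg_normed t)]
    by_cases h0 : (r n).normed volume t = 0
    · simp [h0]
    · refine mul_le_mul_of_nonneg_left ?_ ((r n).nonneg_normed t)
      rw [← dist_eq_norm]
      exact (hδ (hsupp t h0)).2.le
  have hi1 : Integrable (fun t => (r n).normed volume t • w x) :=
    ((r n).integrable_normed (μ := volume)).smul_const (w x)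
  have hmeas : AEStronglyMeasurable (fun t => (r n).normed volume t • (w t - w x)) volume := by
    have h1 : AEStronglyMeasurable (fun t => (r n).normed volume t • (w t - w x))
        (volume.restrict s) :=
      hcont.aestronglyMeasurable.smul
        ((hw.sub continuousOn_const).aestronglyMeasurable hs.measurableSet)
    have h2 := (aestronglyMeasurable_indicator_iff hs.measurableSet).2 h1
    refine h2.congr (Eventually.of_forall fun t => ?_)
    by_cases ht : t ∈ s
    · simp [ht]
    · have : (r n).normed volume t = 0 := by
        by_contra hne; exact ht (hδ (hsupp t hne)).1
      simp [this]
  have hi2 : Integrable (fun t => (r n).normed volume t • (w t - w x)) :=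
    Integrable.mono' (((r n).integrable_normed (μ := volume)).mul_const _) hmeas
      (Eventually.of_forall hbd)
  have hsplit : ∫ t, (r n).normed volume t • w t
      = (∫ t, (r n).normed volume t • (w t - w x)) + ∫ t, (r n).normed volume t • w x := by
    rw [← integral_add hi2 hi1]
    simp only [smul_sub, sub_add_cancel]
  rw [hsplit, integral_smul_const, (r n).integral_normed, one_smul, add_sub_cancel_right]
  have := norm_integral_le_of_norm_le (((r n).integrable_normed (μ := volume)).mul_const (ε / 2))
    (Eventually.of_forall hbd)
  rw [integral_mul_const, (r n).integral_normed, one_mul] at this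
  linarith

lemma setIntegral_bump_le_one {x : ℝ} (r : ContDiffBump x) (s : Set ℝ) :
    ∫ t in s, r.normed volume t ≤ 1 := by
  rw [← r.integral_normed (μ := volume)]
  exact setIntegral_le_integral r.integrable_normed (Eventually.of_forall r.nonneg_normed)

lemma bump_eq_zero {x : ℝ} (r : ContDiffBump x) {t : ℝ} (ht : r.rOut ≤ |t - x|) :
    r.normed volume t = 0 := by
  by_contra hne
  have : t ∈ Function.support (r.normed volume) := hne
  rw [ContDiffBump.support_normed_eq, Metric.mem_ball, Real.dist_eq] at this
  linarith

lemma contDiff_primitive {f : ℝ → ℝ} (hf : ContDiff ℝ ∞ f) :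
    ContDiff ℝ ∞ (fun x => ∫ t in (0:ℝ)..x, f t) ∧
      ∀ x, HasDerivAt (fun x => ∫ t in (0:ℝ)..x, f t) (f x) x := by
  have h : ∀ x, HasDerivAt (fun x => ∫ t in (0:ℝ)..x, f t) (f x) x := fun x =>
    (hf.continuous.integral_hasStrictDerivAt 0 x).hasDerivAt
  refine ⟨contDiff_infty_iff_deriv.2 ⟨fun x => (h x).differentiableAt, ?_⟩, h⟩
  rw [show deriv (fun x => ∫ t in (0:ℝ)..x, f t) = f from funext fun x => (h x).deriv]
  exact hf

lemma primitive_bump_of_le {x : ℝ} (r : ContDiffBump x) (h0 : r.rOut < x) {t : ℝ}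
    (ht : t ≤ x - r.rOut) : ∫ y in (0:ℝ)..t, r.normed volume y = 0 := by
  refine intervalIntegral.integral_zero_ae (Eventually.of_forall fun y hy => ?_)
  refine bump_eq_zero r ?_
  rw [mem_uIoc] at hy
  rw [abs_sub_comm]
  refine le_trans ?_ (le_abs_self _)
  rcases hy with h | h <;> linarith [h.1, h.2]

lemma primitive_bump_of_ge {x : ℝ} (r : ContDiffBump x) (h0 : r.rOut < x) {t : ℝ}
    (ht : x + r.rOut ≤ t) : ∫ y in (0:ℝ)..t, r.normed volume y = 1 := by
  have := r.rOut_pos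
  rw [intervalIntegral.integral_of_le (by linarith), ← r.integral_normed (μ := volume)]
  refine setIntegral_eq_integral_of_forall_compl_eq_zero fun y hy => bump_eq_zero r ?_
  rw [mem_Ioc, not_and_or, not_lt, not_le] at hy
  rcases hy with h | h
  · rw [abs_sub_comm]; exact le_trans (by linarith) (le_abs_self _)
  · exact le_trans (by linarith) (le_abs_self _)

lemma primitive_bump_mem {x : ℝ} (r : ContDiffBump x) {t : ℝ} (ht : 0 ≤ t) :
    ∫ y in (0:ℝ)..t, r.normed volume y ∈ Icc (0:ℝ) 1 := by
  rw [intervalIntegral.integral_of_le ht]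
  exact ⟨integral_nonneg r.nonneg_normed, setIntegral_bump_le_one r _⟩

variable {T : ℝ} {w a : ℝ → H}

/-- The test function is a smoothed indicator of `(s, t]`: the primitive of a bump at `s` minus the
primitive of a bump at `t`. As the bumps shrink, its derivative paired with `w` tends to `w s - w
t`, and the function itself tends to the indicator. -/
lemma sub_eq_integral_of_weak_deriv_aux (hw : ContinuousOn w (Icc 0 T))
    (ha : IntegrableOn a (Ioo 0 T))
    (h : ∀ θ : ℝ → ℝ, ContDiff ℝ ∞ θ → HasCompactSupport θ → tsupport θ ⊆ Ioo 0 T →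
      ∫ t in Ioo 0 T, deriv θ t • w t = -∫ t in Ioo 0 T, θ t • a t)
    {s t : ℝ} (hs : 0 < s) (hst : s < t) (ht : t < T) :
    w t - w s = ∫ y in s..t, a y := by
  -- `ρ` bounds all bump radii, so the test functions are supported in `Icc (s - ρ) (t + ρ)`, inside
  -- `Ioo 0 T`.
  obtain ⟨ρ, ρ0, hρ1, hρ2, hρ3⟩ : ∃ ρ : ℝ, 0 < ρ ∧ ρ < s ∧ ρ < T - t ∧ ρ < t - s :=
    ⟨min s (min (T - t) (t - s)) / 2, by
      have : 0 < min s (min (T - t) (t - s)) := lt_min hs (lt_min (by linarith) (by linarith))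
      refine ⟨by linarith, ?_, ?_, ?_⟩
      · linarith [min_le_left s (min (T - t) (t - s))]
      · linarith [(min_le_right s (min (T - t) (t - s))).trans (min_le_left _ _)]
      · linarith [(min_le_right s (min (T - t) (t - s))).trans (min_le_right _ _)]⟩
  have hpos : ∀ n : ℕ, 0 < ρ / (n + 1) := fun n => by positivity
  have hle : ∀ n : ℕ, ρ / (n + 1) ≤ ρ := fun n => div_le_self ρ0.le (by
    have : (0:ℝ) ≤ n := n.cast_nonneg
    linarith)
  let r : ∀ (x : ℝ) (_ : ℕ), ContDiffBump x := fun x n =>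
    ⟨ρ / (n + 1) / 2, ρ / (n + 1), half_pos (hpos n), half_lt_self (hpos n)⟩
  have hrlim : Tendsto (fun n : ℕ => ρ / ((n : ℝ) + 1)) atTop (𝓝 0) :=
    tendsto_const_div_atTop_nhds_zero_nat ρ |>.comp (tendsto_add_atTop_nat 1) |>.congr fun n => by
      simp
  have hr : ∀ x, Tendsto (fun n => (r x n).rOut) atTop (𝓝 0) := fun x => hrlim
  let Φ : ∀ (x : ℝ) (_ : ℕ) (_ : ℝ), ℝ := fun x n y => ∫ z in (0:ℝ)..y, (r x n).normed volume z
  let θ : ℕ → ℝ → ℝ := fun n y => Φ s n y - Φ t n y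
  have hΦ : ∀ x n, ContDiff ℝ ∞ (Φ x n) ∧ ∀ y, HasDerivAt (Φ x n) ((r x n).normed volume y) y :=
    fun x n => contDiff_primitive (r x n).contDiff_normed
  have hθ : ∀ n, ContDiff ℝ ∞ (θ n) := fun n => (hΦ s n).1.sub (hΦ t n).1
  have hθ' : ∀ n y, deriv (θ n) y = (r s n).normed volume y - (r t n).normed volume y := fun n y =>
    (((hΦ s n).2 y).sub ((hΦ t n).2 y)).deriv
  have hrs : ∀ n, (r s n).rOut < s := fun n => (hle n).trans_lt hρ1
  have hrt : ∀ n, (r t n).rOut < t := fun n => (hle n).trans_lt (by linarith)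
  have hsupp : ∀ n, tsupport (θ n) ⊆ Icc (s - ρ) (t + ρ) := by
    intro n
    refine closure_minimal (fun y hy => ?_) isClosed_Icc
    by_contra hny
    rw [mem_Icc, not_and_or, not_le, not_le] at hny
    refine hy ?_
    have h1 := hle n
    rcases hny with h2 | h2
    · change Φ s n y - Φ t n y = 0
      rw [show Φ s n y = 0 from primitive_bump_of_le _ (hrs n)
          (by change y ≤ s - ρ / (n + 1); linarith),
        show Φ t n y = 0 from primitive_bump_of_le _ (hrt n)
          (by change y ≤ t - ρ / (n + 1); linarith), sub_zero]
    · change Φ s n y - Φ t n y = 0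
      rw [show Φ s n y = 1 from primitive_bump_of_ge _ (hrs n)
          (by change s + ρ / (n + 1) ≤ y; linarith),
        show Φ t n y = 1 from primitive_bump_of_ge _ (hrt n)
          (by change t + ρ / (n + 1) ≤ y; linarith), sub_self]
  have hIcc : Icc (s - ρ) (t + ρ) ⊆ Ioo 0 T := fun y hy =>
    ⟨by linarith [hy.1], by linarith [hy.2]⟩
  have heq : ∀ n, (∫ y in Ioo 0 T, (r s n).normed volume y • w y)
      - (∫ y in Ioo 0 T, (r t n).normed volume y • w y) = -∫ y in Ioo 0 T, θ n y • a y := by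
    intro n
    rw [← h (θ n) (hθ n) (HasCompactSupport.of_support_subset_isCompact isCompact_Icc
      ((subset_tsupport _).trans (hsupp n))) ((hsupp n).trans hIcc)]
    simp only [hθ', sub_smul]
    have hi : ∀ x, IntegrableOn (fun y => (r x n).normed volume y • w y) (Ioo 0 T) := fun x =>
      (((r x n).continuous_normed.continuousOn.smul hw).integrableOn_compact
        isCompact_Icc).mono_set Ioo_subset_Icc_self
    rw [integral_sub (hi s) (hi t)]
  have hwo : ContinuousOn w (Ioo 0 T) := hw.mono Ioo_subset_Icc_self
  have l1 := (tendsto_integral_bump isOpen_Ioo ⟨hs, hst.trans ht⟩ hwo (hr s)).sub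
    (tendsto_integral_bump isOpen_Ioo ⟨hs.trans hst, ht⟩ hwo (hr t))
  have l2 : Tendsto (fun n => -∫ y in Ioo 0 T, θ n y • a y) atTop
      (𝓝 (-∫ y in Ioo 0 T, (Ioc s t).indicator a y)) := by
    refine Tendsto.neg (tendsto_integral_of_dominated_convergence (fun y => ‖a y‖)
      (fun n => (hθ n).continuous.aestronglyMeasurable.smul ha.aestronglyMeasurable) ha.norm ?_ ?_)
    · intro n
      filter_upwards [ae_restrict_mem measurableSet_Ioo] with y hy
      have h1 := primitive_bump_mem (r s n) hy.1.le
      have h2 := primitive_bump_mem (r t n) hy.1.le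
      rw [norm_smul]
      refine mul_le_of_le_one_left (norm_nonneg _) ?_
      change |Φ s n y - Φ t n y| ≤ 1
      rw [abs_le]
      constructor <;> linarith [h1.1, h1.2, h2.1, h2.2]
    · have hne : ∀ᵐ y ∂(volume.restrict (Ioo 0 T)), y ≠ s ∧ y ≠ t := by
        refine ae_restrict_of_ae ?_
        have h1 : ∀ x : ℝ, ∀ᵐ y : ℝ, y ≠ x := fun x => by
          simp [ae_iff]
        filter_upwards [h1 s, h1 t] with y h2 h3 using ⟨h2, h3⟩
      filter_upwards [hne] with y hy
      have step : ∀ x, ρ < x → y ≠ x →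
          ∀ᶠ n in atTop, Φ x n y = if x < y then 1 else 0 := by
        intro x hx hyx
        have hd : 0 < |y - x| := abs_pos.2 (sub_ne_zero.2 hyx)
        filter_upwards [hrlim.eventually (gt_mem_nhds hd)] with n hn
        have hxo : (r x n).rOut < x := (hle n).trans_lt hx
        split_ifs with hlt
        · rw [abs_of_pos (by linarith)] at hn
          exact primitive_bump_of_ge _ hxo (by change x + ρ / (n + 1) ≤ y; linarith)
        · rw [abs_of_nonpos (by linarith)] at hn
          exact primitive_bump_of_le _ hxo (by change y ≤ x - ρ / (n + 1); linarith)
      refine tendsto_const_nhds.congr' ?_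
      filter_upwards [step s hρ1 hy.1, step t (by linarith) hy.2] with n h1 h2
      change _ = (Φ s n y - Φ t n y) • a y
      rw [h1, h2]
      by_cases c1 : s < y
      · by_cases c2 : t < y
        · rw [indicator_of_notMem (show y ∉ Ioc s t from fun hm => absurd hm.2 (not_le.2 c2))]; simp [c1, c2]
        · rw [indicator_of_mem (show y ∈ Ioc s t from ⟨c1, not_lt.1 c2⟩)]; simp [c1, c2]
      · have c2 : ¬t < y := fun c => c1 (hst.trans c)
        rw [indicator_of_notMem (show y ∉ Ioc s t from fun hm => c1 hm.1)]; simp [c1, c2]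
  have huniq := tendsto_nhds_unique (l1.congr heq) l2
  have hsub : Ioc s t ⊆ Ioo 0 T := fun y hy => ⟨hs.trans hy.1, hy.2.trans_lt ht⟩
  rw [integral_indicator measurableSet_Ioc, Measure.restrict_restrict measurableSet_Ioc,
    inter_eq_left.2 hsub,
    ← intervalIntegral.integral_of_le hst.le] at huniq
  rw [← neg_sub, huniq, neg_neg]

/-- A continuous function with a weak derivative in `L¹` is its primitive. -/
lemma sub_eq_integral_of_weak_deriv (hw : ContinuousOn w (Icc 0 T))
    (ha : IntegrableOn a (Ioo 0 T))
    (h : ∀ θ : ℝ → ℝ, ContDiff ℝ ∞ θ → HasCompactSupport θ → tsupport θ ⊆ Ioo 0 T →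
      ∫ t in Ioo 0 T, deriv θ t • w t = -∫ t in Ioo 0 T, θ t • a t)
    {s t : ℝ} (hs : s ∈ Icc 0 T) (ht : t ∈ Icc 0 T) :
    w t - w s = ∫ y in s..t, a y := by
  rcases hs.1.trans hs.2 |>.eq_or_lt with hT0 | hT0
  · have h1 : s = t := by linarith [hs.1, hs.2, ht.1, ht.2]
    simp [h1]
  have haI : IntegrableOn a (Icc 0 T) := by
    rw [integrableOn_Icc_iff_integrableOn_Ioo]; exact ha
  have hii : ∀ x y, x ∈ Icc 0 T → y ∈ Icc 0 T → IntervalIntegrable a volume x y := fun x y hx hy =>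
    (haI.mono_set (uIcc_subset_Icc hx hy)).intervalIntegrable
  have hcont : ContinuousOn (fun x => w x - ∫ y in (0:ℝ)..x, a y) (Icc 0 T) := by
    refine hw.sub ?_
    have := intervalIntegral.continuousOn_primitive_interval (f := a) (a := 0) (b := T)
      (μ := volume) (by rw [uIcc_of_le hT0.le]; exact haI)
    rwa [uIcc_of_le hT0.le] at this
  have hmid : T / 2 ∈ Ioo 0 T := ⟨by linarith, by linarith⟩
  have h0 : (0:ℝ) ∈ Icc 0 T := ⟨le_rfl, hT0.le⟩
  have hin : EqOn (fun x => w x - ∫ y in (0:ℝ)..x, a y)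
      (fun _ => w (T / 2) - ∫ y in (0:ℝ)..(T / 2), a y) (Ioo 0 T) := by
    have key : ∀ x y, 0 < x → x < y → y < T →
        w x - (∫ z in (0:ℝ)..x, a z) = w y - ∫ z in (0:ℝ)..y, a z := by
      intro x y hx hxy hy
      have h1 := sub_eq_integral_of_weak_deriv_aux hw ha h hx hxy hy
      have h2 := intervalIntegral.integral_add_adjacent_intervals
        (hii 0 x h0 ⟨hx.le, (hxy.trans hy).le⟩)
        (hii x y ⟨hx.le, (hxy.trans hy).le⟩ ⟨(hx.trans hxy).le, hy.le⟩)
      rw [← h2, ← h1]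
      abel
    intro x hx
    rcases lt_trichotomy x (T / 2) with hlt | heq | hlt
    · exact key _ _ hx.1 hlt hmid.2
    · simp [heq]
    · exact (key _ _ hmid.1 hlt hx.2).symm
  -- `w` minus its candidate primitive is constant on the open interval; continuity extends this to
  -- the two end points, where the initial velocity is read off.
  have hall := hin.of_subset_closure hcont continuousOn_const Ioo_subset_Icc_self
    (by rw [closure_Ioo hT0.ne])
  have h1 := (hall hs).trans (hall ht).symm
  have h2 := intervalIntegral.integral_add_adjacent_intervals (hii 0 s h0 hs) (hii s t hs ht)
  simp only at h1
  rw [← h2] at h1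
  have : w t - w s = (w t - (∫ y in (0:ℝ)..s, a y) - ∫ y in s..t, a y)
      - (w s - ∫ y in (0:ℝ)..s, a y) + ∫ y in s..t, a y := by abel
  rw [this, h1]
  abel

/-- Integration by parts for a primitive and a continuously differentiable curve. -/
lemma integral_inner_by_parts {x y : ℝ} (hxy : x ≤ y) (ha : IntegrableOn a (Ioc x y))
    (hw : ∀ t ∈ Icc x y, w t - w x = ∫ s in x..t, a s) {G G' : ℝ → H} (hG' : Continuous G')
    (hGc : Continuous G)
    (hG : ∀ (f : H) t, HasDerivAt (fun t => inner ℝ f (G t)) (inner ℝ f (G' t)) t) :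
    (∫ t in x..y, inner ℝ (a t) (G t)) + ∫ t in x..y, inner ℝ (w t) (G' t)
      = inner ℝ (w y) (G y) - inner ℝ (w x) (G x) := by
  have hsub : ∀ (f : H) (s t : ℝ), ∫ z in s..t, inner ℝ f (G' z) = inner ℝ f (G t)
      - (inner ℝ f (G s) : ℝ) := fun f s t =>
    intervalIntegral.integral_eq_sub_of_hasDerivAt (fun z _ => hG f z)
      ((continuous_const.inner hG').intervalIntegrable _ _)
  -- Insert `w t = w x + ∫ a`. The inner integral runs over `s ≤ t`, written as a cut-off on the
  -- full square so that Fubini can be applied.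
  have e1 : ∀ t ∈ Icc x y, (inner ℝ (w t) (G' t) : ℝ) = inner ℝ (w x) (G' t)
      + ∫ s in Ioc x y, (if s ≤ t then inner ℝ (a s) (G' t) else 0) := by
    intro t ht
    have h1 : w t = w x + ∫ s in x..t, a s := by rw [← hw t ht]; abel
    rw [h1, inner_add_left, intervalIntegral.integral_of_le ht.1]
    congr 1
    have hat : Integrable a (volume.restrict (Ioc x t)) :=
      ha.mono_set (Ioc_subset_Ioc_right ht.2)
    rw [real_inner_comm, ← integral_inner hat]
    have : (fun s => if s ≤ t then (inner ℝ (a s) (G' t) : ℝ) else 0)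
        = (Iic t).indicator fun s => inner ℝ (a s) (G' t) := by
      funext s; simp [indicator_apply]
    rw [this, integral_indicator measurableSet_Iic, Measure.restrict_restrict measurableSet_Iic]
    rw [show Iic t ∩ Ioc x y = Ioc x t by
      ext s; simp only [mem_inter_iff, mem_Iic, mem_Ioc]
      constructor
      · rintro ⟨h1, h2, -⟩; exact ⟨h2, h1⟩
      · rintro ⟨h1, h2⟩; exact ⟨h2, h1, h2.trans ht.2⟩]
    refine integral_congr_ae (Eventually.of_forall fun s => ?_)
    exact real_inner_comm _ _
  obtain ⟨M, hM⟩ := (isCompact_Icc (a := x) (b := y)).exists_bound_of_continuousOn hG'.continuousOn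
  have hFi : Integrable (Function.uncurry fun t s => if s ≤ t then (inner ℝ (a s) (G' t) : ℝ) else 0)
      ((volume.restrict (Ioc x y)).prod (volume.restrict (Ioc x y))) := by
    have hmeas : AEStronglyMeasurable (fun p : ℝ × ℝ => (inner ℝ (a p.2) (G' p.1) : ℝ))
        ((volume.restrict (Ioc x y)).prod (volume.restrict (Ioc x y))) :=
      ha.aestronglyMeasurable.comp_snd.inner (hG'.comp continuous_fst).aestronglyMeasurable
    have hset : MeasurableSet {p : ℝ × ℝ | p.2 ≤ p.1} :=
      measurableSet_le measurable_snd measurable_fst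
    have heq : (Function.uncurry fun t s => if s ≤ t then (inner ℝ (a s) (G' t) : ℝ) else 0)
        = {p : ℝ × ℝ | p.2 ≤ p.1}.indicator fun p => (inner ℝ (a p.2) (G' p.1) : ℝ) := by
      funext p; simp [indicator_apply, Function.uncurry]
    rw [heq]
    have hb : Integrable (fun p : ℝ × ℝ => ‖a p.2‖ * M)
        ((volume.restrict (Ioc x y)).prod (volume.restrict (Ioc x y))) :=
      (Integrable.comp_snd (f := fun s => ‖a s‖ * M) (ha.norm.mul_const M) _)
    refine Integrable.indicator (hb.mono' hmeas ?_) hset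
    have : ∀ᵐ p ∂((volume.restrict (Ioc x y)).prod (volume.restrict (Ioc x y))),
        p.1 ∈ Ioc x y := by
      rw [Measure.prod_restrict]
      filter_upwards [ae_restrict_mem (measurableSet_Ioc.prod measurableSet_Ioc)] with p hp
      exact hp.1
    filter_upwards [this] with p hp
    exact (norm_inner_le_norm _ _).trans
      (mul_le_mul_of_nonneg_left (hM _ (Ioc_subset_Icc_self hp)) (norm_nonneg _))
  have e2 : ∫ t in x..y, (inner ℝ (w t) (G' t) : ℝ)
      = (∫ t in x..y, (inner ℝ (w x) (G' t) : ℝ))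
        + ∫ t in Ioc x y, ∫ s in Ioc x y, (if s ≤ t then (inner ℝ (a s) (G' t) : ℝ) else 0) := by
    have hP : Integrable (fun t => ∫ s in Ioc x y,
        (if s ≤ t then (inner ℝ (a s) (G' t) : ℝ) else 0)) (volume.restrict (Ioc x y)) :=
      hFi.integral_prod_left
    rw [intervalIntegral.integral_of_le hxy, intervalIntegral.integral_of_le hxy,
      ← integral_add ((continuous_const.inner hG').integrableOn_Ioc) hP]
    exact setIntegral_congr_fun measurableSet_Ioc fun t ht => e1 t (Ioc_subset_Icc_self ht)
  -- With the order exchanged, `t` runs from `s` to `y` against the fixed vector `a s`, which gives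
  -- an increment of `G`.
  have e3 : ∀ s ∈ Ioc x y, ∫ t in Ioc x y, (if s ≤ t then (inner ℝ (a s) (G' t) : ℝ) else 0)
      = inner ℝ (a s) (G y) - inner ℝ (a s) (G s) := by
    intro s hs
    rw [← hsub, intervalIntegral.integral_of_le hs.2]
    have : (fun t => if s ≤ t then (inner ℝ (a s) (G' t) : ℝ) else 0)
        = (Ici s).indicator fun t => inner ℝ (a s) (G' t) := by
      funext t; simp [indicator_apply]
    rw [this, integral_indicator measurableSet_Ici, Measure.restrict_restrict measurableSet_Ici,
      ← integral_Icc_eq_integral_Ioc]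
    congr 2
    ext t; simp only [mem_inter_iff, mem_Ici, mem_Ioc, mem_Icc]
    constructor
    · rintro ⟨h1, h2, h3⟩; exact ⟨h1, h3⟩
    · rintro ⟨h1, h2⟩; exact ⟨h1, hs.1.trans_le h1, h2⟩
  have hi1 : IntegrableOn (fun s => (inner ℝ (a s) (G y) : ℝ)) (Ioc x y) :=
    integrableOn_inner_of_continuous ha continuous_const
  have hi2 : IntegrableOn (fun s => (inner ℝ (a s) (G s) : ℝ)) (Ioc x y) :=
    integrableOn_inner_of_continuous ha hGc
  rw [e2, integral_integral_swap hFi, setIntegral_congr_fun measurableSet_Ioc e3,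
    integral_sub hi1 hi2, hsub, intervalIntegral.integral_of_le hxy]
  have e4 : ∫ s in Ioc x y, (inner ℝ (a s) (G y) : ℝ) = inner ℝ (w y - w x) (G y) := by
    rw [hw y ⟨hxy, le_rfl⟩, intervalIntegral.integral_of_le hxy, real_inner_comm,
      ← integral_inner ha]
    exact integral_congr_ae (Eventually.of_forall fun s => real_inner_comm _ _)
  rw [e4, inner_sub_left]
  ring

end WeakDerivative

/-! ### Smooth test functions and Green formula for fluxes -/

section Networks

variable {d : ℕ}

lemma HiddenNet.contDiff_eval {act : ℝ → ℝ} (hact : ContDiff ℝ 2 act) {m n : ℕ}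
    (N : HiddenNet m n) : ContDiff ℝ 2 (N.eval act) := by
  have layer : ∀ {m k n : ℕ} (W : Matrix (Fin n) (Fin k) ℝ) (b : Fin n → ℝ)
      {f : (Fin m → ℝ) → Fin k → ℝ}, ContDiff ℝ 2 f →
      ContDiff ℝ 2 fun x => fun i => act ((W *ᵥ f x + b) i) := by
    intro m k n W b f hf
    rw [contDiff_pi]
    intro i
    refine hact.comp ?_
    have h1 : ContDiff ℝ 2 fun x => W *ᵥ f x :=
      ((Matrix.mulVecLin W).toContinuousLinearMap.contDiff).comp hf
    exact (contDiff_pi.1 h1 i).add contDiff_const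
  induction N with
  | first W b =>
    have h : (HiddenNet.first W b).eval act = fun x i => act ((W *ᵥ x + b) i) := by
      funext x i; rw [HiddenNet.eval]
    rw [h]
    exact layer W b contDiff_id
  | next N W b ih =>
    have h : (HiddenNet.next N W b).eval act = fun x i => act ((W *ᵥ N.eval act x + b) i) := by
      funext x i; rw [HiddenNet.eval]
    rw [h]
    exact layer W b ih

lemma RandNet.contDiff_of_mem_space {act : ℝ → ℝ} (hact : ContDiff ℝ 2 act) {N : RandNet d}
    {v : ℝ → E d → ℝ} (hv : v ∈ N.space act) : ContDiff ℝ 2 (Function.uncurry v) := by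
  obtain ⟨α, hα⟩ := hv
  have : Function.uncurry v = fun p : ℝ × E d => ∑ m, α m * N.basis act m p.1 p.2 := by
    funext p; exact hα p.1 p.2
  rw [this]
  refine ContDiff.sum fun m _ => contDiff_const.mul ?_
  have h1 : ContDiff ℝ 2 fun p : ℝ × E d => (Fin.cons p.1 fun k => p.2 k : Fin (d + 1) → ℝ) := by
    rw [contDiff_pi]
    intro i
    refine Fin.cases ?_ (fun k => ?_) i
    · exact contDiff_fst
    · simp only [Fin.cons_succ]
      exact (EuclideanSpace.proj (𝕜 := ℝ) k).contDiff.comp contDiff_snd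
  exact (contDiff_pi.1 (N.hidden.contDiff_eval hact) m).comp h1

end Networks

/-! ### Regularity in time and space of a C² piece. -/

section Pieces

variable {d : ℕ}

lemma inner_eq_sum (a b : E d) : (inner ℝ a b : ℝ) = ∑ k, a k * b k := by
  simp [PiLp.inner_apply, mul_comm]

lemma inner_single_eq (a : E d) (k : Fin d) :
    (inner ℝ a (EuclideanSpace.single k (1 : ℝ)) : ℝ) = a k := by
  simp [EuclideanSpace.inner_single_right]

variable {V : ℝ → E d → ℝ}

lemma hasDerivAt_piece (hV : ContDiff ℝ 2 (Function.uncurry V)) (t : ℝ) (x : E d) :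
    HasDerivAt (fun s => V s x) (deriv (fun s => V s x) t) t := by
  have h : ContDiff ℝ 2 fun s => V s x := hV.comp (contDiff_id.prodMk contDiff_const)
  exact (h.differentiable two_ne_zero t).hasDerivAt

lemma deriv_piece_eq (hV : ContDiff ℝ 2 (Function.uncurry V)) (t : ℝ) (x : E d) :
    deriv (fun s => V s x) t = fderiv ℝ (Function.uncurry V) (t, x) (1, 0) := by
  have h1 := (hV.differentiable two_ne_zero (t, x)).hasFDerivAt
  have h2 : HasDerivAt (fun s : ℝ => (s, x)) ((1 : ℝ), (0 : E d)) t :=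
    (hasDerivAt_id t).prodMk (hasDerivAt_const t x)
  exact (h1.comp_hasDerivAt t h2).deriv

lemma continuous_deriv_piece (hV : ContDiff ℝ 2 (Function.uncurry V)) :
    Continuous (Function.uncurry fun t x => deriv (fun s => V s x) t) := by
  have : (Function.uncurry fun t x => deriv (fun s => V s x) t)
      = fun p => fderiv ℝ (Function.uncurry V) p (1, 0) := by
    funext p; exact deriv_piece_eq hV p.1 p.2
  rw [this]
  exact (hV.continuous_fderiv two_ne_zero).clm_apply continuous_const

lemma contDiff_slice (hV : ContDiff ℝ 2 (Function.uncurry V)) (t : ℝ) : ContDiff ℝ 1 (V t) :=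
  (hV.comp (contDiff_const.prodMk contDiff_id : ContDiff ℝ 2 fun x : E d => (t, x))).of_le
    one_le_two

lemma gradient_slice_apply (hV : ContDiff ℝ 2 (Function.uncurry V)) (t : ℝ) (x : E d) (k : Fin d) : gradient (V t) x k
    = fderiv ℝ (Function.uncurry V) (t, x) (0, EuclideanSpace.single k 1) := by
  have h1 := (hV.differentiable two_ne_zero (t, x)).hasFDerivAt
  have h2 : HasFDerivAt (fun y : E d => (t, y)) ((0 : E d →L[ℝ] ℝ).prod (.id ℝ (E d))) x :=
    (hasFDerivAt_const t x).prodMk (hasFDerivAt_id x)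
  have h3 : fderiv ℝ (V t) x = (fderiv ℝ (Function.uncurry V) (t, x)).comp
      ((0 : E d →L[ℝ] ℝ).prod (.id ℝ (E d))) := (h1.comp x h2).fderiv
  have h4 := fderiv_eq_inner_gradient (V t) x (EuclideanSpace.single k 1)
  rw [h3] at h4
  simp only [ContinuousLinearMap.comp_apply, ContinuousLinearMap.prod_apply,
    _root_.zero_apply, ContinuousLinearMap.id_apply] at h4
  rw [h4, inner_single_eq]

lemma continuous_gradient_piece (hV : ContDiff ℝ 2 (Function.uncurry V)) (k : Fin d) :
    Continuous (Function.uncurry fun t x => gradient (V t) x k) := by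
  have : (Function.uncurry fun t x => gradient (V t) x k)
      = fun p => fderiv ℝ (Function.uncurry V) p (0, EuclideanSpace.single k 1) := by
    funext p; exact gradient_slice_apply hV p.1 p.2 k
  rw [this]
  exact (hV.continuous_fderiv two_ne_zero).clm_apply continuous_const

end Pieces

/-! ### Fluxes through the boundary of an element. -/

section Flux

variable {d : ℕ} {K Ω : Set (E d)}

lemma IsCell.traceVec_grad (hK : IsCell Ω K) (w : H2 Ω) (x : E d) (k : Fin d) :
    traceVec K (H2.grad w) x k = trace K (H2.gradH1 k w).1.1 x := by
  have h := trace_congr (K := K) ((Measure.absolutelyContinuous_of_le hK.restrict_le).ae_eq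
    (H2.gradH1_fst k w))
  rw [h]
  rfl

/-- The flux density `c ⟦v⟧ · {∇w}` of one element. -/
def fluxDensity (K : Set (E d)) (c : E d → ℝ) (w : H2 Ω) (V : E d → ℝ) (x : E d) : ℝ :=
  c x * inner ℝ (trace K V x • outwardNormal K x) (traceVec K (H2.grad w) x)

/-- The flux becomes a finite sum of trace operators applied to `w`, times bounded coefficients and
the smooth `V`. In this form integrability and continuity in time can be read off. -/
lemma IsCell.fluxDensity_ae_eq (hK : IsCell Ω K) (c : E d → ℝ) (w : H2 Ω) {V : E d → ℝ}
    (hV : ContDiff ℝ 1 V) : fluxDensity K c w V =ᵐ[bdry K] fun x =>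
      ∑ k, traceL hK (H2.gradH1 k w) x * (c x * outwardNormal K x k * V x) := by
  have h1 : ∀ᵐ x ∂(bdry K), ∀ k, traceL hK (H2.gradH1 k w) x = trace K (H2.gradH1 k w).1.1 x :=
    ae_all_iff.2 fun k => coeFn_traceL hK _
  filter_upwards [h1, hK.polytope.trace_of_contDiff hK.one_le hV] with x h1 h2
  rw [fluxDensity, h2, real_inner_smul_left, inner_eq_sum, Finset.mul_sum, Finset.mul_sum]
  refine Finset.sum_congr rfl fun k _ => ?_
  rw [h1, hK.traceVec_grad]
  ring

/-- Green's formula for `div (c ∇w)` on an element. -/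
lemma IsCell.green_flux (hK : IsCell Ω K) {c : E d → ℝ} {C : NNReal} (hc : LipschitzOnWith C c K)
    (w : H2 Ω) {V : E d → ℝ} (hV : ContDiff ℝ 1 V) :
    Integrable (fun x => H2.divCoeffGrad c w x * V x) (volume.restrict K) ∧
    Integrable (fun x => c x * inner ℝ (H2.grad w x) (gradient V x)) (volume.restrict K) ∧
    (∫ x in K, H2.divCoeffGrad c w x * V x) + ∫ x in K, c x * inner ℝ (H2.grad w x) (gradient V x)
      = ∫ x, fluxDensity K c w V x ∂(bdry K) := by
  have hP := hK.polytope
  have := hP.isFiniteMeasure_bdry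
  obtain ⟨CV, hCV⟩ := hP.exists_lipschitzOn hV
  -- Green's formula is applied to the `k`-th partial derivative of `w` in direction `e k` with the
  -- Lipschitz test function `c V`. Summation over `k` produces the divergence term and `c ∇w · ∇V`.
  obtain ⟨C', hψ⟩ := lipschitzOn_mul hP.isCompact hc hCV
  let e : Fin d → E d := fun k => EuclideanSpace.single k 1
  let wk : Fin d → E d → ℝ := fun k => (H2.gradH1 k w).1.1
  have hwk : ∀ k, MemLp (wk k) 2 (volume.restrict K) := fun k => hK.memLp _
  have hH : ∀ k, MemLp (fun x => (inner ℝ (H2.hess w k x) (e k) : ℝ)) 2 (volume.restrict K) :=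
    fun k => memLp_inner_const (hK.memLp _) _
  obtain ⟨hψ2, hψb, -⟩ := hP.memLp_of_lipschitzOn hψ
  obtain ⟨hc2, -, hc'⟩ := hP.memLp_of_lipschitzOn hc
  have hV1 : MemLp V ⊤ (volume.restrict K) := hP.memLp_volume hV.continuous ⊤
  have hVc := continuous_gradient hV
  have hV2 : ∀ k, MemLp (fun x => gradient V x k) ⊤ (volume.restrict K) := fun k =>
    hP.memLp_volume ((EuclideanSpace.proj (𝕜 := ℝ) k).continuous.comp hVc) ⊤
  have iA : ∀ k, Integrable (fun x => inner ℝ (H2.hess w k x) (e k) * (c x * V x))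
      (volume.restrict K) := fun k =>
    memLp_one_iff_integrable.1 (MemLp.smul (p := 2) (q := 2) hψ2 (hH k))
  have iC : ∀ k, Integrable (fun x => wk k x * (fderiv ℝ c x (e k) * V x))
      (volume.restrict K) := fun k =>
    memLp_one_iff_integrable.1 (MemLp.smul (p := 2) (q := 2)
      (MemLp.smul (p := 2) (q := ⊤) hV1 (hc' (e k))) (hwk k))
  have iD : ∀ k, Integrable (fun x => wk k x * (c x * gradient V x k)) (volume.restrict K) :=
    fun k => memLp_one_iff_integrable.1 (MemLp.smul (p := 2) (q := 2)
      (MemLp.smul (p := 2) (q := ⊤) (hV2 k) hc2) (hwk k))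
  have iAC : ∀ k, Integrable (fun x => inner ℝ (H2.hess w k x) (e k) * (c x * V x)
      + wk k x * (fderiv ℝ c x (e k) * V x)) (volume.restrict K) := fun k => (iA k).add (iC k)
  have hwae : ∀ᵐ x ∂(volume.restrict K), ∀ k, wk k x = H2.grad w x k := ae_all_iff.2 fun k =>
    (Measure.absolutelyContinuous_of_le hK.restrict_le).ae_eq (H2.gradH1_fst k w)
  have e1 : (fun x => H2.divCoeffGrad c w x * V x) =ᵐ[volume.restrict K] fun x =>
      ∑ k, (inner ℝ (H2.hess w k x) (e k) * (c x * V x)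
        + wk k x * (fderiv ℝ c x (e k) * V x)) := by
    filter_upwards [hwae] with x hx
    rw [H2.divCoeffGrad, H2.laplacian, inner_eq_sum, Finset.mul_sum, ← Finset.sum_add_distrib,
      Finset.sum_mul]
    refine Finset.sum_congr rfl fun k _ => ?_
    rw [hx, fderiv_eq_inner_gradient]
    simp only [e, inner_single_eq]
    ring
  have e2 : (fun x => c x * inner ℝ (H2.grad w x) (gradient V x)) =ᵐ[volume.restrict K] fun x =>
      ∑ k, wk k x * (c x * gradient V x k) := by
    filter_upwards [hwae] with x hx
    rw [inner_eq_sum, Finset.mul_sum]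
    refine Finset.sum_congr rfl fun k _ => ?_
    rw [hx]
    ring
  refine ⟨(integrable_finsetSum _ fun k _ => iAC k).congr e1.symm,
    (integrable_finsetSum _ fun k _ => iD k).congr e2.symm, ?_⟩
  have green : ∀ k, (∫ x in K, inner ℝ (H2.hess w k x) (e k) * (c x * V x)
        + wk k x * (fderiv ℝ c x (e k) * V x)) + ∫ x in K, wk k x * (c x * gradient V x k)
      = ∫ x, traceL hK (H2.gradH1 k w) x * (c x * outwardNormal K x k * V x) ∂(bdry K) := by
    intro k
    have h := hP.green hK.one_le (hK.isTrace_trace (H2.gradH1 k w)) (hK.memLp _)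
      (hK.isWeakGrad (H2.gradH1 k w).2) hψ (e k)
    rw [← integral_add (iAC k) (iD k)]
    refine Eq.trans (integral_congr_ae ?_) (h.trans (integral_congr_ae ?_))
    · filter_upwards [hP.ae_differentiableAt hc] with x hx
      have hm : fderiv ℝ (fun y => c y * V y) x (e k)
          = c x * gradient V x k + V x * fderiv ℝ c x (e k) := by
        rw [fderiv_fun_mul hx (hV.differentiable one_ne_zero x)]
        simp only [_root_.add_apply, _root_.smul_apply, smul_eq_mul]
        rw [fderiv_eq_inner_gradient V, inner_single_eq]
      rw [hm, H2.gradH1_snd]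
      ring
    · filter_upwards [coeFn_traceL hK (H2.gradH1 k w)] with x hx
      rw [hx, inner_single_eq]
      ring
  have iF : ∀ k, Integrable
      (fun x => traceL hK (H2.gradH1 k w) x * (c x * outwardNormal K x k * V x)) (bdry K) := by
    intro k
    have h1 := memLp_one_iff_integrable.1 (MemLp.smul (p := 2) (q := 2)
      (hP.memLp_mul_normal hψb (e k)) (Lp.memLp (traceL hK (H2.gradH1 k w))))
    refine h1.congr (Eventually.of_forall fun x => ?_)
    simp only [Pi.smul_apply', smul_eq_mul, e, inner_single_eq]
    ring
  rw [integral_congr_ae e1, integral_congr_ae e2, integral_congr_ae (hK.fluxDensity_ae_eq c w hV),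
    integral_finsetSum _ fun k _ => iAC k, integral_finsetSum _ fun k _ => iD k,
    integral_finsetSum _ fun k _ => iF k, ← Finset.sum_add_distrib]
  exact Finset.sum_congr rfl fun k _ => green k

end Flux

/-! ### Integrals over an element as functions of time -/

section ElementIntegrals

variable {d : ℕ} {K Ω : Set (E d)} {c : E d → ℝ} {V : ℝ → E d → ℝ}

lemma IsPolytope.memLp_top_of_lipschitzOn (hK : IsPolytope K) {C : NNReal}
    (hc : LipschitzOnWith C c K) :
    MemLp c ⊤ (volume.restrict K) ∧ MemLp c ⊤ (bdry K) := by
  obtain ⟨g, h1, h2, -⟩ := exists_extension_of_lipschitzOn hc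
  refine ⟨(hK.memLp_volume h1.continuous ⊤).ae_eq ?_, (hK.memLp_bdry h1.continuous ⊤).ae_eq ?_⟩
  · filter_upwards [ae_restrict_mem hK.isClosed.measurableSet] with x hx using (h2 hx).symm
  · filter_upwards [ae_restrict_mem isClosed_frontier.measurableSet] with x hx
    exact (h2 (hK.isClosed.frontier_subset hx)).symm

lemma isFiniteMeasure_of_isCompact_closure (hΩ : IsCompact (closure Ω)) :
    IsFiniteMeasure ((volume : Measure (E d)).restrict Ω) :=
  ⟨by
    rw [Measure.restrict_apply_univ]
    exact (measure_mono subset_closure).trans_lt hΩ.measure_lt_top⟩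

lemma ae_mem_closure (hΩ : IsOpen Ω) :
    ∀ᵐ x ∂((volume : Measure (E d)).restrict Ω), x ∈ closure Ω := by
  filter_upwards [ae_restrict_mem hΩ.measurableSet] with x hx using subset_closure hx

lemma IsCell.memLp_indicator (hK : IsCell Ω K) (hc : MemLp c ⊤ (volume.restrict K)) :
    MemLp (K.indicator c) ⊤ (volume.restrict Ω) := by
  rw [memLp_indicator_iff_restrict hK.polytope.isClosed.measurableSet]
  refine hc.mono_measure ?_
  rw [Measure.restrict_restrict hK.polytope.isClosed.measurableSet]
  exact Measure.restrict_mono inter_subset_left le_rfl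

/-- Moves an integral over the element to `Ω` with a cut-off coefficient, so that the solution
remains a curve in the single space `L²(Ω)`. -/
lemma IsCell.integral_indicator_mul (hK : IsCell Ω K) (f g h : E d → ℝ) :
    ∫ x in Ω, f x * (K.indicator g x * h x) = ∫ x in K, f x * (g x * h x) := by
  have hm := hK.polytope.isClosed.measurableSet
  have e : (fun x => f x * (K.indicator g x * h x))
      = K.indicator fun x => f x * (g x * h x) := by
    funext x; by_cases hx : x ∈ K <;> simp [hx]
  rw [e, integral_indicator hm, Measure.restrict_restrict hm]
  refine setIntegral_congr_set ?_
  refine Filter.EventuallyLE.antisymm inter_subset_left.eventuallyLE (ae_le_set.2 ?_)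
  refine measure_mono_null ?_ (volume_diff_interior hK.polytope)
  rintro x ⟨h1, h2⟩
  exact ⟨h1, fun hi => h2 ⟨h1, hK.interior_subset hi⟩⟩

lemma IsCell.continuousOn_integral (hK : IsCell Ω K) (hΩ : IsCompact (closure Ω))
    (hc : MemLp c ⊤ (volume.restrict K)) (hV : Continuous (Function.uncurry V))
    {F : ℝ → L2 Ω ℝ} {s : Set ℝ} (hF : ContinuousOn F s) :
    ContinuousOn (fun t => ∫ x in K, F t x * (c x * V t x)) s := by
  have := isFiniteMeasure_of_isCompact_closure hΩ
  simp only [← hK.integral_indicator_mul]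
  exact continuousOn_integral_mul hΩ (ae_mem_closure hK.isOpen) (hK.memLp_indicator hc) hV hF

lemma IsCell.integrableOn_integral (hK : IsCell Ω K) (hΩ : IsCompact (closure Ω))
    (hc : MemLp c ⊤ (volume.restrict K)) (hV : Continuous (Function.uncurry V))
    {F : ℝ → L2 Ω ℝ} {a b : ℝ} (hF : IntegrableOn F (Ioc a b)) :
    IntegrableOn (fun t => ∫ x in K, F t x * (c x * V t x)) (Ioc a b) := by
  have := isFiniteMeasure_of_isCompact_closure hΩ
  simp only [← hK.integral_indicator_mul]
  exact integrableOn_integral_mul hΩ (ae_mem_closure hK.isOpen) (hK.memLp_indicator hc) hV hF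

lemma IsCell.integrable_mul (hK : IsCell Ω K) (hc : MemLp c ⊤ (volume.restrict K))
    {φ : E d → ℝ} (hφ : Continuous φ) (f : L2 Ω ℝ) :
    Integrable (fun x => f x * (c x * φ x)) (volume.restrict K) :=
  memLp_one_iff_integrable.1 (MemLp.smul (p := 2) (q := 2)
    (MemLp.smul (p := ⊤) (q := 2) (hK.polytope.memLp_volume hφ 2) hc) (hK.memLp f))

/-- Integration by parts in time on an element. -/
lemma IsCell.integral_by_parts (hK : IsCell Ω K) (hΩ : IsCompact (closure Ω))
    (hV : ContDiff ℝ 2 (Function.uncurry V)) {a b : ℝ} (hab : a ≤ b) {w α : ℝ → L2 Ω ℝ}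
    (hα : IntegrableOn α (Ioc a b)) (hw : ∀ t ∈ Icc a b, w t - w a = ∫ s in a..t, α s) :
    (∫ t in a..b, ∫ x in K, α t x * V t x)
      + ∫ t in a..b, ∫ x in K, w t x * deriv (fun s => V s x) t
      = (∫ x in K, w b x * V b x) - ∫ x in K, w a x * V a x := by
  have := isFiniteMeasure_of_isCompact_closure hΩ
  have hμ := ae_mem_closure hK.isOpen
  have hc : MemLp (K.indicator fun _ => (1:ℝ)) ⊤ (volume.restrict Ω) :=
    hK.memLp_indicator (hK.polytope.memLp_volume continuous_const ⊤)
  have hV' := continuous_deriv_piece hV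
  have h := integral_inner_by_parts hab hα hw
    (continuous_coeffMul hΩ hμ hc hV') (continuous_coeffMul hΩ hμ hc hV.continuous)
    (hasDerivAt_inner_coeffMul hΩ hμ hc hV.continuous hV' (hasDerivAt_piece hV))
  simp only [inner_coeffMul, hK.integral_indicator_mul, one_mul] at h
  exact h

lemma H2.continuousOn_fst_gradH1 {q : ℝ → H2 Ω} {s : Set ℝ} (hq : ContinuousOn q s) (k : Fin d) :
    ContinuousOn (fun t => (H2.gradH1 k (q t)).1.1) s :=
  continuous_fst.comp_continuousOn
    (continuous_subtype_val.comp_continuousOn ((H2.gradH1 k).continuous.comp_continuousOn hq))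

lemma H2.continuousOn_toL2 {q : ℝ → H2 Ω} {s : Set ℝ} (hq : ContinuousOn q s) :
    ContinuousOn (fun t => H2.toL2 (q t)) s :=
  continuous_fst.comp_continuousOn (continuous_subtype_val.comp_continuousOn hq)

lemma IsCell.continuousOn_integral_grad (hK : IsCell Ω K) (hΩ : IsCompact (closure Ω))
    (hc : MemLp c ⊤ (volume.restrict K)) (hV : ContDiff ℝ 2 (Function.uncurry V))
    {q : ℝ → H2 Ω} {s : Set ℝ} (hq : ContinuousOn q s) :
    ContinuousOn (fun t => ∫ x in K, c x * inner ℝ (H2.grad (q t) x) (gradient (V t) x)) s := by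
  have e : ∀ t, ∫ x in K, c x * inner ℝ (H2.grad (q t) x) (gradient (V t) x)
      = ∑ k, ∫ x in K, (H2.gradH1 k (q t)).1.1 x * (c x * gradient (V t) x k) := by
    intro t
    have hcont : ∀ k, Continuous fun x => gradient (V t) x k := fun k =>
      (EuclideanSpace.proj (𝕜 := ℝ) k).continuous.comp (continuous_gradient (contDiff_slice hV t))
    rw [← integral_finsetSum _ fun k _ => hK.integrable_mul hc (hcont k) _]
    refine integral_congr_ae ?_
    have hwae : ∀ᵐ x ∂(volume.restrict K), ∀ k, (H2.gradH1 k (q t)).1.1 x = H2.grad (q t) x k :=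
      ae_all_iff.2 fun k => (Measure.absolutelyContinuous_of_le hK.restrict_le).ae_eq
        (H2.gradH1_fst k (q t))
    filter_upwards [hwae] with x hx
    rw [inner_eq_sum, Finset.mul_sum]
    refine Finset.sum_congr rfl fun k _ => ?_
    rw [hx]; ring
  simp only [e]
  exact continuousOn_finsetSum _ fun k _ => hK.continuousOn_integral hΩ hc
    (continuous_gradient_piece hV k) (H2.continuousOn_fst_gradH1 hq k)

lemma IsPolytope.ae_mem_bdry (hK : IsPolytope K) : ∀ᵐ x ∂(bdry K), x ∈ K := by
  filter_upwards [ae_restrict_mem isClosed_frontier.measurableSet] with x hx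
  exact hK.isClosed.frontier_subset hx

lemma integral_frontier_inter (f : E d → ℝ) {S : Set (E d)} (hS : MeasurableSet S) :
    ∫ x in frontier K ∩ S, f x ∂(surf d) = ∫ x, S.indicator f x ∂(bdry K) := by
  rw [integral_indicator hS, Measure.restrict_restrict hS, inter_comm]

lemma IsPolytope.memLp_coeff_normal (hK : IsPolytope K) (hc : MemLp c ⊤ (bdry K)) (k : Fin d)
    {S : Set (E d)} (hS : MeasurableSet S) :
    MemLp (S.indicator fun x => c x * outwardNormal K x k) ⊤ (bdry K) := by
  refine MemLp.indicator hS ?_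
  have hn : AEStronglyMeasurable (fun x => outwardNormal K x k) (bdry K) :=
    (EuclideanSpace.proj (𝕜 := ℝ) k).continuous.comp_aestronglyMeasurable
      hK.aestronglyMeasurable_outwardNormal
  refine hc.norm.mono' (hc.1.mul hn) (Eventually.of_forall fun x => ?_)
  rw [norm_mul]
  refine mul_le_of_le_one_right (norm_nonneg _) ?_
  exact (PiLp.norm_apply_le _ k).trans (norm_outwardNormal_le K x)

lemma IsCell.integrable_traceL_mul (hK : IsCell Ω K) (hc : MemLp c ⊤ (bdry K))
    {φ : E d → ℝ} (hφ : Continuous φ) (f : Lp ℝ 2 (bdry K)) :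
    Integrable (fun x => f x * (c x * φ x)) (bdry K) :=
  memLp_one_iff_integrable.1 (MemLp.smul (p := 2) (q := 2)
    (MemLp.smul (p := ⊤) (q := 2) (hK.polytope.memLp_bdry hφ 2) hc) (Lp.memLp f))

lemma IsCell.integrable_fluxDensity (hK : IsCell Ω K) (hc : MemLp c ⊤ (bdry K)) (w : H2 Ω)
    {φ : E d → ℝ} (hφ : ContDiff ℝ 1 φ) : Integrable (fluxDensity K c w φ) (bdry K) := by
  refine (integrable_finsetSum Finset.univ fun k _ => ?_).congr (hK.fluxDensity_ae_eq c w hφ).symm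
  have := hK.polytope.memLp_coeff_normal hc k MeasurableSet.univ
  rw [indicator_univ] at this
  exact hK.integrable_traceL_mul this hφ.continuous _

/-- Each component of the gradient trace is a continuous linear image of `q t`, so the flux integral
is a finite sum of continuous pairings. The set `S` selects a face or a part of the boundary through
an indicator in the coefficient. -/
lemma IsCell.continuousOn_flux (hK : IsCell Ω K) (hc : MemLp c ⊤ (bdry K))
    (hV : ContDiff ℝ 2 (Function.uncurry V)) {q : ℝ → H2 Ω} {s : Set ℝ} (hq : ContinuousOn q s)
    {S : Set (E d)} (hS : MeasurableSet S) :
    ContinuousOn (fun t => ∫ x in frontier K ∩ S, fluxDensity K c (q t) (V t) x ∂(surf d)) s := by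
  have := hK.polytope.isFiniteMeasure_bdry
  have e : ∀ t, ∫ x in frontier K ∩ S, fluxDensity K c (q t) (V t) x ∂(surf d)
      = ∑ k, ∫ x, traceL hK (H2.gradH1 k (q t)) x
          * (S.indicator (fun x => c x * outwardNormal K x k) x * V t x) ∂(bdry K) := by
    intro t
    rw [integral_frontier_inter _ hS, ← integral_finsetSum _ fun k _ => hK.integrable_traceL_mul
      (hK.polytope.memLp_coeff_normal hc k hS) (contDiff_slice hV t).continuous _]
    refine integral_congr_ae ?_
    filter_upwards [hK.fluxDensity_ae_eq c (q t) (contDiff_slice hV t)] with x hx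
    by_cases hxS : x ∈ S
    · simp only [indicator_of_mem hxS, hx]
    · simp [indicator_of_notMem hxS]
  simp only [e]
  exact continuousOn_finsetSum _ fun k _ => continuousOn_integral_mul hK.polytope.isCompact
    hK.polytope.ae_mem_bdry (hK.polytope.memLp_coeff_normal hc k hS) hV.continuous
    ((traceL hK).continuous.comp_continuousOn ((H2.gradH1 k).continuous.comp_continuousOn hq))

/-- The coefficient is bounded only on `S`; extended by zero it is bounded on the whole boundary of
the element, and the trace pairing applies. -/
lemma IsCell.robin (hK : IsCell Ω K) {S : Set (E d)} (hS : MeasurableSet S)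
    (hc : MemLp c ⊤ ((bdry K).restrict S)) (hV : ContDiff ℝ 2 (Function.uncurry V))
    {q : ℝ → H2 Ω} {s : Set ℝ} (hq : ContinuousOn q s) :
    (∀ t, IntegrableOn (fun x => c x * trace K (H2.toL2 (q t)) x * trace K (V t) x)
      (frontier K ∩ S) (surf d)) ∧
    ContinuousOn (fun t => ∫ x in frontier K ∩ S,
      c x * trace K (H2.toL2 (q t)) x * trace K (V t) x ∂(surf d)) s := by
  have := hK.polytope.isFiniteMeasure_bdry
  have hc' : MemLp (S.indicator c) ⊤ (bdry K) := (memLp_indicator_iff_restrict hS).2 hc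
  have e : ∀ t, S.indicator (fun x => c x * trace K (H2.toL2 (q t)) x * trace K (V t) x)
      =ᵐ[bdry K] fun x => traceL hK (H2.toH1 (q t)) x * (S.indicator c x * V t x) := by
    intro t
    filter_upwards [coeFn_traceL hK (H2.toH1 (q t)),
      hK.polytope.trace_of_contDiff hK.one_le (contDiff_slice hV t)] with x h1 h2
    rw [h1, H2.toH1_fst]
    by_cases hxS : x ∈ S
    · simp only [indicator_of_mem hxS, h2]; ring
    · simp [indicator_of_notMem hxS]
  constructor
  · intro t
    rw [IntegrableOn, inter_comm, ← Measure.restrict_restrict hS]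
    change IntegrableOn _ S (bdry K)
    rw [← integrable_indicator_iff hS]
    exact (hK.integrable_traceL_mul hc' (contDiff_slice hV t).continuous _).congr (e t).symm
  · have e2 : ∀ t, ∫ x in frontier K ∩ S,
        c x * trace K (H2.toL2 (q t)) x * trace K (V t) x ∂(surf d)
        = ∫ x, traceL hK (H2.toH1 (q t)) x * (S.indicator c x * V t x) ∂(bdry K) := fun t => by
      rw [integral_frontier_inter _ hS]; exact integral_congr_ae (e t)
    simp only [e2]
    exact continuousOn_integral_mul hK.polytope.isCompact
      hK.polytope.ae_mem_bdry hc' hV.continuous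
      ((traceL hK).continuous.comp_continuousOn (H2.toH1.continuous.comp_continuousOn hq))

end ElementIntegrals

/-! ### The equation on a slab -/

section Slabs

variable {d Nt Ns : ℕ} {P : Problem d} {u : ℝ → H2 P.Ω} {a b : ℝ}

lemma continuousOn_timeDeriv (hu : ContDiffOn ℝ 1 u (Icc 0 P.T)) :
    ContinuousOn (timeDeriv P u) (Icc 0 P.T) :=
  hu.continuousOn_derivWithin (uniqueDiffOn_Icc P.T_pos) le_rfl

lemma ae_restrict_Ioc_of_Ioo {T : ℝ} (ha : 0 ≤ a) (hb : b ≤ T) {p : ℝ → Prop}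
    (h : ∀ᵐ t ∂(volume.restrict (Ioo 0 T)), p t) : ∀ᵐ t ∂(volume.restrict (Ioc a b)), p t := by
  rw [Measure.restrict_congr_set Ioo_ae_eq_Ioc] at h
  exact ae_mono (Measure.restrict_mono (Ioc_subset_Ioc ha hb) le_rfl) h

lemma interval_integral_congr (hab : a ≤ b) {f g : ℝ → ℝ}
    (h : ∀ᵐ t ∂(volume.restrict (Ioc a b)), f t = g t) : ∫ t in a..b, f t = ∫ t in a..b, g t := by
  rw [intervalIntegral.integral_of_le hab, intervalIntegral.integral_of_le hab]
  exact integral_congr_ae h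

lemma intervalIntegrable_of_continuousOn_Icc {T : ℝ} (ha : 0 ≤ a) (hab : a ≤ b) (hb : b ≤ T)
    {f : ℝ → ℝ} (hf : ContinuousOn f (Icc 0 T)) : IntervalIntegrable f volume a b :=
  (hf.mono (by rw [uIcc_of_le hab]; exact Icc_subset_Icc ha hb)).intervalIntegrable

namespace Mesh

variable (𝓜 : Mesh P Nt Ns)

lemma lipschitzOn_η (j : Fin Ns) : ∃ C, LipschitzOnWith C P.η (𝓜.elem j) :=
  P.η_lip.imp fun _ h => h.mono (𝓜.elem_subset j)

lemma lipschitzOn_ξ_sq (j : Fin Ns) : ∃ C, LipschitzOnWith C (fun x => P.ξ x ^ 2) (𝓜.elem j) := by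
  obtain ⟨C, h⟩ := P.ξ_lip
  obtain ⟨C', h'⟩ := lipschitzOn_mul (𝓜.isPolytope j).isCompact (h.mono (𝓜.elem_subset j))
    (h.mono (𝓜.elem_subset j))
  exact ⟨C', by simpa only [sq] using h'⟩

/-- The equation tested with a smooth function on a space-time element. -/
lemma element_equation (hd : 1 ≤ d) (hu : ContDiffOn ℝ 1 u (Icc 0 P.T)) (hsol : IsSolution P u)
    (ha : 0 ≤ a) (hab : a ≤ b) (hb : b ≤ P.T) (j : Fin Ns) {V : ℝ → E d → ℝ}
    (hV : ContDiff ℝ 2 (Function.uncurry V)) :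
    -(∫ t in a..b, ∫ x in 𝓜.elem j, H2.toL2 (timeDeriv P u t) x * deriv (fun s => V s x) t)
      + (∫ t in a..b, ∫ x in 𝓜.elem j, P.γ x * H2.toL2 (timeDeriv P u t) x * V t x)
      + (∫ t in a..b, ∫ x in 𝓜.elem j,
          P.η x * inner ℝ (H2.grad (timeDeriv P u t) x) (gradient (V t) x))
      + (∫ t in a..b, ∫ x in 𝓜.elem j, P.ξ x ^ 2 * inner ℝ (H2.grad (u t) x) (gradient (V t) x))
      + ((∫ x in 𝓜.elem j, H2.toL2 (timeDeriv P u b) x * V b x)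
          - ∫ x in 𝓜.elem j, H2.toL2 (timeDeriv P u a) x * V a x)
      - (∫ t in a..b, ∫ x, fluxDensity (𝓜.elem j) P.η (timeDeriv P u t) (V t) x
          ∂(bdry (𝓜.elem j)))
      - (∫ t in a..b, ∫ x, fluxDensity (𝓜.elem j) (fun y => P.ξ y ^ 2) (u t) (V t) x
          ∂(bdry (𝓜.elem j)))
      = ∫ t in a..b, ∫ x in 𝓜.elem j, P.f t x * V t x := by
  obtain ⟨utt, hutt, hweak, heq⟩ := hsol.equation
  have hK := 𝓜.isCell hd j
  have hΩ := 𝓜.isCompact_closure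
  obtain ⟨Cη, hη⟩ := 𝓜.lipschitzOn_η j
  obtain ⟨Cξ, hξ⟩ := 𝓜.lipschitzOn_ξ_sq j
  have hη' := hK.polytope.memLp_top_of_lipschitzOn hη
  have hξ' := hK.polytope.memLp_top_of_lipschitzOn hξ
  have hW := continuousOn_timeDeriv hu
  have hγ : MemLp P.γ ⊤ (volume.restrict (𝓜.elem j)) := P.γ_bdd.mono_measure hK.restrict_le
  have h1 : MemLp (fun _ : E d => (1:ℝ)) ⊤ (volume.restrict (𝓜.elem j)) :=
    hK.polytope.memLp_volume continuous_const ⊤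
  have huttI : IntegrableOn utt (Ioc a b) :=
    by
    have h := hutt
    rw [← integrableOn_Ioc_iff_integrableOn_Ioo] at h
    exact h.mono_set (Ioc_subset_Ioc ha hb)
  have hWprim : ∀ t ∈ Icc a b, H2.toL2 (timeDeriv P u t) - H2.toL2 (timeDeriv P u a)
      = ∫ s in a..t, utt s := fun t ht =>
    sub_eq_integral_of_weak_deriv (H2.continuousOn_toL2 hW) hutt hweak
      ⟨ha, hab.trans hb⟩ ⟨ha.trans ht.1, ht.2.trans hb⟩
  -- The only term integrated by parts in time: it exchanges the weak second derivative for the end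
  -- values of the slab and the product of first derivatives.
  have hparts := hK.integral_by_parts hΩ hV hab huttI hWprim
  have cγ : ContinuousOn (fun t => ∫ x in 𝓜.elem j, P.γ x * H2.toL2 (timeDeriv P u t) x * V t x)
      (Icc 0 P.T) := by
    refine (hK.continuousOn_integral hΩ hγ hV.continuous (H2.continuousOn_toL2 hW)).congr
      fun t _ => ?_
    refine integral_congr_ae (Eventually.of_forall fun x => ?_)
    simp only; ring
  have cη := hK.continuousOn_integral_grad hΩ hη'.1 hV hW
  have cξ := hK.continuousOn_integral_grad hΩ hξ'.1 hV hu.continuousOn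
  have fη := hK.continuousOn_flux hη'.2 hV hW MeasurableSet.univ
  have fξ := hK.continuousOn_flux hξ'.2 hV hu.continuousOn MeasurableSet.univ
  simp only [inter_univ] at fη fξ
  have iA : IntegrableOn (fun t => ∫ x in 𝓜.elem j, utt t x * V t x) (Ioc a b) := by
    simpa only [one_mul] using hK.integrableOn_integral hΩ h1 hV.continuous huttI
  have iA' := (intervalIntegrable_iff_integrableOn_Ioc_of_le hab).2 iA
  have ii : ∀ {f : ℝ → ℝ}, ContinuousOn f (Icc 0 P.T) → IntervalIntegrable f volume a b :=
    fun hf => intervalIntegrable_of_continuousOn_Icc ha hab hb hf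
  -- Nothing is assumed about the integrability of `P.f`. The equation replaces its integral at
  -- almost every time by terms that are each known to be integrable in time.
  have hf : ∫ t in a..b, ∫ x in 𝓜.elem j, P.f t x * V t x
      = ∫ t in a..b, ((∫ x in 𝓜.elem j, utt t x * V t x)
        + (∫ x in 𝓜.elem j, P.γ x * H2.toL2 (timeDeriv P u t) x * V t x)
        + (∫ x in 𝓜.elem j, P.η x * inner ℝ (H2.grad (timeDeriv P u t) x) (gradient (V t) x))
        + (∫ x in 𝓜.elem j, P.ξ x ^ 2 * inner ℝ (H2.grad (u t) x) (gradient (V t) x))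
        - (∫ x, fluxDensity (𝓜.elem j) P.η (timeDeriv P u t) (V t) x ∂(bdry (𝓜.elem j)))
        - (∫ x, fluxDensity (𝓜.elem j) (fun y => P.ξ y ^ 2) (u t) (V t) x
            ∂(bdry (𝓜.elem j)))) := by
    refine interval_integral_congr hab ?_
    filter_upwards [ae_restrict_Ioc_of_Ioo ha hb heq] with t ht
    have hVt := contDiff_slice hV t
    obtain ⟨g1, -, g3⟩ := hK.green_flux hη (timeDeriv P u t) hVt
    obtain ⟨k1, -, k3⟩ := hK.green_flux hξ (u t) hVt
    have i1 : Integrable (fun x => utt t x * V t x) (volume.restrict (𝓜.elem j)) := by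
      simpa only [one_mul] using hK.integrable_mul h1 hVt.continuous (utt t)
    have i2 : Integrable (fun x => P.γ x * H2.toL2 (timeDeriv P u t) x * V t x)
        (volume.restrict (𝓜.elem j)) := by
      refine (hK.integrable_mul hγ hVt.continuous (H2.toL2 (timeDeriv P u t))).congr
        (Eventually.of_forall fun x => ?_)
      simp only; ring
    have e : ∫ x in 𝓜.elem j, P.f t x * V t x = ∫ x in 𝓜.elem j, (utt t x * V t x
        + P.γ x * H2.toL2 (timeDeriv P u t) x * V t x
        - H2.divCoeffGrad P.η (timeDeriv P u t) x * V t x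
        - H2.divCoeffGrad (fun y => P.ξ y ^ 2) (u t) x * V t x) := by
      refine integral_congr_ae ?_
      filter_upwards [(Measure.absolutelyContinuous_of_le hK.restrict_le) ht] with x hx
      rw [← hx]; ring
    have i12 : Integrable (fun x => utt t x * V t x
        + P.γ x * H2.toL2 (timeDeriv P u t) x * V t x) (volume.restrict (𝓜.elem j)) := i1.add i2
    have i123 : Integrable (fun x => utt t x * V t x
        + P.γ x * H2.toL2 (timeDeriv P u t) x * V t x
        - H2.divCoeffGrad P.η (timeDeriv P u t) x * V t x) (volume.restrict (𝓜.elem j)) :=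
      i12.sub g1
    rw [e, integral_sub i123 k1, integral_sub i12 g1, integral_add i1 i2, ← g3, ← k3]
    ring
  rw [hf, intervalIntegral.integral_sub
      ((((iA'.add (ii cγ)).add (ii cη)).add (ii cξ)).sub (ii fη)) (ii fξ),
    intervalIntegral.integral_sub (((iA'.add (ii cγ)).add (ii cη)).add (ii cξ)) (ii fη),
    intervalIntegral.integral_add ((iA'.add (ii cγ)).add (ii cη)) (ii cξ),
    intervalIntegral.integral_add (iA'.add (ii cγ)) (ii cη),
    intervalIntegral.integral_add iA' (ii cγ), ← hparts]
  ring

/-- Ordered pairs come from the element boundaries, unordered pairs from the faces; every unordered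
pair collects its two orders. -/
lemma sum_erase_eq_sum_Ioi {n : ℕ} (Φ : Fin n → Fin n → ℝ) :
    ∑ j, ∑ k ∈ Finset.univ.erase j, Φ j k = ∑ j, ∑ k ∈ Finset.Ioi j, (Φ j k + Φ k j) := by
  have h1 : ∀ j, ∑ k ∈ Finset.univ.erase j, Φ j k
      = ∑ k ∈ Finset.Ioi j, Φ j k + ∑ k ∈ Finset.Iio j, Φ j k := by
    intro j
    rw [← Finset.sum_union]
    · congr 1
      ext k
      simp only [Finset.mem_erase, Finset.mem_univ, and_true, Finset.mem_union, Finset.mem_Ioi,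
        Finset.mem_Iio]
      exact ⟨fun h => (lt_or_gt_of_ne h).symm, fun h => h.elim ne_of_gt ne_of_lt⟩
    · rw [Finset.disjoint_left]
      intro k h1 h2
      exact lt_asymm (Finset.mem_Ioi.1 h1) (Finset.mem_Iio.1 h2)
  simp only [h1, Finset.sum_add_distrib]
  congr 1
  exact Finset.sum_comm' (by simp)

/-- The gradient trace is the same from both sides, so the average equals either trace and the jump
of `V` splits into its two one-sided parts. -/
lemma jump_avg_eq_flux (hd : 1 ≤ d) (c : E d → ℝ) (w : H2 P.Ω) (V : Fin Ns → E d → ℝ)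
    {j k : Fin Ns} (hjk : j ≠ k) : ∀ᵐ x ∂((surf d).restrict (𝓜.elem j ∩ 𝓜.elem k)),
      c x * inner ℝ (𝓜.jump V j k x) (𝓜.avg (fun _ => H2.grad w) j k x)
        = fluxDensity (𝓜.elem j) c w (V j) x + fluxDensity (𝓜.elem k) c w (V k) x := by
  have h : ∀ᵐ x ∂((surf d).restrict (𝓜.elem j ∩ 𝓜.elem k)), ∀ m,
      trace (𝓜.elem j) (H2.gradH1 m w).1.1 x = trace (𝓜.elem k) (H2.gradH1 m w).1.1 x :=
    ae_all_iff.2 fun m => 𝓜.trace_ae_eq hd _ hjk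
  filter_upwards [h] with x hx
  have hv : traceVec (𝓜.elem k) (H2.grad w) x = traceVec (𝓜.elem j) (H2.grad w) x := by
    ext m
    rw [(𝓜.isCell hd k).traceVec_grad, (𝓜.isCell hd j).traceVec_grad, hx]
  have ha : 𝓜.avg (fun _ => H2.grad w) j k x = traceVec (𝓜.elem j) (H2.grad w) x := by
    rw [avg, hv, ← two_smul ℝ, smul_smul]
    norm_num
  rw [ha, jump, fluxDensity, fluxDensity, hv, inner_add_left]
  ring

lemma inter_eq_frontier_inter {j k : Fin Ns} (hjk : j ≠ k) :
    𝓜.elem j ∩ 𝓜.elem k = frontier (𝓜.elem j) ∩ 𝓜.elem k := by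
  ext x
  exact ⟨fun h => ⟨mem_frontier_of_mem_inter hjk h.1 h.2, h.2⟩,
    fun h => ⟨(𝓜.isClosed_elem j).frontier_subset h.1, h.2⟩⟩

/-- The element boundary fluxes sum up to the face integrals of jumps times averages. -/
lemma sum_flux_eq (hd : 1 ≤ d) {c : E d → ℝ} (hc : ∀ j, ∃ C, LipschitzOnWith C c (𝓜.elem j))
    {q : ℝ → H2 P.Ω} (hq : ContinuousOn q (Icc 0 P.T)) {V : Fin Ns → ℝ → E d → ℝ}
    (hV : ∀ j, ContDiff ℝ 2 (Function.uncurry (V j))) (ha : 0 ≤ a) (hab : a ≤ b) (hb : b ≤ P.T) :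
    ∑ j, ∫ t in a..b, ∫ x, fluxDensity (𝓜.elem j) c (q t) (V j t) x ∂(bdry (𝓜.elem j))
      = (∑ j, ∑ k ∈ Finset.Ioi j, ∫ t in a..b, ∫ x in 𝓜.elem j ∩ 𝓜.elem k,
          c x * inner ℝ (𝓜.jump (fun l => V l t) j k x)
            (𝓜.avg (fun _ => H2.grad (q t)) j k x) ∂(surf d))
        + ∑ j, ∫ t in a..b, ∫ x in frontier (𝓜.elem j) ∩ frontier P.Ω,
            fluxDensity (𝓜.elem j) c (q t) (V j t) x ∂(surf d) := by
  have hcb : ∀ j, MemLp c ⊤ (bdry (𝓜.elem j)) := fun j =>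
    ((𝓜.isPolytope j).memLp_top_of_lipschitzOn (hc j).choose_spec).2
  have hi : ∀ j t, Integrable (fluxDensity (𝓜.elem j) c (q t) (V j t)) (bdry (𝓜.elem j)) :=
    fun j t => (𝓜.isCell hd j).integrable_fluxDensity (hcb j) _ (contDiff_slice (hV j) t)
  have ii : ∀ j {S : Set (E d)}, MeasurableSet S → IntervalIntegrable (fun t =>
      ∫ x in frontier (𝓜.elem j) ∩ S, fluxDensity (𝓜.elem j) c (q t) (V j t) x ∂(surf d))
      volume a b := fun j S hS => intervalIntegrable_of_continuousOn_Icc ha hab hb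
    ((𝓜.isCell hd j).continuousOn_flux (hcb j) (hV j) hq hS)
  have ii' : ∀ j k, j ≠ k → IntervalIntegrable (fun t =>
      ∫ x in 𝓜.elem j ∩ 𝓜.elem k, fluxDensity (𝓜.elem j) c (q t) (V j t) x ∂(surf d))
      volume a b := fun j k hjk => by
    rw [𝓜.inter_eq_frontier_inter hjk]
    exact ii j (𝓜.isClosed_elem k).measurableSet
  have step : ∀ j, ∫ t in a..b, ∫ x, fluxDensity (𝓜.elem j) c (q t) (V j t) x ∂(bdry (𝓜.elem j))
      = (∫ t in a..b, ∫ x in frontier (𝓜.elem j) ∩ frontier P.Ω,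
            fluxDensity (𝓜.elem j) c (q t) (V j t) x ∂(surf d))
        + ∑ k ∈ Finset.univ.erase j, ∫ t in a..b, ∫ x in 𝓜.elem j ∩ 𝓜.elem k,
            fluxDensity (𝓜.elem j) c (q t) (V j t) x ∂(surf d) := by
    intro j
    simp only [𝓜.integral_bdry j (hi j _)]
    have hne : ∀ k ∈ Finset.univ.erase j, j ≠ k := fun k hk => (Finset.ne_of_mem_erase hk).symm
    have hs : IntervalIntegrable (fun t => ∑ k ∈ Finset.univ.erase j,
        ∫ x in 𝓜.elem j ∩ 𝓜.elem k, fluxDensity (𝓜.elem j) c (q t) (V j t) x ∂(surf d))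
        volume a b := by
      have := IntervalIntegrable.sum (Finset.univ.erase j) fun k hk => ii' j k (hne k hk)
      simpa only [Finset.sum_fn] using this
    rw [intervalIntegral.integral_add (ii j isClosed_frontier.measurableSet) hs,
      intervalIntegral.integral_finsetSum fun k hk => ii' j k (hne k hk)]
  simp only [step, Finset.sum_add_distrib]
  -- Every interior face occurs twice in the sum over element boundaries, once from each side.
  rw [add_comm, sum_erase_eq_sum_Ioi]
  congr 1
  refine Finset.sum_congr rfl fun j _ => Finset.sum_congr rfl fun k hk => ?_
  have hjk : j ≠ k := (Finset.mem_Ioi.1 hk).ne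
  rw [inter_comm (𝓜.elem k)]
  have ikj := ii' k j hjk.symm
  rw [inter_comm] at ikj
  rw [← intervalIntegral.integral_add (ii' j k hjk) ikj]
  refine intervalIntegral.integral_congr fun t _ => ?_
  have m1 : Integrable (fluxDensity (𝓜.elem j) c (q t) (V j t))
      ((surf d).restrict (𝓜.elem j ∩ 𝓜.elem k)) := by
    rw [𝓜.inter_eq_frontier_inter hjk]
    exact IntegrableOn.mono_set (hi j t) inter_subset_left
  have m2 : Integrable (fluxDensity (𝓜.elem k) c (q t) (V k t))
      ((surf d).restrict (𝓜.elem j ∩ 𝓜.elem k)) := by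
    rw [inter_comm, 𝓜.inter_eq_frontier_inter hjk.symm]
    exact IntegrableOn.mono_set (hi k t) inter_subset_left
  rw [← integral_add m1 m2]
  exact integral_congr_ae ((𝓜.jump_avg_eq_flux hd c (q t) (fun l => V l t) hjk).mono
    fun x hx => hx.symm)

/-- The boundary flux splits into the parts on the three types of boundary faces. -/
lemma flux_boundary_parts (hd : 1 ≤ d) {c : E d → ℝ}
    (hc : ∀ j, ∃ C, LipschitzOnWith C c (𝓜.elem j))
    {q : ℝ → H2 P.Ω} (hq : ContinuousOn q (Icc 0 P.T)) (j : Fin Ns) {V : ℝ → E d → ℝ}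
    (hV : ContDiff ℝ 2 (Function.uncurry V)) (ha : 0 ≤ a) (hab : a ≤ b) (hb : b ≤ P.T) :
    ∫ t in a..b, ∫ x in frontier (𝓜.elem j) ∩ frontier P.Ω,
        fluxDensity (𝓜.elem j) c (q t) (V t) x ∂(surf d)
      = (∫ t in a..b, ∫ x in frontier (𝓜.elem j) ∩ P.ΓD,
          fluxDensity (𝓜.elem j) c (q t) (V t) x ∂(surf d))
        + (∫ t in a..b, ∫ x in frontier (𝓜.elem j) ∩ P.ΓN,
          fluxDensity (𝓜.elem j) c (q t) (V t) x ∂(surf d))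
        + ∫ t in a..b, ∫ x in frontier (𝓜.elem j) ∩ P.ΓR,
          fluxDensity (𝓜.elem j) c (q t) (V t) x ∂(surf d) := by
  have hcb : MemLp c ⊤ (bdry (𝓜.elem j)) :=
    ((𝓜.isPolytope j).memLp_top_of_lipschitzOn (hc j).choose_spec).2
  have ii : ∀ {S : Set (E d)}, MeasurableSet S → IntervalIntegrable (fun t =>
      ∫ x in frontier (𝓜.elem j) ∩ S, fluxDensity (𝓜.elem j) c (q t) (V t) x ∂(surf d))
      volume a b := fun hS => intervalIntegrable_of_continuousOn_Icc ha hab hb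
    ((𝓜.isCell hd j).continuousOn_flux hcb hV hq hS)
  rw [← intervalIntegral.integral_add (ii P.measurableSet_ΓD) (ii P.measurableSet_ΓN),
    ← intervalIntegral.integral_add ((ii P.measurableSet_ΓD).add (ii P.measurableSet_ΓN))
      (ii P.measurableSet_ΓR)]
  refine intervalIntegral.integral_congr fun t _ => ?_
  exact 𝓜.integral_boundary_parts j
    ((𝓜.isCell hd j).integrable_fluxDensity hcb _ (contDiff_slice hV t))

end Mesh

end Slabs

/-! ### Consistency -/

section Consistency

variable {d Nt Ns : ℕ} {P : Problem d} {u : ℝ → H2 P.Ω} (𝓜 : Mesh P Nt Ns)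

namespace Mesh

lemma node_nonneg (i : Fin (Nt + 1)) : 0 ≤ 𝓜.node i := by
  rw [← 𝓜.node_zero]; exact 𝓜.node_strictMono.monotone (Fin.zero_le i)

lemma node_le (i : Fin (Nt + 1)) : 𝓜.node i ≤ P.T := by
  rw [← 𝓜.node_last]; exact 𝓜.node_strictMono.monotone (Fin.le_last i)

lemma node_castSucc_le (i : Fin Nt) : 𝓜.node i.castSucc ≤ 𝓜.node i.succ :=
  𝓜.node_strictMono.monotone (Fin.castSucc_lt_succ).le

lemma ae_slab (i : Fin Nt) {p : ℝ → Prop} (h : ∀ᵐ t ∂(volume.restrict (Ioo 0 P.T)), p t) :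
    ∀ᵐ t ∂(volume.restrict (Ioc (𝓜.node i.castSucc) (𝓜.node i.succ))), p t :=
  ae_restrict_Ioc_of_Ioo (𝓜.node_nonneg _) (𝓜.node_le _) h

lemma intBoundary_congr {Γ : Set (E d)} {g g' : Fin Nt → Fin Ns → ℝ → E d → ℝ}
    (h : ∀ i j, ∀ᵐ t ∂(volume.restrict (Ioo 0 P.T)),
      ∀ᵐ x ∂((surf d).restrict (frontier (𝓜.elem j) ∩ Γ)), g i j t x = g' i j t x) :
    𝓜.intBoundary Γ g = 𝓜.intBoundary Γ g' := by
  refine Finset.sum_congr rfl fun i _ => Finset.sum_congr rfl fun j _ => ?_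
  refine interval_integral_congr (𝓜.node_castSucc_le i) ?_
  filter_upwards [𝓜.ae_slab i (h i j)] with t ht
  exact integral_congr_ae ht

lemma ae_boundary_normal (j : Fin Ns) {Γ : Set (E d)} (hm : MeasurableSet Γ)
    (hΓ : Γ ⊆ frontier P.Ω) : ∀ᵐ x ∂((surf d).restrict (frontier (𝓜.elem j) ∩ Γ)),
      ‖outwardNormal (𝓜.elem j) x‖ = 1 ∧ outwardNormal P.Ω x = outwardNormal (𝓜.elem j) x := by
  filter_upwards [ae_restrict_of_ae 𝓜.surf_ae_structure,
    ae_restrict_mem (isClosed_frontier.measurableSet.inter hm)] with x hx hxm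
  obtain ⟨h0, -, -, h1⟩ := hx j hxm.1
  refine ⟨h0.1, h1 fun hxΩ => (hΓ hxm.2).2 ?_⟩
  rwa [P.isOpen_Ω.interior_eq]

lemma ae_boundary_trace (hd : 1 ≤ d) (j : Fin Ns) {Γ : Set (E d)} (hΓ : Γ ⊆ frontier P.Ω)
    (p : H1 P.Ω) {g : E d → ℝ} (hg : IsTrace P.Ω p.1.1 g) :
    ∀ᵐ x ∂((surf d).restrict (frontier (𝓜.elem j) ∩ Γ)), trace (𝓜.elem j) p.1.1 x = g x :=
  ae_mono (Measure.restrict_mono (inter_subset_inter_right _ hΓ) le_rfl)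
    ((𝓜.isCell hd j).trace_ae_eq_of_isTrace p hg)

lemma ae_boundary_traceVec (hd : 1 ≤ d) (j : Fin Ns) {Γ : Set (E d)} (hΓ : Γ ⊆ frontier P.Ω)
    (w : H2 P.Ω) {p : E d → E d} (hp : ∀ k, IsTrace P.Ω (fun x => H2.grad w x k) fun x => p x k) :
    ∀ᵐ x ∂((surf d).restrict (frontier (𝓜.elem j) ∩ Γ)),
      traceVec (𝓜.elem j) (H2.grad w) x = p x := by
  have h : ∀ᵐ x ∂((surf d).restrict (frontier (𝓜.elem j) ∩ Γ)), ∀ k,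
      trace (𝓜.elem j) (H2.gradH1 k w).1.1 x = p x k := ae_all_iff.2 fun k =>
    𝓜.ae_boundary_trace hd j hΓ (H2.gradH1 k w) ((hp k).congr_ae (H2.gradH1_fst k w).symm)
  filter_upwards [h] with x hx
  ext k
  rw [(𝓜.isCell hd j).traceVec_grad, hx]

lemma ae_of_part {Γ : Set (E d)} (j : Fin Ns) {p : E d → Prop}
    (h : ∀ᵐ x ∂((surf d).restrict Γ), p x) :
    ∀ᵐ x ∂((surf d).restrict (frontier (𝓜.elem j) ∩ Γ)), p x :=
  ae_mono (Measure.restrict_mono inter_subset_right le_rfl) h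

lemma ae_dirichlet (hd : 1 ≤ d) (hsol : IsSolution P u) (j : Fin Ns) :
    ∀ᵐ t ∂(volume.restrict (Ioo 0 P.T)), ∀ᵐ x ∂((surf d).restrict (frontier (𝓜.elem j) ∩ P.ΓD)),
      trace (𝓜.elem j) (H2.toL2 (u t)) x = P.gD t x := by
  filter_upwards [hsol.dirichlet] with t ht
  obtain ⟨g, hg, hgD⟩ := ht
  filter_upwards [𝓜.ae_boundary_trace hd j P.ΓD_subset (H2.toH1 (u t)) hg, 𝓜.ae_of_part j hgD]
    with x h1 h2
  rw [← h2, ← h1, H2.toH1_fst]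

lemma ae_neumann (hd : 1 ≤ d) (hsol : IsSolution P u) (j : Fin Ns) :
    ∀ᵐ t ∂(volume.restrict (Ioo 0 P.T)), ∀ᵐ x ∂((surf d).restrict (frontier (𝓜.elem j) ∩ P.ΓN)),
      inner ℝ (outwardNormal (𝓜.elem j) x) (traceVec (𝓜.elem j) (H2.grad (u t)) x)
        = P.gN t x := by
  filter_upwards [hsol.neumann] with t ht
  obtain ⟨p, hp, hgN⟩ := ht
  filter_upwards [𝓜.ae_boundary_traceVec hd j P.ΓN_subset (u t) hp, 𝓜.ae_of_part j hgN,
    𝓜.ae_boundary_normal j P.measurableSet_ΓN P.ΓN_subset] with x h1 h2 h3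
  rw [← h2, h1, h3.2, real_inner_comm]

lemma ae_robin (hd : 1 ≤ d) (hsol : IsSolution P u) (j : Fin Ns) :
    ∀ᵐ t ∂(volume.restrict (Ioo 0 P.T)), ∀ᵐ x ∂((surf d).restrict (frontier (𝓜.elem j) ∩ P.ΓR)),
      inner ℝ (outwardNormal (𝓜.elem j) x) (traceVec (𝓜.elem j) (H2.grad (u t)) x)
        + P.κ x * trace (𝓜.elem j) (H2.toL2 (u t)) x = P.gR t x := by
  filter_upwards [hsol.robin] with t ht
  obtain ⟨p, g, hp, hg, hgR⟩ := ht
  filter_upwards [𝓜.ae_boundary_traceVec hd j P.ΓR_subset (u t) hp,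
    𝓜.ae_boundary_trace hd j P.ΓR_subset (H2.toH1 (u t)) hg, 𝓜.ae_of_part j hgR,
    𝓜.ae_boundary_normal j P.measurableSet_ΓR P.ΓR_subset] with x h1 h0 h2 h3
  rw [H2.toH1_fst] at h0
  rw [← h2, h1, h0, h3.2, real_inner_comm]

lemma jump_ofCurve (hd : 1 ≤ d) (w : H2 P.Ω) {j k : Fin Ns} (hjk : j ≠ k) :
    ∀ᵐ x ∂((surf d).restrict (𝓜.elem j ∩ 𝓜.elem k)),
      𝓜.jump (fun _ => H2.toL2 w) j k x = 0 := by
  have hm : MeasurableSet (𝓜.elem j ∩ 𝓜.elem k) :=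
    (𝓜.isClosed_elem j).measurableSet.inter (𝓜.isClosed_elem k).measurableSet
  filter_upwards [𝓜.trace_ae_eq hd (H2.toH1 w) hjk, ae_restrict_of_ae 𝓜.surf_ae_structure,
    ae_restrict_mem hm] with x h1 h2 h3
  rw [H2.toH1_fst] at h1
  rw [jump, h1, ((h2 j (mem_frontier_of_mem_inter hjk h3.1 h3.2)).2.1 k hjk.symm h3.2).1, smul_neg,
    add_neg_cancel]

lemma intInterior_jump_zero (hd : 1 ≤ d) (c : Fin Nt → E d → ℝ)
    (G : Fin Nt → Fin Ns → Fin Ns → ℝ → E d → E d) :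
    𝓜.intInterior (fun i j k t x => c i x *
      inner ℝ (𝓜.jump (fun _ => H2.toL2 (u t)) j k x) (G i j k t x)) = 0 := by
  refine Finset.sum_eq_zero fun i _ => Finset.sum_eq_zero fun j _ => Finset.sum_eq_zero fun k hk => ?_
  have : ∀ t, ∫ x in 𝓜.elem j ∩ 𝓜.elem k, c i x *
      inner ℝ (𝓜.jump (fun _ => H2.toL2 (u t)) j k x) (G i j k t x) ∂(surf d) = 0 := by
    intro t
    refine integral_eq_zero_of_ae ?_
    filter_upwards [𝓜.jump_ofCurve hd (u t) (Finset.mem_Ioi.1 hk).ne] with x hx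
    simp [hx]
  simp [this]

/-- The jump of `u` vanishes on interior faces and is the Dirichlet datum times the normal on
Dirichlet faces; only data remain. -/
lemma intJumpAvg_curve (hd : 1 ≤ d) (hsol : IsSolution P u)
    (q : Fin Nt → Fin Ns → ℝ → E d → E d) :
    𝓜.intJumpAvg P.ΓD (fun x => P.ξ x ^ 2) (fun _ _ t => H2.toL2 (u t)) q
      = 𝓜.intBoundary P.ΓD (fun i j t x => P.ξ x ^ 2 * P.gD t x *
        inner ℝ (outwardNormal (𝓜.elem j) x) (traceVec (𝓜.elem j) (q i j t) x)) := by
  rw [intJumpAvg, 𝓜.intInterior_jump_zero hd (fun _ x => P.ξ x ^ 2), zero_add]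
  refine 𝓜.intBoundary_congr fun i j => ?_
  filter_upwards [𝓜.ae_dirichlet hd hsol j] with t ht
  filter_upwards [ht] with x hx
  rw [bJump, bAvg, hx, real_inner_smul_left]
  ring

/-- As in `intJumpAvg_curve`; on Dirichlet faces the two copies of the normal contribute its squared
length, which is 1 almost everywhere. -/
lemma intJumpJump_curve (hd : 1 ≤ d) (hsol : IsSolution P u) (β : Fin Nt → E d → ℝ)
    (v : Fin Nt → Fin Ns → ℝ → E d → ℝ) :
    𝓜.intJumpJump P.ΓD (fun i x => β i x * P.ξ x ^ 2) (fun _ _ t => H2.toL2 (u t)) v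
      = 𝓜.intBoundary P.ΓD (fun i j t x => β i x * P.ξ x ^ 2 * P.gD t x *
        trace (𝓜.elem j) (v i j t) x) := by
  rw [intJumpJump, 𝓜.intInterior_jump_zero hd (fun i x => β i x * P.ξ x ^ 2), zero_add]
  refine 𝓜.intBoundary_congr fun i j => ?_
  filter_upwards [𝓜.ae_dirichlet hd hsol j] with t ht
  filter_upwards [ht, 𝓜.ae_boundary_normal j P.measurableSet_ΓD P.ΓD_subset] with x hx hn
  rw [bJump, bJump, hx, real_inner_smul_left, real_inner_smul_right, real_inner_self_eq_norm_sq,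
    hn.1]
  ring

lemma intBoundary_neumann (hd : 1 ≤ d) (hsol : IsSolution P u)
    (v : Fin Nt → Fin Ns → ℝ → E d → ℝ) :
    𝓜.intBoundary P.ΓN (fun i j t => fluxDensity (𝓜.elem j) (fun x => P.ξ x ^ 2) (u t) (v i j t))
      = 𝓜.intBoundary P.ΓN (fun i j t x => P.ξ x ^ 2 * P.gN t x *
        trace (𝓜.elem j) (v i j t) x) := by
  refine 𝓜.intBoundary_congr fun i j => ?_
  filter_upwards [𝓜.ae_neumann hd hsol j] with t ht
  filter_upwards [ht] with x hx
  rw [fluxDensity, real_inner_smul_left, hx]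
  ring

/-- The condition prescribes only the sum of normal derivative and `κ u`, so the two integrals have
to be merged first; for this each of them must be integrable in space and in time. -/
lemma intBoundary_robin (hd : 1 ≤ d) (hu : ContDiffOn ℝ 1 u (Icc 0 P.T)) (hsol : IsSolution P u)
    {v : Fin Nt → Fin Ns → ℝ → E d → ℝ} (hv : ∀ i j, ContDiff ℝ 2 (Function.uncurry (v i j))) :
    𝓜.intBoundary P.ΓR (fun i j t => fluxDensity (𝓜.elem j) (fun x => P.ξ x ^ 2) (u t) (v i j t))
      + 𝓜.intBoundary P.ΓR (fun i j t x => P.ξ x ^ 2 * P.κ x *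
          trace (𝓜.elem j) (H2.toL2 (u t)) x * trace (𝓜.elem j) (v i j t) x)
      = 𝓜.intBoundary P.ΓR (fun i j t x => P.ξ x ^ 2 * P.gR t x *
        trace (𝓜.elem j) (v i j t) x) := by
  simp only [intBoundary, ← Finset.sum_add_distrib]
  refine Finset.sum_congr rfl fun i _ => Finset.sum_congr rfl fun j _ => ?_
  obtain ⟨C, hC⟩ := 𝓜.lipschitzOn_ξ_sq j
  have hξ := ((𝓜.isPolytope j).memLp_top_of_lipschitzOn hC).2
  have hm := P.measurableSet_ΓR
  have hκ : MemLp (fun x => P.ξ x ^ 2 * P.κ x) ⊤ ((bdry (𝓜.elem j)).restrict P.ΓR) := by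
    refine MemLp.smul (p := ⊤) (q := ⊤) (P.κ_bdd.mono_measure ?_) (hξ.mono_measure
      Measure.restrict_le_self)
    rw [Measure.restrict_restrict hm]
    exact Measure.restrict_mono inter_subset_left le_rfl
  obtain ⟨r1, r2⟩ := (𝓜.isCell hd j).robin hm hκ (hv i j) hu.continuousOn
  have f2 := (𝓜.isCell hd j).continuousOn_flux hξ (hv i j) hu.continuousOn hm
  have ha := 𝓜.node_nonneg i.castSucc
  have hab := 𝓜.node_castSucc_le i
  have hb := 𝓜.node_le i.succ
  rw [← intervalIntegral.integral_add (intervalIntegrable_of_continuousOn_Icc ha hab hb f2)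
    (intervalIntegrable_of_continuousOn_Icc ha hab hb r2)]
  refine interval_integral_congr hab ?_
  filter_upwards [𝓜.ae_slab i (𝓜.ae_robin hd hsol j)] with t ht
  have f1 : IntegrableOn (fluxDensity (𝓜.elem j) (fun x => P.ξ x ^ 2) (u t) (v i j t))
      (frontier (𝓜.elem j) ∩ P.ΓR) (surf d) :=
    IntegrableOn.mono_set ((𝓜.isCell hd j).integrable_fluxDensity hξ (u t)
      (contDiff_slice (hv i j) t)) inter_subset_left
  rw [← integral_add f1 (r1 t)]
  refine integral_congr_ae ?_
  filter_upwards [ht] with x hx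
  rw [fluxDensity, real_inner_smul_left, ← hx]
  ring

lemma sum_flux_eq_intJumpAvg (hd : 1 ≤ d) {c : E d → ℝ}
    (hc : ∀ j, ∃ C, LipschitzOnWith C c (𝓜.elem j)) {q : ℝ → H2 P.Ω}
    (hq : ContinuousOn q (Icc 0 P.T)) {v : Fin Nt → Fin Ns → ℝ → E d → ℝ}
    (hv : ∀ i j, ContDiff ℝ 2 (Function.uncurry (v i j))) :
    ∑ i, ∑ j, ∫ t in 𝓜.node i.castSucc..𝓜.node i.succ,
        ∫ x, fluxDensity (𝓜.elem j) c (q t) (v i j t) x ∂(bdry (𝓜.elem j))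
      = 𝓜.intJumpAvg (frontier P.Ω) c v (fun _ _ t => H2.grad (q t)) := by
  rw [intJumpAvg, intInterior, intBoundary, ← Finset.sum_add_distrib]
  exact Finset.sum_congr rfl fun i _ => 𝓜.sum_flux_eq hd hc hq (hv i) (𝓜.node_nonneg _)
    (𝓜.node_castSucc_le i) (𝓜.node_le _)

/-- In the `ξ²` terms of the bilinear form jumps and averages are taken only over interior and
Dirichlet faces. The Neumann and Robin fluxes are split off here to be replaced by data. -/
lemma intJumpAvg_frontier (hd : 1 ≤ d) {c : E d → ℝ}
    (hc : ∀ j, ∃ C, LipschitzOnWith C c (𝓜.elem j)) {q : ℝ → H2 P.Ω}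
    (hq : ContinuousOn q (Icc 0 P.T)) {v : Fin Nt → Fin Ns → ℝ → E d → ℝ}
    (hv : ∀ i j, ContDiff ℝ 2 (Function.uncurry (v i j))) :
    𝓜.intJumpAvg (frontier P.Ω) c v (fun _ _ t => H2.grad (q t))
      = 𝓜.intJumpAvg P.ΓD c v (fun _ _ t => H2.grad (q t))
        + 𝓜.intBoundary P.ΓN (fun i j t => fluxDensity (𝓜.elem j) c (q t) (v i j t))
        + 𝓜.intBoundary P.ΓR (fun i j t => fluxDensity (𝓜.elem j) c (q t) (v i j t)) := by
  have h : 𝓜.intBoundary (frontier P.Ω) (fun i j t => fluxDensity (𝓜.elem j) c (q t) (v i j t))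
      = 𝓜.intBoundary P.ΓD (fun i j t => fluxDensity (𝓜.elem j) c (q t) (v i j t))
        + 𝓜.intBoundary P.ΓN (fun i j t => fluxDensity (𝓜.elem j) c (q t) (v i j t))
        + 𝓜.intBoundary P.ΓR (fun i j t => fluxDensity (𝓜.elem j) c (q t) (v i j t)) := by
    simp only [intBoundary, ← Finset.sum_add_distrib]
    exact Finset.sum_congr rfl fun i _ => Finset.sum_congr rfl fun j _ =>
      𝓜.flux_boundary_parts hd hc hq j (hv i j) (𝓜.node_nonneg _) (𝓜.node_castSucc_le i)
        (𝓜.node_le _)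
  change _ + 𝓜.intBoundary (frontier P.Ω)
      (fun i j t => fluxDensity (𝓜.elem j) c (q t) (v i j t))
    = _ + 𝓜.intBoundary P.ΓD (fun i j t => fluxDensity (𝓜.elem j) c (q t) (v i j t)) + _ + _
  rw [h]
  ring

/-- The one-sided convention at the last node agrees with this value because `right` is zero there;
taking `n.succ` excludes the first node. -/
lemma tAvg_const (g : ℝ → ℝ) (n : Fin Nt) :
    𝓜.tAvg (fun _ => g) n.succ = g (𝓜.node n.succ) := by
  have h1 : 𝓜.left (fun _ => g) n.succ = g (𝓜.node n.succ) := by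
    rw [left, dif_neg (Fin.succ_ne_zero n)]
  by_cases h : n.succ = Fin.last Nt
  · rw [tAvg, if_pos (Or.inr h), h1, right, dif_pos h, add_zero]
  · rw [tAvg, if_neg (not_or.2 ⟨Fin.succ_ne_zero n, h⟩), h1, right, dif_neg h]
    ring

lemma tJump_const (g : ℝ → ℝ) {n : Fin (Nt + 1)} (h0 : n ≠ 0) (hl : n ≠ Fin.last Nt) :
    𝓜.tJump (fun _ => g) n = 0 := by
  rw [tJump, left, right, dif_neg h0, dif_neg hl, sub_self]

lemma left_zero (w : Fin Nt → ℝ → ℝ) : 𝓜.left w 0 = 0 := by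
  rw [left, dif_pos rfl]

variable [NeZero Nt]

lemma zero_ne_last : (0 : Fin (Nt + 1)) ≠ Fin.last Nt := by
  intro h
  have := congrArg Fin.val h
  simp only [Fin.val_zero, Fin.val_last] at this
  exact NeZero.ne Nt this.symm

lemma right_zero (w : Fin Nt → ℝ → ℝ) : 𝓜.right w 0 = w 0 0 := by
  rw [right, dif_neg zero_ne_last, 𝓜.node_zero]
  congr 1

lemma tJump_zero (w : Fin Nt → ℝ → ℝ) : 𝓜.tJump w 0 = -w 0 0 := by
  rw [tJump, left_zero, right_zero, zero_sub]

lemma tAvg_zero (w : Fin Nt → ℝ → ℝ) : 𝓜.tAvg w 0 = w 0 0 := by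
  rw [tAvg, if_pos (Or.inl rfl), left_zero, right_zero, zero_add]

/-- A single curve takes the same value from both sides of an interior node, so only the node `t_0`
contributes, where the jump is minus the initial value. The weight `w` is free in order to cover
both the average term and the penalty term. -/
lemma sum_tJump_curve (hsol : IsSolution P u) (w : Fin (Nt + 1) → Fin Ns → E d → ℝ) :
    ∑ n : Fin Nt, 𝓜.intSpace (fun j x =>
        𝓜.tJump (fun _ t => H2.toL2 (u t) x) n.castSucc * w n.castSucc j x)
      = -𝓜.intSpace (fun j x => P.u0 x * w 0 j x) := by
  rw [Finset.sum_eq_single (0 : Fin Nt)]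
  · rw [Fin.castSucc_zero', intSpace, intSpace, ← Finset.sum_neg_distrib]
    refine Finset.sum_congr rfl fun j _ => ?_
    rw [← integral_neg]
    have hle : (volume : Measure (E d)).restrict (𝓜.elem j) ≪ volume.restrict P.Ω := by
      rw [← (𝓜.isPolytope j).restrict_interior]
      exact Measure.absolutelyContinuous_of_le
        (Measure.restrict_mono (𝓜.interior_subset j) le_rfl)
    refine integral_congr_ae ?_
    filter_upwards [hle hsol.init_value] with x hx
    rw [tJump_zero, hx]
    ring
  · intro n _ hn
    have h0 : n.castSucc ≠ 0 := fun h => hn (by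
      rw [← Fin.castSucc_zero'] at h; exact Fin.castSucc_injective _ h)
    simp only [intSpace, 𝓜.tJump_const _ h0 (Fin.castSucc_ne_last n), zero_mul, integral_zero,
      Finset.sum_const_zero]
  · simp

/-- Summation by parts over the time nodes. -/
lemma sum_tJump_tAvg (hd : 1 ≤ d) (hsol : IsSolution P u)
    {v : Fin Nt → Fin Ns → ℝ → E d → ℝ}
    (hv : ∀ i j, ContDiff ℝ 2 (Function.uncurry (v i j))) :
    ∑ n : Fin Nt, 𝓜.intSpace (fun j x => 𝓜.tJump (fun i t => v i j t x) n.succ *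
        𝓜.tAvg (fun _ t => H2.toL2 (timeDeriv P u t) x) n.succ)
      = (∑ i : Fin Nt, ∑ j,
          ((∫ x in 𝓜.elem j, H2.toL2 (timeDeriv P u (𝓜.node i.succ)) x * v i j (𝓜.node i.succ) x)
          - ∫ x in 𝓜.elem j,
              H2.toL2 (timeDeriv P u (𝓜.node i.castSucc)) x * v i j (𝓜.node i.castSucc) x))
        + 𝓜.intSpace (fun j x => P.w0 x * v 0 j 0 x) := by
  simp only [intSpace]
  rw [Finset.sum_comm, Finset.sum_comm (s := (Finset.univ : Finset (Fin Nt))),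
    ← Finset.sum_add_distrib]
  refine Finset.sum_congr rfl fun j _ => ?_
  have hK := 𝓜.isCell hd j
  let W : ℝ → E d → ℝ := fun t => H2.toL2 (timeDeriv P u t)
  have hint : ∀ i t s, Integrable (fun x => W s x * v i j t x) (volume.restrict (𝓜.elem j)) := by
    intro i t s
    simpa only [one_mul] using hK.integrable_mul (c := fun _ => 1)
      (hK.polytope.memLp_volume continuous_const ⊤) (contDiff_slice (hv i j) t).continuous
      (H2.toL2 (timeDeriv P u s))
  -- Contribution of the value of `v` to the right of node `m`. The convention that `right` vanishes
  -- at the last node lets one formula cover all nodes.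
  let R : Fin (Nt + 1) → ℝ := fun m => ∫ x in 𝓜.elem j,
    W (𝓜.node m) x * 𝓜.right (fun i t => v i j t x) m
  have hR : ∀ m, Integrable (fun x => W (𝓜.node m) x * 𝓜.right (fun i t => v i j t x) m)
      (volume.restrict (𝓜.elem j)) := by
    intro m
    by_cases h : m = Fin.last Nt
    · simp [right, h]
    · simp only [right, dif_neg h]; exact hint _ _ _
  have hRlast : R (Fin.last Nt) = 0 := by simp [R, right]
  have hRcast : ∀ n : Fin Nt, R n.castSucc
      = ∫ x in 𝓜.elem j, W (𝓜.node n.castSucc) x * v n j (𝓜.node n.castSucc) x := by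
    intro n
    simp only [R, right, dif_neg (Fin.castSucc_ne_last n), Fin.castPred_castSucc]
  have hR0 : R 0 = ∫ x in 𝓜.elem j, P.w0 x * v 0 j 0 x := by
    simp only [R, 𝓜.right_zero, 𝓜.node_zero]
    refine integral_congr_ae ?_
    filter_upwards [Measure.absolutelyContinuous_of_le hK.restrict_le hsol.init_velocity]
      with x hx
    simp only [W, hx]
  have hstep : ∀ n : Fin Nt, ∫ x in 𝓜.elem j, 𝓜.tJump (fun i t => v i j t x) n.succ *
        𝓜.tAvg (fun _ t => H2.toL2 (timeDeriv P u t) x) n.succ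
      = (∫ x in 𝓜.elem j, W (𝓜.node n.succ) x * v n j (𝓜.node n.succ) x) - R n.succ := by
    intro n
    rw [← integral_sub (hint _ _ _) (hR _)]
    refine integral_congr_ae (Eventually.of_forall fun x => ?_)
    simp only [𝓜.tAvg_const, tJump, left, dif_neg (Fin.succ_ne_zero n), Fin.pred_succ, W]
    ring
  -- Index shift: jumps are summed over the ends of the slabs and right-hand values over their
  -- beginnings. The difference is the term at `t_0`, which carries the initial velocity, since `R`
  -- vanishes at the last node.
  have hsum : R 0 + ∑ n : Fin Nt, R n.succ = ∑ n : Fin Nt, R n.castSucc := by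
    rw [← Fin.sum_univ_succ, Fin.sum_univ_castSucc, hRlast, add_zero]
  rw [← hR0]
  simp only [hstep, Finset.sum_sub_distrib]
  have e : ∑ n : Fin Nt, ∫ x in 𝓜.elem j,
      H2.toL2 (timeDeriv P u (𝓜.node n.castSucc)) x * v n j (𝓜.node n.castSucc) x
      = R 0 + ∑ n : Fin Nt, R n.succ := by
    rw [hsum]; exact Finset.sum_congr rfl fun n _ => (hRcast n).symm
  rw [e]
  ring

/-- Consistency for piecewise `C²` test functions. -/
theorem B_ofCurve_eq_l (hd : 1 ≤ d) (hu : ContDiffOn ℝ 1 u (Icc 0 P.T)) (hsol : IsSolution P u)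
    (β₁ : Fin (Nt + 1) → Fin Ns → ℝ) (β₂ : Fin Nt → E d → ℝ)
    {v : Fin Nt → Fin Ns → ℝ → E d → ℝ}
    (hv : ∀ i j, ContDiff ℝ 2 (Function.uncurry (v i j))) :
    𝓜.B β₁ β₂ (Broken.ofCurve Nt Ns P u) (Broken.ofPieces v)
      = 𝓜.l β₁ β₂ (Broken.ofPieces v) := by
  have hW := continuousOn_timeDeriv hu
  -- The element equations summed over the mesh. The rewrites that follow turn the element fluxes
  -- into face integrals and insert the Neumann data.
  have eq1 : ∑ i : Fin Nt, ∑ j, _ = ∑ i : Fin Nt, ∑ j, _ :=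
    Finset.sum_congr rfl fun i _ => Finset.sum_congr rfl fun j _ =>
      𝓜.element_equation hd hu hsol (𝓜.node_nonneg i.castSucc) (𝓜.node_castSucc_le i)
        (𝓜.node_le i.succ) j (hv i j)
  simp only [Finset.sum_sub_distrib, Finset.sum_add_distrib, Finset.sum_neg_distrib] at eq1
  rw [𝓜.sum_flux_eq_intJumpAvg hd 𝓜.lipschitzOn_η hW hv,
    𝓜.sum_flux_eq_intJumpAvg hd 𝓜.lipschitzOn_ξ_sq hu.continuousOn hv,
    𝓜.intJumpAvg_frontier hd 𝓜.lipschitzOn_ξ_sq hu.continuousOn hv,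
    𝓜.intBoundary_neumann hd hsol] at eq1
  have eq2 := 𝓜.intBoundary_robin hd hu hsol hv
  have eq3 := 𝓜.sum_tJump_tAvg hd hsol hv
  simp only [Finset.sum_sub_distrib] at eq3
  -- At `t_0` the average of `∂ₜv` is its one-sided value and the jump of `v` is minus its value.
  -- This accounts for the signs of the two terms with the initial value in `l`.
  have eq4 := 𝓜.sum_tJump_curve hsol
    (fun n j x => 𝓜.tAvg (fun i t => deriv (fun s => v i j s x) t) n)
  have eq5 := 𝓜.sum_tJump_curve hsol
    (fun n j x => β₁ n j * 𝓜.tJump (fun i t => v i j t x) n)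
  simp only [tAvg_zero] at eq4
  simp only [tJump_zero] at eq5
  have eq6 : ∑ n : Fin Nt, 𝓜.intSpace (fun j x => β₁ n.castSucc j *
      𝓜.tJump (fun _ t => H2.toL2 (u t) x) n.castSucc *
        𝓜.tJump (fun i t => v i j t x) n.castSucc)
      = 𝓜.intSpace (fun j x => β₁ 0 j * P.u0 x * v 0 j 0 x) := by
    refine Eq.trans (Finset.sum_congr rfl fun n _ => ?_) (eq5.trans ?_)
    · refine Finset.sum_congr rfl fun j _ => integral_congr_ae (Eventually.of_forall fun x => ?_)
      simp only; ring
    · rw [intSpace, intSpace, ← Finset.sum_neg_distrib]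
      refine Finset.sum_congr rfl fun j _ => ?_
      rw [← integral_neg]
      refine integral_congr_ae (Eventually.of_forall fun x => ?_)
      simp only; ring
  have eq7 := 𝓜.intJumpAvg_curve hd hsol (fun i j t x => gradient (v i j t) x)
  have eq8 := 𝓜.intJumpJump_curve hd hsol β₂ v
  simp only [B, l, Broken.ofCurve, Broken.ofPieces]
  rw [eq3, eq4, eq6, eq7, eq8]
  simp only [intVolume]
  -- All remaining integrals are shared terms; `eq2` trades the Robin flux and the Robin term for
  -- the Robin data.
  linarith [eq1, eq2]

end Mesh

end Consistency

end LRNNDG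

end

theorem lemma1 (d : ℕ) (hd : 1 ≤ d) (hd' : d ≤ 3) (P : Problem d)
    (u : ℝ → H2 P.Ω) (hu : ContDiffOn ℝ 1 u (Set.Icc 0 P.T)) (hsol : IsSolution P u)
    (Nt Ns : ℕ) [NeZero Nt] (𝓜 : Mesh P Nt Ns)
    (act : ℝ → ℝ) (hact : ContDiff ℝ 2 act) (net : Fin Nt → Fin Ns → RandNet d)
    (β₁ : Fin (Nt + 1) → Fin Ns → ℝ) (β₂ : Fin Nt → E d → ℝ)
    (v : Fin Nt → Fin Ns → ℝ → E d → ℝ) (hv : v ∈ dgSpace act net) :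
    𝓜.B β₁ β₂ (Broken.ofCurve Nt Ns P u) (Broken.ofPieces v)
      = 𝓜.l β₁ β₂ (Broken.ofPieces v) := by
  exact 𝓜.B_ofCurve_eq_l hd hu hsol β₁ β₂ fun i j =>
    RandNet.contDiff_of_mem_space hact (hv i j)
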